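/- **Setting.** Let $\mathcal X$ be a measurable space and $\mu$ a probability measure on $\mathcal X\times\{-1,+1\}$ with marginal $\mu^{\mathcal X}$. Let $\mathcal H$ be a class of functions $h:\mathcal X\to\{-1,+1\}$ of finite VC dimension $\mathcal V$, pointwise measurable (its members are measurable and are pointwise limits of sequences from one countable subclass). Let $\Lambda=\ell^1(\mathcal H)$, $(H\lambda)_x=\sum_h h(x)\lambda(h)$, $(A\lambda)_{x,y}=-y(H\lambda)_x$, $\mathcal L(A\lambda)=\int\ell(A\lambda)\,d\mu$, $\bar{\mathcal L}=\inf_{\lambda\in\Lambda}\mathcal L(A\lambda)$; $\mathcal R(H\lambda)$ is the classification risk of the classifier predicting $+1$ iff $(H\lambda)_x\ge 0$, and $\mathcal R_\star$ the Bayes error rate. Hats denote the empirical versions for an i.i.d. sample of size $m$ from $\mu$. The loss $\ell:\mathbb R\to[0,\infty)$ is convex, twice continuously differentiable, $\lim_{z\to-\infty}\ell(z)=0$, Lipschitz with tightest constant $\beta_2$, $\ell'\in[0,\beta_2]$, $\ell'\ge\beta_1$ on $[0,\infty)$ for some $\beta_1>0$, and $\ell'$ is Lipschitz with tightest constant $B_2$.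 **Algorithm.** With $\rho\in(0,1)$ and $\lambda_0=0$, round $i$ picks $h_i\in\mathcal H$ with $|\langle A^\top\nabla\widehat{\mathcal L}(A\lambda_{i-1}),\mathbf e_{h_i}\rangle|\ge\rho\|A^\top\nabla\widehat{\mathcal L}(A\lambda_{i-1})\|_\infty$, a descent direction $v_i\in\{\pm\mathbf e_{h_i}\}$, and $\lambda_i=\lambda_{i-1}+\alpha_iv_i$, where $\alpha_i$ is any one of: an optimal step $\bar\alpha_i\in\arg\min_{\alpha\ge0}\widehat{\mathcal L}(A(\lambda_{i-1}+\alpha v_i))$; any step with $-\langle A^\top\nabla\widehat{\mathcal L}(A\lambda_{i-1}),v_i\rangle/B_2\le\alpha_i<\bar\alpha_i$ ($\bar\alpha_i=\infty$ if there is no optimal step); any nonnegative step satisfying the Wolfe conditions with constants $1/3$ and $1/2$. After $T$ rounds it returns $\hat\lambda\in\{\lambda_1,\dots,\lambda_T\}$ minimizing $\widehat{\mathcal R}(H\lambda_i)$. **Dual.** Let $\ell^*$ be the Fenchel conjugate. A *dual optimum* $\bar p$ is a maximizer of $-\int\ell^*(p)\,d\mu$ over $p\in L^\infty(\mu)$ with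 $p\in[0,\beta_2]$ a.e. and $A^\top p=0$, that is, $\int(A\lambda)p\,d\mu=0$ for all $\lambda\in\Lambda$. **Theorem.** There is a function $\psi:\mathbb R\to\mathbb R$, depending only on $\ell$, with $\psi(z)\to0$ as $z\to0$ and such that for every sequence $z_n\in[0,1]$, $\psi(z_n)\to0$ iff $z_n\to0$ (for the logistic loss $\ell(z)=\ln(1+e^z)$, $\psi(z)=z^2/2$ is such a function), for which the following holds for all $\mathcal X,\mu,\mathcal H$ as above with $\bar{\mathcal L}>0$. A dual optimum exists. Let $\bar p$ be any dual optimum. Then $\tau_0:=(\ell^*|_{[0,\ell'(0)]})^{-1}(-\bar{\mathcal L})/(2\max\{1,\beta_2\})$ satisfies $\tau_0>0$ and $\mu([\bar p\ge\tau_0])\ge\tau_0$. Let $\tau>0$ be any real with $\mu([\bar p\ge\tau])\ge\tau$ (for instance $\tau_0$), let $\rho,a\in(0,1)$, $\delta\in(0,1]$, and put $$c=\frac{16\,\ell(0)}{\tau\,\ell'(0)}\max\{1,\tfrac1\tau\}\max\{1,\|\bar p\|_\infty\},\quad B_1=\frac\tau8\inf_{z\in[-c,c]}\ell''(z),\quad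 R_i=\sqrt i\,\sqrt{\frac{\ell(0)\max\{5,2B_1/B_2\}}{\rho^2B_1}} .$$ Assume $\ell''>0$ on $[-c,c]$. Then $c$, $B_1$ and $R_i$ ($i\ge1$) are positive. Consider the conditions $$m\ge\frac2{\tau^2}\ln\frac4\delta,\qquad \frac{2(R_t+2c)\|\bar p\|_\infty}{\sqrt m}\Bigl(2\sqrt{2\mathcal V\ln(m+1)}+\sqrt{2\ln(4/\delta)}\Bigr)\le\frac{c\tau^2}8. \qquad(\ast)$$ For all sufficiently large $m$, $(\ast)$ holds for every $t\le m^a$. Whenever integers $m$ and $1\le t\le m^a$ satisfy $(\ast)$ and $t\le T\le\lceil m^a\rceil$, then with probability at least $1-\delta$ over the sample, simultaneously for every possible execution of $T$ rounds of the algorithm: 1. for every $\bar\lambda\in\Lambda$ with $\|\bar\lambda\|_1\le R_{t-1}$, $$\begin{aligned}\mathcal L(A\lambda_t)\le{}&\mathcal L(A\bar\lambda)+t^{-1/4}+R_{t-1}\sqrt{\tfrac2m\ln\tfrac6\delta}+\frac{2\beta_2R_t}{\sqrt m}\Bigl(2\sqrt{2\mathcal V\ln(m+1)}+\ell(R_t)\sqrt{2\ln(6/\delta)}\Bigr)\\&+\ell(0)\left(\frac{\|\bar\lambda\|_1}{\|\bar\lambda\|_1+\rho\,t^{1/4}/(4B_2R_1)}\right)^{\rho^3B_1/(9B_2)};\end{aligned}$$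 2. if $\mathrm{span}(\mathcal H)$ is dense, in the $L^1(\mu^{\mathcal X})$ distance, in the bounded measurable functions on $\mathcal X$, then $\psi(\mathcal R(H\lambda_t)-\mathcal R_\star)\le\mathcal L(A\lambda_t)-\bar{\mathcal L}$; 3. with $Q:=\bigl((\mathcal V+1)\ln(2em)+\ln(24/\delta)\bigr)\,\max\{T,m^a\}/m$ (for $T\le m^a$ the last factor is $1/m^{1-a}$), $$\mathcal R(H\hat\lambda)\le\mathcal R(H\lambda_t)+4\sqrt{\widehat{\mathcal R}(H\lambda_t)\,Q}+8Q .$$ -/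

import Mathlib

open MeasureTheory Set Filter Topology

universe u

noncomputable section

namespace Boost

variable {X : Type u}

/-! ### Losses -/

/-- The tightest Lipschitz constant of the loss. -/
def lipConst (ℓ : ℝ → ℝ) : ℝ :=
  sSup {r : ℝ | ∃ x y : ℝ, x ≠ y ∧ r = |ℓ x - ℓ y| / |x - y|}

/-- The tightest Lipschitz constant of the derivative of the loss. -/
def gradLipConst (ℓ : ℝ → ℝ) : ℝ :=
  sSup {r : ℝ | ∃ x y : ℝ, x ≠ y ∧ r = (deriv ℓ y - deriv ℓ x) / (y - x)}

/-- Convex differentiable nonnegative losses, Lipschitz with Lipschitz gradient, whose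
derivative lies in `[0, β₂]` everywhere and in `[β₁, β₂]` on the nonnegative reals for some
`0 < β₁ ≤ β₂`, and which tend to zero at `-∞`. -/
structure LossBds (ℓ : ℝ → ℝ) : Prop where
  nonneg : ∀ x, 0 ≤ ℓ x
  convex : ConvexOn ℝ univ ℓ
  differentiable : Differentiable ℝ ℓ
  lipschitz : ∃ K, LipschitzWith K ℓ
  deriv_mem : ∀ x, deriv ℓ x ∈ Icc 0 (lipConst ℓ)
  deriv_lower : ∃ β₁ : ℝ, 0 < β₁ ∧ β₁ ≤ lipConst ℓ ∧
    ∀ x, 0 ≤ x → deriv ℓ x ∈ Icc β₁ (lipConst ℓ)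
  grad_lipschitz : ∃ K, LipschitzWith K (deriv ℓ)
  tendsto_atBot : Tendsto ℓ atBot (𝓝 0)

/-- Twice continuously differentiable convex losses. -/
structure LossTd (ℓ : ℝ → ℝ) : Prop where
  convex : ConvexOn ℝ univ ℓ
  contDiff : ContDiff ℝ 2 ℓ

/-- The logistic loss. -/
def logisticLoss (x : ℝ) : ℝ := Real.log (1 + Real.exp x)

/-- The (real) value of the Fenchel conjugate. It is meaningful where the supremum is finite;
the points at which it is infinite are excluded explicitly in `DualFeasible`. -/
def conj (ℓ : ℝ → ℝ) (φ : ℝ) : ℝ := sSup (range fun x : ℝ => φ * x - ℓ x)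

/-- The inverse of the conjugate along `[0, ℓ'(0)]`. -/
def conjInv (ℓ : ℝ → ℝ) (v : ℝ) : ℝ :=
  Function.invFunOn (conj ℓ) (Icc 0 (deriv ℓ 0)) v

/-! ### Weak learners, weightings, and the operators `H` and `A` -/

/-- Labels: `true` stands for `+1`, `false` for `-1`. -/
def sgn (y : Bool) : ℝ := if y then 1 else -1

/-- Absolutely summable weightings of the class `H`, with the `ℓ¹` norm. -/
abbrev Weights (H : Set (X → ℝ)) := lp (fun _ : H => ℝ) 1

/-- `(Hλ)(x) = ∑ₕ h(x) λ(h)`. -/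
def opH {H : Set (X → ℝ)} (lam : Weights H) (x : X) : ℝ := ∑' h : H, h.1 x * lam h

/-- `(Aλ)(x, y) = -y (Hλ)(x)`. -/
def opA {H : Set (X → ℝ)} (lam : Weights H) (z : X × Bool) : ℝ := -sgn z.2 * opH lam z.1

open Classical in
/-- The weighting with unit mass on `h`. -/
def unitWeight {H : Set (X → ℝ)} (h : H) : Weights H :=
  lp.single (E := fun _ : H => ℝ) 1 h 1

/-- Every weak learner takes values in `{-1, +1}`. -/
def IsBinary (H : Set (X → ℝ)) : Prop := ∀ h ∈ H, ∀ x, h x = 1 ∨ h x = -1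

/-- Pointwise measurable class: its members are measurable, and each is a pointwise limit of a
sequence taken from a fixed countable subclass. -/
def PointwiseMeasurable [MeasurableSpace X] (H : Set (X → ℝ)) : Prop :=
  (∀ h ∈ H, Measurable h) ∧
  ∃ H₀ ⊆ H, H₀.Countable ∧ ∀ h ∈ H, ∃ g : ℕ → X → ℝ, (∀ n, g n ∈ H₀) ∧
    ∀ x, Tendsto (fun n => g n x) atTop (𝓝 (h x))

/-- The finite set `s` is shattered by the binary class `H`. -/
def Shatters (H : Set (X → ℝ)) (s : Finset X) : Prop :=
  ∀ b ⊆ s, ∃ h ∈ H, ∀ x ∈ s, h x = 1 ↔ x ∈ b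

/-- Finite VC dimension. -/
def FiniteVC (H : Set (X → ℝ)) : Prop :=
  BddAbove {n : ℕ | ∃ s : Finset X, s.card = n ∧ Shatters H s}

/-- The VC dimension. -/
def vcDim (H : Set (X → ℝ)) : ℕ := sSup {n : ℕ | ∃ s : Finset X, s.card = n ∧ Shatters H s}

/-- The linear span of `H` is dense, for the `L¹(ν)` distance, in the bounded measurable
functions. -/
def DenseClass [MeasurableSpace X] (H : Set (X → ℝ)) (ν : Measure X) : Prop :=
  ∀ g : X → ℝ, Measurable g → (∃ C, ∀ x, |g x| ≤ C) → ∀ ε : ℝ, 0 < ε →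
    ∃ f ∈ Submodule.span ℝ H, ∫ x, |f x - g x| ∂ν < ε

/-! ### Risks -/

/-- Convex surrogate risk of `Aλ`. -/
def risk [MeasurableSpace X] (ℓ : ℝ → ℝ) (μ : Measure (X × Bool)) {H : Set (X → ℝ)}
    (lam : Weights H) : ℝ := ∫ z, ℓ (opA lam z) ∂μ

/-- Optimal surrogate risk over all weightings. -/
def optRisk [MeasurableSpace X] (ℓ : ℝ → ℝ) (μ : Measure (X × Bool)) (H : Set (X → ℝ)) : ℝ :=
  ⨅ lam : Weights H, risk ℓ μ lam

/-- Empirical surrogate risk. -/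
def empRisk {m : ℕ} (ℓ : ℝ → ℝ) (S : Fin m → X × Bool) {H : Set (X → ℝ)}
    (lam : Weights H) : ℝ := (1 / (m : ℝ)) * ∑ i, ℓ (opA lam (S i))

open Classical in
/-- Classification error of the real-valued predictor `f`, predicting `+1` iff `f ≥ 0`. -/
def classErr (f : X → ℝ) (z : X × Bool) : ℝ :=
  if (z.2 = true ∧ f z.1 < 0) ∨ (z.2 = false ∧ 0 ≤ f z.1) then 1 else 0

/-- Classification risk. -/
def classRisk [MeasurableSpace X] (μ : Measure (X × Bool)) (f : X → ℝ) : ℝ :=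
  ∫ z, classErr f z ∂μ

/-- Empirical classification risk. -/
def empClassRisk {m : ℕ} (S : Fin m → X × Bool) (f : X → ℝ) : ℝ :=
  (1 / (m : ℝ)) * ∑ i, classErr f (S i)

/-- Bayes error rate. -/
def bayesRisk [MeasurableSpace X] (μ : Measure (X × Bool)) : ℝ :=
  ⨅ f : {f : X → ℝ // Measurable f}, classRisk μ f.1

/-! ### The dual problem -/

/-- Domain of the dual problem: `p ∈ L^∞(μ)` with values in `[0, β₂]`, annihilated by the adjoint
of `A : Λ → L¹(μ)`, and for which `∫ ℓ*(p) dμ` is finite (otherwise the dual objective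
`-∫ ℓ*(p) dμ` is `-∞`). -/
structure DualFeasible [MeasurableSpace X] (ℓ : ℝ → ℝ) (μ : Measure (X × Bool))
    (H : Set (X → ℝ)) (p : Lp ℝ ⊤ μ) : Prop where
  mem_Icc : ∀ᵐ z ∂μ, p z ∈ Icc 0 (lipConst ℓ)
  adjoint_eq_zero : ∀ lam : Weights H, ∫ z, opA lam z * p z ∂μ = 0
  conj_finite : ∀ᵐ z ∂μ, BddAbove (range fun x : ℝ => p z * x - ℓ x)
  conj_integrable : Integrable (fun z => conj ℓ (p z)) μ

/-- `p` maximizes `-∫ ℓ*(p) dμ` over the dual feasible set. -/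
def IsDualOptimum [MeasurableSpace X] (ℓ : ℝ → ℝ) (μ : Measure (X × Bool))
    (H : Set (X → ℝ)) (p : Lp ℝ ⊤ μ) : Prop :=
  DualFeasible ℓ μ H p ∧
    ∀ q : Lp ℝ ⊤ μ, DualFeasible ℓ μ H q →
      -∫ z, conj ℓ (q z) ∂μ ≤ -∫ z, conj ℓ (p z) ∂μ

/-- The explicit level `(ℓ*)⁻¹(-𝓛̄) / (2 max {1, β₂})`. -/
def dualLevel [MeasurableSpace X] (ℓ : ℝ → ℝ) (μ : Measure (X × Bool))
    (H : Set (X → ℝ)) : ℝ :=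
  conjInv ℓ (-optRisk ℓ μ H) / (2 * max 1 (lipConst ℓ))

/-! ### The boosting algorithm -/

/-- `⟨∇𝓛̂(Aλ), Aλ'⟩`. -/
def empGrad {m : ℕ} (ℓ : ℝ → ℝ) (S : Fin m → X × Bool) {H : Set (X → ℝ)}
    (lam lam' : Weights H) : ℝ :=
  (1 / (m : ℝ)) * ∑ i, deriv ℓ (opA lam (S i)) * opA lam' (S i)

/-- `‖Aᵀ∇𝓛̂(Aλ)‖_∞`. -/
def gradSup {m : ℕ} (ℓ : ℝ → ℝ) (S : Fin m → X × Bool) {H : Set (X → ℝ)}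
    (lam : Weights H) : ℝ := ⨆ h : H, |empGrad ℓ S lam (unitWeight h)|

/-- `α` is an optimal unconstrained step from `lam` along `v`. The value `0` is allowed, so that the
step is also defined at a stationary point. -/
def IsOptStep {m : ℕ} (ℓ : ℝ → ℝ) (S : Fin m → X × Bool) {H : Set (X → ℝ)}
    (lam v : Weights H) (α : ℝ) : Prop :=
  0 ≤ α ∧ ∀ β : ℝ, 0 ≤ β → empRisk ℓ S (lam + α • v) ≤ empRisk ℓ S (lam + β • v)

/-- Admissible step sizes: an optimal step; or a step that is at least the minimizer of the
quadratic upper bound and smaller than the optimal step (infinite if there is none);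
or a Wolfe step with parameters `1/3` and `1/2`. -/
def IsStep {m : ℕ} (ℓ : ℝ → ℝ) (S : Fin m → X × Bool) {H : Set (X → ℝ)}
    (lam v : Weights H) (α : ℝ) : Prop :=
  IsOptStep ℓ S lam v α ∨
  (-empGrad ℓ S lam v / gradLipConst ℓ ≤ α ∧ ∀ β, IsOptStep ℓ S lam v β → α < β) ∨
  (0 ≤ α ∧
    empRisk ℓ S (lam + α • v) ≤ empRisk ℓ S lam + α * (1 / 3) * empGrad ℓ S lam v ∧
    (1 / 2) * empGrad ℓ S lam v ≤ empGrad ℓ S (lam + α • v) v)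

/-- One round of the algorithm, from `lam` to `lam'`. -/
def IsRound {m : ℕ} (ℓ : ℝ → ℝ) (S : Fin m → X × Bool) (ρ : ℝ) {H : Set (X → ℝ)}
    (lam lam' : Weights H) : Prop :=
  ∃ (h : H) (v : Weights H) (α : ℝ),
    ρ * gradSup ℓ S lam ≤ |empGrad ℓ S lam (unitWeight h)| ∧
    (v = unitWeight h ∨ v = -unitWeight h) ∧
    empGrad ℓ S lam v ≤ -(ρ * gradSup ℓ S lam) ∧
    -gradSup ℓ S lam ≤ empGrad ℓ S lam v ∧
    IsStep ℓ S lam v α ∧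
    lam' = lam + α • v

/-- `lam 0, …, lam T` are the iterates of `T` rounds of the algorithm. -/
def IsRun {m : ℕ} (ℓ : ℝ → ℝ) (S : Fin m → X × Bool) (ρ : ℝ) (T : ℕ) {H : Set (X → ℝ)}
    (lam : ℕ → Weights H) : Prop :=
  lam 0 = 0 ∧ ∀ i < T, IsRound ℓ S ρ (lam i) (lam (i + 1))

/-- `out` is an iterate among `lam 1, …, lam T` of smallest empirical classification error. -/
def IsOutput {m : ℕ} (S : Fin m → X × Bool) (T : ℕ) {H : Set (X → ℝ)}
    (lam : ℕ → Weights H) (out : Weights H) : Prop :=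
  (∃ j ∈ Finset.Icc 1 T, out = lam j) ∧
    ∀ i ∈ Finset.Icc 1 T, empClassRisk S (opH out) ≤ empClassRisk S (opH (lam i))

/-! ### The quantities in the bounds (`P` is the norm `‖p‖_∞`) -/

/-- `c`. -/
def cConst (ℓ : ℝ → ℝ) (τ P : ℝ) : ℝ :=
  16 * ℓ 0 / (τ * deriv ℓ 0) * max 1 (1 / τ) * max 1 P

/-- `B₁`. -/
def B1 (ℓ : ℝ → ℝ) (τ P : ℝ) : ℝ :=
  τ / 8 * sInf (deriv (deriv ℓ) '' Icc (-cConst ℓ τ P) (cConst ℓ τ P))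

/-- `Rᵢ`. -/
def normBound (ℓ : ℝ → ℝ) (ρ τ P : ℝ) (i : ℕ) : ℝ :=
  √(i : ℝ) * √(ℓ 0 * max 5 (2 * B1 ℓ τ P / gradLipConst ℓ) / (ρ ^ 2 * B1 ℓ τ P))

/-- The two lower bounds on the sample size `m`, for VC dimension `V`. -/
def SampleLarge (ℓ : ℝ → ℝ) (ρ τ P δ : ℝ) (V m t : ℕ) : Prop :=
  2 / τ ^ 2 * Real.log (4 / δ) ≤ m ∧
  2 * (normBound ℓ ρ τ P t + 2 * cConst ℓ τ P) * P / √(m : ℝ) *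
      (2 * √(2 * V * Real.log (m + 1)) + √(2 * Real.log (4 / δ)))
    ≤ cConst ℓ τ P * τ ^ 2 / 8

/-- Calibration functions: `ψ(z) → 0` as `z → 0`, and, along sequences in `[0, 1]`, `ψ(zₙ) → 0`
exactly when `zₙ → 0`. -/
def IsCalibration (ψ : ℝ → ℝ) : Prop :=
  Tendsto ψ (𝓝 0) (𝓝 0) ∧
  ∀ z : ℕ → ℝ, (∀ n, z n ∈ Icc (0 : ℝ) 1) →
    (Tendsto (fun n => ψ (z n)) atTop (𝓝 0) ↔ Tendsto z atTop (𝓝 0))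

/-- The bound on the surrogate risk of the iterate `lam`, after `t` rounds, against the
comparator `lb`. -/
def SurrogateBound [MeasurableSpace X] (ℓ : ℝ → ℝ) (μ : Measure (X × Bool)) {H : Set (X → ℝ)}
    (ρ τ P δ : ℝ) (m t : ℕ) (lam lb : Weights H) : Prop :=
  risk ℓ μ lam ≤ risk ℓ μ lb
    + (t : ℝ) ^ (-(1 / 4) : ℝ)
    + normBound ℓ ρ τ P (t - 1) * √(2 / m * Real.log (6 / δ))
    + 2 * lipConst ℓ * normBound ℓ ρ τ P t / √(m : ℝ) *
        (2 * √(2 * vcDim H * Real.log (m + 1))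
          + ℓ (normBound ℓ ρ τ P t) * √(2 * Real.log (6 / δ)))
    + ℓ 0 *
        (‖lb‖ / (‖lb‖ + ρ * (t : ℝ) ^ (1 / 4 : ℝ) /
          (4 * gradLipConst ℓ * normBound ℓ ρ τ P 1)))
        ^ (ρ ^ 3 * B1 ℓ τ P / (9 * gradLipConst ℓ))

/-- The VC term `((V + 1) ln(2em) + ln(24/δ)) · max {T, mᵃ} / m`; for `T ≤ mᵃ` the last factor is
`1 / m^(1-a)`. -/
def vcTerm (a δ : ℝ) (V m T : ℕ) : ℝ :=
  ((V + 1) * Real.log (2 * Real.exp 1 * m) + Real.log (24 / δ)) * (max (T : ℝ) ((m : ℝ) ^ a) / m)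

end Boost

end

open Boost

/-!
The theorem combines a duality argument, a deterministic analysis of the algorithm on a good sample,
and three concentration inequalities.

*Duality.* Along a minimizing sequence of weightings, rescaled so that each is optimal on its segment
to `0`, the derivatives `ℓ'(Aλₙ)` are nearly annihilated by the adjoint of `A`. The densities that
satisfy the Fenchel inequalities against all of `L²` and are annihilated up to `ε` form nested closed
convex bounded sets, whose minimal norm elements converge to a dual optimum attaining the optimal risk
(`exists_isDualOptimum`). Since the conjugate of its mean is at most the negative of the optimal risk,
a dual optimum cannot be small almost everywhere (`dualLevel_spec`).

*Curvature on a good sample.* Call a sample good (`IsCurvedSample`) if a fraction `τ/2` of it carries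
dual weight at least `τ` and the dual weights nearly annihilate the predictions of all weightings of
moderate norm. On a good sample, a weighting whose empirical risk is at most `ℓ 0` makes predictions of
size at most `c` on more than half of the points of dual weight `≥ τ`: large positive values of `Aλ`
cost risk, and large negative ones would have to be balanced by positive ones. Hence two such weightings
have a common point of small prediction, so no descent step is longer than `2c`, and the empirical risk
is strongly convex along every step (`IsCurvedSample.step_le`). All three step rules then decrease the
risk by a multiple of the squared step length and by a multiple of gradient times step length
(`IsCurvedSample.round_progress`). The first bound keeps the norm of the `i`th iterate of order `√i`; the
second contracts the excess risk by a power of the ratio of consecutive norms, which gives the rate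
(`IsCurvedSample.empRisk_run_le`).

*Concentration.* A sample is good with large probability, and the surrogate risk is close to its
empirical version on balls of weightings (`measure_risk_deviation_le`), by the bounded difference
inequality, symmetrization, the contraction principle and Massart's lemma. For the classification risk
of the output, relative deviations (`measure_exists_relative_deviation_le`) are applied to thresholded
combinations of `T` weak learners, whose traces are counted with the Sauer–Shelah lemma and the bound
`card_affine_trace_le` for affine families. Suprema over uncountable classes are reduced to countable
ones by pointwise measurability.

*Calibration.* The function `ψ(z) = ℓ'(0)² z² / (2 B₂)` is a lower bound on the excess surrogate risk:
on the region where the classifier disagrees with the Bayes rule, replacing its prediction by the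
minimizer of the quadratic upper bound of the loss reduces the surrogate risk by at least that much, and
the dense span of the class approximates the replacement (`calib_classRisk_sub_le`).
-/

namespace Boost

/-! ### Losses and their derivatives -/

section Loss
variable {ℓ : ℝ → ℝ}

theorem LossBds.abs_sub_le (h : LossBds ℓ) (x y : ℝ) : |ℓ x - ℓ y| ≤ lipConst ℓ * |x - y| := by
  rcases eq_or_ne x y with rfl | hxy
  · simp
  obtain ⟨K, hK⟩ := h.lipschitz
  have hpos : 0 < |x - y| := abs_pos.2 (sub_ne_zero.2 hxy)
  rw [← div_le_iff₀ hpos]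
  refine le_csSup ⟨K, ?_⟩ ⟨x, y, hxy, rfl⟩
  rintro r ⟨a, b, hab, rfl⟩
  rw [div_le_iff₀ (abs_pos.2 (sub_ne_zero.2 hab))]
  simpa [Real.dist_eq] using hK.dist_le_mul a b

theorem LossBds.deriv_sub_le (h : LossBds ℓ) {x y : ℝ} (hxy : x ≤ y) :
    deriv ℓ y - deriv ℓ x ≤ gradLipConst ℓ * (y - x) := by
  rcases hxy.eq_or_lt with rfl | hxy
  · simp
  obtain ⟨K, hK⟩ := h.grad_lipschitz
  rw [← div_le_iff₀ (sub_pos.2 hxy)]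
  refine le_csSup ⟨K, ?_⟩ ⟨x, y, hxy.ne, rfl⟩
  rintro r ⟨a, b, hab, rfl⟩
  refine (le_abs_self _).trans ?_
  rw [abs_div, div_le_iff₀ (abs_pos.2 (sub_ne_zero.2 hab.symm))]
  simpa [Real.dist_eq] using hK.dist_le_mul b a

theorem LossBds.hasDerivAt (h : LossBds ℓ) (x : ℝ) : HasDerivAt ℓ (deriv ℓ x) x :=
  (h.differentiable x).hasDerivAt

theorem LossBds.deriv_mono (h : LossBds ℓ) : Monotone (deriv ℓ) := by
  have := h.convex.monotoneOn_deriv (fun x _ => h.differentiable x)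
  exact monotoneOn_univ.1 this

theorem LossBds.deriv_nonneg (h : LossBds ℓ) (x : ℝ) : 0 ≤ deriv ℓ x := (h.deriv_mem x).1

theorem LossBds.deriv_le (h : LossBds ℓ) (x : ℝ) : deriv ℓ x ≤ lipConst ℓ := (h.deriv_mem x).2

theorem LossBds.deriv_zero_pos (h : LossBds ℓ) : 0 < deriv ℓ 0 := by
  obtain ⟨b, hb, _, hx⟩ := h.deriv_lower
  exact hb.trans_le (hx 0 le_rfl).1

theorem LossBds.lipConst_pos (h : LossBds ℓ) : 0 < lipConst ℓ :=
  h.deriv_zero_pos.trans_le (h.deriv_le 0)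

theorem LossBds.monotone (h : LossBds ℓ) : Monotone ℓ :=
  monotone_of_deriv_nonneg h.differentiable h.deriv_nonneg

theorem LossBds.continuous (h : LossBds ℓ) : Continuous ℓ := h.differentiable.continuous

theorem LossBds.continuous_deriv (h : LossBds ℓ) : Continuous (deriv ℓ) := by
  obtain ⟨K, hK⟩ := h.grad_lipschitz
  exact hK.continuous

/-- The tangent inequality of convexity. -/
theorem LossBds.tangent_le (h : LossBds ℓ) (x y : ℝ) : ℓ x + deriv ℓ x * (y - x) ≤ ℓ y := by
  rcases lt_trichotomy x y with hxy | rfl | hxy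
  · have := h.convex.le_slope_of_hasDerivAt (mem_univ x) (mem_univ y) hxy (h.hasDerivAt x)
    rw [slope_def_field, le_div_iff₀ (sub_pos.2 hxy)] at this
    linarith
  · simp
  · have := h.convex.slope_le_of_hasDerivAt (mem_univ y) (mem_univ x) hxy (h.hasDerivAt x)
    rw [slope_def_field, div_le_iff₀ (sub_pos.2 hxy)] at this
    linarith

/-- The quadratic upper bound given by the Lipschitz derivative. -/
theorem LossBds.le_quadratic (h : LossBds ℓ) (x y : ℝ) :
    ℓ y ≤ ℓ x + deriv ℓ x * (y - x) + gradLipConst ℓ / 2 * (y - x) ^ 2 := by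
  let g : ℝ → ℝ := fun z => ℓ z - (deriv ℓ x * (z - x) + gradLipConst ℓ / 2 * (z - x) ^ 2)
  have hg : ∀ z, HasDerivAt g (deriv ℓ z - (deriv ℓ x + gradLipConst ℓ * (z - x))) z := by
    intro z
    have h1 : HasDerivAt (fun z => z - x) 1 z := (hasDerivAt_id z).sub_const x
    have := (h.hasDerivAt z).sub ((h1.const_mul (deriv ℓ x)).add
      ((h1.pow 2).const_mul (gradLipConst ℓ / 2)))
    refine this.congr_deriv ?_
    simp
    ring
  have hgc : Continuous g := continuous_iff_continuousAt.2 fun z => (hg z).continuousAt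
  have hgx : g x = ℓ x := by simp [g]
  have key : g y ≤ g x := by
    rcases le_total x y with hxy | hxy
    · have : AntitoneOn g (Ici x) := by
        refine antitoneOn_of_deriv_nonpos (convex_Ici x) hgc.continuousOn
          (fun z _ => (hg z).differentiableAt.differentiableWithinAt) fun z hz => ?_
        rw [interior_Ici] at hz
        rw [(hg z).deriv]
        linarith [h.deriv_sub_le (le_of_lt hz : x ≤ z)]
      exact this (mem_Ici.2 le_rfl) hxy hxy
    · have : MonotoneOn g (Iic x) := by
        refine monotoneOn_of_deriv_nonneg (convex_Iic x) hgc.continuousOn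
          (fun z _ => (hg z).differentiableAt.differentiableWithinAt) fun z hz => ?_
        rw [interior_Iic] at hz
        rw [(hg z).deriv]
        linarith [h.deriv_sub_le (le_of_lt hz : z ≤ x)]
      exact this hxy (mem_Iic.2 le_rfl) hxy
  simp only [hgx] at key
  simp only [g] at key
  linarith

/-- A loss with vanishing Lipschitz constant of the derivative would be affine with positive slope
at `-∞`, hence negative somewhere. -/
theorem LossBds.gradLipConst_pos (h : LossBds ℓ) : 0 < gradLipConst ℓ := by
  by_contra! hB
  have hd := h.deriv_zero_pos
  have h0 := h.nonneg 0
  set x : ℝ := -(ℓ 0 + 1) / deriv ℓ 0 with hx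
  have hx0 : x ≤ 0 := by
    rw [hx]; exact div_nonpos_of_nonpos_of_nonneg (by linarith) hd.le
  have h1 := h.deriv_sub_le hx0
  have h2 : deriv ℓ 0 ≤ deriv ℓ x := by nlinarith
  have h3 := h.tangent_le x 0
  have h4 := h.nonneg x
  have h5 : deriv ℓ 0 * (-x) = ℓ 0 + 1 := by rw [hx]; field_simp
  nlinarith

theorem LossBds.le_zero_add (h : LossBds ℓ) {x : ℝ} (hx : 0 ≤ x) : ℓ x ≤ ℓ 0 + lipConst ℓ * x := by
  have := h.abs_sub_le x 0
  rw [sub_zero, abs_of_nonneg hx] at this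
  linarith [le_abs_self (ℓ x - ℓ 0)]

theorem LossTd.continuous_deriv_deriv (h : LossTd ℓ) : Continuous (deriv (deriv ℓ)) := by
  have h2 : ContDiff ℝ (1 + 1) ℓ := by simpa [one_add_one_eq_two] using h.contDiff
  have h1 : ContDiff ℝ 1 (deriv ℓ) := (contDiff_succ_iff_deriv.1 h2).2.2
  exact h1.continuous_deriv le_rfl

theorem LossTd.hasDerivAt_deriv (h : LossTd ℓ) (x : ℝ) :
    HasDerivAt (deriv ℓ) (deriv (deriv ℓ) x) x := by
  have h2 : ContDiff ℝ (1 + 1) ℓ := by simpa [one_add_one_eq_two] using h.contDiff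
  have h1 : ContDiff ℝ 1 (deriv ℓ) := (contDiff_succ_iff_deriv.1 h2).2.2
  exact (h1.differentiable one_ne_zero x).hasDerivAt

theorem LossBds.deriv_deriv_nonneg (h : LossBds ℓ) (x : ℝ) : 0 ≤ deriv (deriv ℓ) x :=
  h.deriv_mono.deriv_nonneg

theorem LossBds.deriv_deriv_le (h : LossBds ℓ) (htd : LossTd ℓ) (x : ℝ) :
    deriv (deriv ℓ) x ≤ gradLipConst ℓ := by
  have := (htd.hasDerivAt_deriv x).tendsto_slope
  have h2 : Tendsto (slope (deriv ℓ) x) (𝓝[>] x) (𝓝 (deriv (deriv ℓ) x)) :=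
    this.mono_left (nhdsWithin_mono _ fun y hy => ne_of_gt hy)
  refine le_of_tendsto h2 ?_
  filter_upwards [self_mem_nhdsWithin] with y hy
  rw [slope_def_field, div_le_iff₀ (sub_pos.2 hy)]
  exact h.deriv_sub_le (le_of_lt hy)

/-! ### The logistic loss and the calibration function -/

/-- The calibration function `ψ(z) = ℓ'(0)² z² / (2 B₂)`: the optimal decrease of the quadratic
upper bound of `θ ↦ (1+z)/2 ℓ(-θ) + (1-z)/2 ℓ(θ)` at `θ = 0`. -/
noncomputable def calib (ℓ : ℝ → ℝ) (z : ℝ) : ℝ := deriv ℓ 0 ^ 2 * z ^ 2 / (2 * gradLipConst ℓ)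

theorem LossBds.isCalibration_calib (h : LossBds ℓ) : IsCalibration (calib ℓ) := by
  have hB := h.gradLipConst_pos
  have hd := h.deriv_zero_pos
  have hc : Continuous (calib ℓ) := by unfold calib; fun_prop
  have h0 : calib ℓ 0 = 0 := by simp [calib]
  refine ⟨by simpa [h0] using hc.tendsto 0, fun z hz => ⟨fun hl => ?_, fun hl => ?_⟩⟩
  · have h1 : Tendsto (fun n => √(calib ℓ (z n) * (2 * gradLipConst ℓ) / deriv ℓ 0 ^ 2)) atTop
        (𝓝 (√(0 * (2 * gradLipConst ℓ) / deriv ℓ 0 ^ 2))) :=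
      (Real.continuous_sqrt.tendsto _).comp ((hl.mul_const _).div_const _)
    simp only [zero_mul, zero_div, Real.sqrt_zero] at h1
    refine h1.congr fun n => ?_
    have : calib ℓ (z n) * (2 * gradLipConst ℓ) / deriv ℓ 0 ^ 2 = z n ^ 2 := by
      unfold calib; field_simp
    rw [this, Real.sqrt_sq (hz n).1]
  · have := (hc.tendsto 0).comp hl
    rwa [h0] at this

theorem hasDerivAt_logisticLoss (x : ℝ) :
    HasDerivAt logisticLoss (Real.exp x / (1 + Real.exp x)) x := by
  have h1 : HasDerivAt (fun x => 1 + Real.exp x) (Real.exp x) x :=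
    (Real.hasDerivAt_exp x).const_add 1
  exact h1.log (by positivity)

theorem deriv_logisticLoss : deriv logisticLoss = fun x => Real.exp x / (1 + Real.exp x) :=
  funext fun x => (hasDerivAt_logisticLoss x).deriv

theorem hasDerivAt_deriv_logisticLoss (x : ℝ) :
    HasDerivAt (deriv logisticLoss) (Real.exp x / (1 + Real.exp x) ^ 2) x := by
  rw [deriv_logisticLoss]
  have h1 : HasDerivAt (fun x => 1 + Real.exp x) (Real.exp x) x :=
    (Real.hasDerivAt_exp x).const_add 1
  refine ((Real.hasDerivAt_exp x).div h1 (by positivity)).congr_deriv ?_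
  ring

theorem gradLipConst_logisticLoss (h : LossBds logisticLoss) : gradLipConst logisticLoss = 1 / 4 := by
  have hle : ∀ a b : ℝ, a < b →
      (deriv logisticLoss b - deriv logisticLoss a) / (b - a) ≤ 1 / 4 := by
    intro a b hab
    rw [div_le_iff₀ (sub_pos.2 hab)]
    refine Convex.image_sub_le_mul_sub_of_deriv_le convex_univ
      (fun x _ => (hasDerivAt_deriv_logisticLoss x).continuousAt.continuousWithinAt)
      (fun x _ => (hasDerivAt_deriv_logisticLoss x).differentiableAt.differentiableWithinAt)
      (fun x _ => ?_) a (mem_univ _) b (mem_univ _) hab.le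
    rw [(hasDerivAt_deriv_logisticLoss x).deriv, div_le_div_iff₀ (by positivity) (by norm_num)]
    nlinarith [sq_nonneg (1 - Real.exp x)]
  apply le_antisymm
  · refine csSup_le ⟨_, 0, 1, by norm_num, rfl⟩ ?_
    rintro r ⟨a, b, hab, rfl⟩
    rcases lt_or_gt_of_ne hab with hab | hab
    · exact hle a b hab
    · rw [← neg_sub, ← neg_sub a b, neg_div_neg_eq]
      exact hle b a hab
  · have h1 := (hasDerivAt_deriv_logisticLoss 0).tendsto_slope
    have h2 : Tendsto (slope (deriv logisticLoss) 0) (𝓝[>] 0) (𝓝 (1 / 4)) := by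
      have h3 : Real.exp 0 / (1 + Real.exp 0) ^ 2 = 1 / 4 := by norm_num
      rw [← h3]
      exact h1.mono_left (nhdsWithin_mono _ fun y hy => ne_of_gt hy)
    refine le_of_tendsto h2 ?_
    filter_upwards [self_mem_nhdsWithin] with y hy
    rw [slope_def_field, div_le_iff₀ (sub_pos.2 hy)]
    exact h.deriv_sub_le (le_of_lt hy)

theorem calib_logisticLoss (h : LossBds logisticLoss) (z : ℝ) : calib logisticLoss z = z ^ 2 / 2 := by
  rw [calib, gradLipConst_logisticLoss h, deriv_logisticLoss]
  norm_num
  ring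

end Loss

/-! ### Weightings and the operators `H` and `A` -/

section Weightings
variable {X : Type u} {H : Set (X → ℝ)}

theorem abs_sgn (y : Bool) : |sgn y| = 1 := by cases y <;> simp [sgn]

theorem measurable_sgn : Measurable sgn := measurable_of_countable _

theorem IsBinary.abs_eq (hb : IsBinary H) (h : H) (x : X) : |h.1 x| = 1 := by
  rcases hb h.1 h.2 x with e | e <;> simp [e]

theorem Weights.summable_abs (lam : Weights H) : Summable fun h => |lam h| := by
  have := (lp.memℓp lam).summable (by norm_num)
  simpa using this

theorem Weights.norm_eq (lam : Weights H) : ‖lam‖ = ∑' h, |lam h| := by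
  have := lp.norm_eq_tsum_rpow (p := 1) (by norm_num) lam
  simpa using this

theorem IsBinary.summable (hb : IsBinary H) (lam : Weights H) (x : X) :
    Summable fun h : H => h.1 x * lam h := by
  refine Summable.of_norm_bounded (Weights.summable_abs lam) fun h => ?_
  rw [Real.norm_eq_abs, abs_mul, hb.abs_eq, one_mul]

theorem opH_add (hb : IsBinary H) (a b : Weights H) (x : X) :
    opH (a + b) x = opH a x + opH b x := by
  unfold opH
  rw [← (hb.summable a x).tsum_add (hb.summable b x)]
  simp [mul_add]

theorem opH_smul (c : ℝ) (a : Weights H) (x : X) : opH (c • a) x = c * opH a x := by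
  unfold opH
  rw [← tsum_mul_left]
  congr 1; ext h
  simp; ring

theorem opH_zero (x : X) : opH (0 : Weights H) x = 0 := by simp [opH]

theorem opH_neg (a : Weights H) (x : X) : opH (-a) x = -opH a x := by
  rw [← neg_one_smul ℝ a, opH_smul]; ring

theorem opH_sum (hb : IsBinary H) {ι : Type*} (s : Finset ι) (f : ι → Weights H) (x : X) :
    opH (∑ i ∈ s, f i) x = ∑ i ∈ s, opH (f i) x := by
  classical
  induction s using Finset.induction_on with
  | empty => simp [opH_zero]
  | insert a s ha ih => rw [Finset.sum_insert ha, Finset.sum_insert ha, opH_add hb, ih]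

theorem opH_unitWeight (h : H) (x : X) : opH (unitWeight h) x = h.1 x := by
  classical
  unfold opH unitWeight
  rw [tsum_eq_single h]
  · simp
  · intro k hk
    simp [lp.single_apply, hk]

theorem norm_unitWeight (h : H) : ‖unitWeight h‖ = 1 := by
  classical
  simp [unitWeight, lp.norm_single]

theorem abs_opH_le (hb : IsBinary H) (lam : Weights H) (x : X) : |opH lam x| ≤ ‖lam‖ := by
  rw [(Weights.norm_eq lam)]
  unfold opH
  have h1 : Summable fun h : H => |h.1 x * lam h| := by
    simpa [abs_mul, hb.abs_eq] using (Weights.summable_abs lam)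
  have h2 := norm_tsum_le_tsum_norm (f := fun h : H => h.1 x * lam h) (by simpa using h1)
  simpa [abs_mul, hb.abs_eq] using h2

theorem opA_eq (lam : Weights H) (z : X × Bool) : opA lam z = -sgn z.2 * opH lam z.1 := rfl

theorem abs_opA_eq (lam : Weights H) (z : X × Bool) : |opA lam z| = |opH lam z.1| := by
  rw [opA_eq, abs_mul, abs_neg, abs_sgn, one_mul]

theorem abs_opA_le (hb : IsBinary H) (lam : Weights H) (z : X × Bool) : |opA lam z| ≤ ‖lam‖ := by
  rw [abs_opA_eq]; exact abs_opH_le hb lam _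

theorem opA_add (hb : IsBinary H) (a b : Weights H) (z : X × Bool) :
    opA (a + b) z = opA a z + opA b z := by simp only [opA_eq, opH_add hb]; ring

theorem opA_smul (c : ℝ) (a : Weights H) (z : X × Bool) : opA (c • a) z = c * opA a z := by
  simp only [opA_eq, opH_smul]; ring

theorem opA_zero (z : X × Bool) : opA (0 : Weights H) z = 0 := by simp [opA_eq, opH_zero]

theorem opA_neg (a : Weights H) (z : X × Bool) : opA (-a) z = -opA a z := by
  simp only [opA_eq, opH_neg]; ring

theorem opA_sub (hb : IsBinary H) (a b : Weights H) (z : X × Bool) :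
    opA (a - b) z = opA a z - opA b z := by rw [sub_eq_add_neg, opA_add hb, opA_neg]; ring

theorem opA_unitWeight (h : H) (z : X × Bool) : opA (unitWeight h) z = -sgn z.2 * h.1 z.1 := by
  rw [opA_eq, opH_unitWeight]

theorem IsBinary.opA_unitWeight_sq (hb : IsBinary H) (h : H) (z : X × Bool) :
    opA (unitWeight h) z ^ 2 = 1 := by
  rw [opA_unitWeight, ← sq_abs, abs_mul, abs_neg, abs_sgn, hb.abs_eq]; norm_num

theorem IsBinary.abs_opA_unitWeight (hb : IsBinary H) (h : H) (z : X × Bool) :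
    |opA (unitWeight h) z| = 1 := by
  rw [opA_unitWeight, abs_mul, abs_neg, abs_sgn, hb.abs_eq]; norm_num

/-- Restriction of a weighting to a finite set of weak learners. -/
noncomputable def Weights.trunc (lam : Weights H) (s : Finset H) : Weights H :=
  ∑ h ∈ s, lam h • unitWeight h

theorem Weights.hasSum_unitWeight (lam : Weights H) :
    HasSum (fun h => lam h • unitWeight h) lam := by
  classical
  have := lp.hasSum_single (p := 1) (by norm_num) lam
  convert this using 2 with h
  simp only [unitWeight]
  rw [← lp.single_smul]
  simp

theorem Weights.tendsto_trunc (lam : Weights H) : Tendsto (Weights.trunc lam) atTop (𝓝 lam) :=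
  (Weights.hasSum_unitWeight lam)

theorem Weights.norm_trunc_le (lam : Weights H) (s : Finset H) : ‖Weights.trunc lam s‖ ≤ ‖lam‖ := by
  refine (norm_sum_le _ _).trans ?_
  rw [(Weights.norm_eq lam)]
  simp only [norm_smul, norm_unitWeight, mul_one, Real.norm_eq_abs]
  exact (Weights.summable_abs lam).sum_le_tsum s fun _ _ => abs_nonneg _

theorem Weights.sum_abs_le (lam : Weights H) (s : Finset H) : ∑ h ∈ s, |lam h| ≤ ‖lam‖ := by
  rw [(Weights.norm_eq lam)]
  exact (Weights.summable_abs lam).sum_le_tsum s fun _ _ => abs_nonneg _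

theorem opH_trunc (hb : IsBinary H) (lam : Weights H) (s : Finset H) (x : X) :
    opH (Weights.trunc lam s) x = ∑ h ∈ s, lam h * h.1 x := by
  rw [Weights.trunc, opH_sum hb]
  simp [opH_smul, opH_unitWeight]

/-- A weighting is the limit of a sequence of its finite truncations. -/
theorem Weights.exists_seq_trunc (lam : Weights H) :
    ∃ s : ℕ → Finset H, Tendsto (fun n => Weights.trunc lam (s n)) atTop (𝓝 lam) := by
  have h : ∀ n : ℕ, ∃ s : Finset H, dist (Weights.trunc lam s) lam < 1 / ((n : ℝ) + 1) := fun n =>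
    ((Metric.tendsto_nhds.1 (Weights.tendsto_trunc lam)) _ Nat.one_div_pos_of_nat).exists
  choose s hs using h
  refine ⟨s, tendsto_iff_dist_tendsto_zero.2 ?_⟩
  exact squeeze_zero (fun _ => dist_nonneg) (fun n => (hs n).le)
    tendsto_one_div_add_atTop_nhds_zero_nat

theorem abs_opA_sub_le (hb : IsBinary H) (a b : Weights H) (z : X × Bool) :
    |opA a z - opA b z| ≤ ‖a - b‖ := by
  rw [← opA_sub hb]; exact abs_opA_le hb _ _

theorem continuous_opA (hb : IsBinary H) (z : X × Bool) :
    Continuous fun lam : Weights H => opA lam z := by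
  refine (LipschitzWith.of_dist_le_mul (K := 1) fun a b => ?_).continuous
  rw [Real.dist_eq, dist_eq_norm, NNReal.coe_one, one_mul]
  exact abs_opA_sub_le hb a b z

variable [MeasurableSpace X]

theorem measurable_opH (hb : IsBinary H) (hm : ∀ h ∈ H, Measurable h) (lam : Weights H) :
    Measurable (opH lam) := by
  obtain ⟨s, hs⟩ := (Weights.exists_seq_trunc lam)
  refine measurable_of_tendsto_metrizable (f := fun n => opH (Weights.trunc lam (s n))) (fun n => ?_) ?_
  · have : opH (Weights.trunc lam (s n)) = fun x => ∑ h ∈ s n, lam h * h.1 x :=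
      funext fun x => opH_trunc hb lam _ x
    rw [this]
    exact Finset.measurable_sum _ fun h _ => (hm h.1 h.2).const_mul _
  · rw [tendsto_pi_nhds]
    intro x
    have := ((continuous_opA hb (x, false)).tendsto lam).comp hs
    simpa [opA_eq, sgn, Function.comp_def] using this

theorem measurable_opA (hb : IsBinary H) (hm : ∀ h ∈ H, Measurable h) (lam : Weights H) :
    Measurable (opA lam) :=
  ((measurable_sgn.comp measurable_snd).neg).mul ((measurable_opH hb hm lam).comp measurable_fst)

section Risk
variable {ℓ : ℝ → ℝ} {μ : Measure (X × Bool)}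

theorem integrable_of_bdd {Z : Type*} [MeasurableSpace Z] {ν : Measure Z} [IsFiniteMeasure ν]
    {f : Z → ℝ} (hf : Measurable f) {C : ℝ} (h : ∀ z, |f z| ≤ C) : Integrable f ν :=
  Integrable.of_bound hf.aestronglyMeasurable C (ae_of_all _ h)

theorem LossBds.abs_comp_le (h : LossBds ℓ) {R x : ℝ} (hx : |x| ≤ R) : |ℓ x| ≤ ℓ R := by
  rw [abs_of_nonneg (h.nonneg x)]
  exact h.monotone ((le_abs_self x).trans hx)

theorem LossBds.integrable_loss (h : LossBds ℓ) {Z : Type*} [MeasurableSpace Z] {ν : Measure Z}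
    [IsFiniteMeasure ν] {f : Z → ℝ} (hf : Measurable f) {C : ℝ} (hC : ∀ z, |f z| ≤ C) :
    Integrable (fun z => ℓ (f z)) ν :=
  integrable_of_bdd (h.continuous.measurable.comp hf) fun z => h.abs_comp_le (hC z)

theorem risk_nonneg (h : LossBds ℓ) (lam : Weights H) : 0 ≤ risk ℓ μ lam :=
  integral_nonneg fun _ => h.nonneg _

theorem optRisk_le (h : LossBds ℓ) (lam : Weights H) : optRisk ℓ μ H ≤ risk ℓ μ lam :=
  ciInf_le ⟨0, by rintro _ ⟨l, rfl⟩; exact risk_nonneg h l⟩ lam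

theorem risk_zero [IsProbabilityMeasure μ] : risk ℓ μ (0 : Weights H) = ℓ 0 := by simp [risk, opA_zero]

theorem abs_risk_sub_le [IsProbabilityMeasure μ] (h : LossBds ℓ) (hb : IsBinary H) (hm : ∀ h ∈ H, Measurable h)
    (a b : Weights H) : |risk ℓ μ a - risk ℓ μ b| ≤ lipConst ℓ * ‖a - b‖ := by
  unfold risk
  rw [← integral_sub (h.integrable_loss (measurable_opA hb hm a) (abs_opA_le hb a))
    (h.integrable_loss (measurable_opA hb hm b) (abs_opA_le hb b))]
  have : ∀ᵐ z ∂μ, ‖ℓ (opA a z) - ℓ (opA b z)‖ ≤ lipConst ℓ * ‖a - b‖ := ae_of_all _ fun z =>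
    (h.abs_sub_le _ _).trans
      (mul_le_mul_of_nonneg_left (abs_opA_sub_le hb a b z) h.lipConst_pos.le)
  simpa using norm_integral_le_of_norm_le_const this

theorem continuous_risk [IsProbabilityMeasure μ] (h : LossBds ℓ) (hb : IsBinary H) (hm : ∀ h ∈ H, Measurable h) :
    Continuous fun lam : Weights H => risk ℓ μ lam := by
  refine (LipschitzWith.of_dist_le_mul (K := ⟨lipConst ℓ, h.lipConst_pos.le⟩) fun a b => ?_).continuous
  rw [Real.dist_eq, dist_eq_norm]
  exact abs_risk_sub_le h hb hm a b

end Risk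
end Weightings

/-! ### Nested convex sets in a Hilbert space -/

/-- A decreasing sequence of closed convex sets in a Hilbert space, each meeting a fixed ball, has
a common point: the elements of least norm form a Cauchy sequence. This replaces weak compactness
in the construction of a dual optimum. -/
theorem exists_mem_iInter_of_closed_convex {E : Type*} [NormedAddCommGroup E]
    [InnerProductSpace ℝ E] [CompleteSpace E] (K : ℕ → Set E) (hanti : Antitone K)
    (hcl : ∀ n, IsClosed (K n)) (hcv : ∀ n, Convex ℝ (K n)) (M : ℝ)
    (hM : ∀ n, ∃ y ∈ K n, ‖y‖ ≤ M) : ∃ x, ∀ n, x ∈ K n := by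
  have hmin : ∀ n, ∃ x ∈ K n, ∀ y ∈ K n, ‖x‖ ≤ ‖y‖ := by
    intro n
    obtain ⟨y, hy, -⟩ := hM n
    obtain ⟨x, hx, he⟩ := exists_norm_eq_iInf_of_complete_convex ⟨y, hy⟩ (hcl n).isComplete
      (hcv n) 0
    refine ⟨x, hx, fun y hy => ?_⟩
    have h2 : ⨅ w : K n, ‖(0 : E) - w‖ ≤ ‖(0 : E) - (⟨y, hy⟩ : K n)‖ :=
      ciInf_le ⟨0, by rintro _ ⟨w, rfl⟩; exact norm_nonneg _⟩ _
    rw [← he] at h2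
    simpa using h2
  choose x hx hxm using hmin
  have hmono : Monotone fun n => ‖x n‖ ^ 2 := fun n m hnm =>
    pow_le_pow_left₀ (norm_nonneg _) (hxm n _ (hanti hnm (hx m))) 2
  have hbdd : BddAbove (range fun n => ‖x n‖ ^ 2) := by
    refine ⟨M ^ 2, ?_⟩
    rintro _ ⟨n, rfl⟩
    obtain ⟨y, hy, hyM⟩ := hM n
    exact pow_le_pow_left₀ (norm_nonneg _) ((hxm n y hy).trans hyM) 2
  have hlim := tendsto_atTop_ciSup hmono hbdd
  set d := ⨆ n, ‖x n‖ ^ 2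
  have hle : ∀ n, ‖x n‖ ^ 2 ≤ d := fun n => le_ciSup hbdd n
  have hpar : ∀ n m, n ≤ m → ‖x n - x m‖ ^ 2 ≤ 2 * (d - ‖x n‖ ^ 2) := by
    intro n m hnm
    have hmid : (1 / 2 : ℝ) • x n + (1 / 2 : ℝ) • x m ∈ K n :=
      hcv n (hx n) (hanti hnm (hx m)) (by norm_num) (by norm_num) (by norm_num)
    have h1 := hxm n _ hmid
    rw [← smul_add, norm_smul] at h1
    norm_num at h1
    have h2 := parallelogram_law_with_norm ℝ (x n) (x m)
    have h3 := hle m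
    have h4 := norm_nonneg (x n)
    nlinarith
  have hc : CauchySeq x := by
    rw [Metric.cauchySeq_iff']
    intro ε hε
    have h1 : ∀ᶠ n in atTop, d - ε ^ 2 / 2 < ‖x n‖ ^ 2 :=
      hlim.eventually (lt_mem_nhds (by linarith [pow_pos hε 2]))
    obtain ⟨N, hN⟩ := h1.exists
    refine ⟨N, fun n hn => ?_⟩
    rw [dist_comm, dist_eq_norm]
    have h2 := hpar N n hn
    exact lt_of_pow_lt_pow_left₀ 2 hε.le (by linarith)
  obtain ⟨a, ha⟩ := cauchySeq_tendsto_of_complete hc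
  refine ⟨a, fun n => (hcl n).mem_of_tendsto ha ?_⟩
  filter_upwards [eventually_ge_atTop n] with m hm using hanti hm (hx m)

/-! ### The Fenchel conjugate -/

section Conj
variable {ℓ : ℝ → ℝ}

theorem le_conj {φ : ℝ} (hb : BddAbove (range fun x : ℝ => φ * x - ℓ x)) (x : ℝ) :
    φ * x - ℓ x ≤ conj ℓ φ := le_csSup hb ⟨x, rfl⟩

theorem conj_le {φ C : ℝ} (h : ∀ x : ℝ, φ * x - ℓ x ≤ C) : conj ℓ φ ≤ C :=
  csSup_le (range_nonempty _) (by rintro _ ⟨x, rfl⟩; exact h x)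

theorem LossBds.sub_le_of_deriv (h : LossBds ℓ) (x y : ℝ) :
    deriv ℓ x * y - ℓ y ≤ deriv ℓ x * x - ℓ x := by
  have := h.tangent_le x y
  linarith

theorem LossBds.bddAbove_conj_deriv (h : LossBds ℓ) (x : ℝ) :
    BddAbove (range fun y : ℝ => deriv ℓ x * y - ℓ y) :=
  ⟨_, by rintro _ ⟨y, rfl⟩; exact h.sub_le_of_deriv x y⟩

theorem LossBds.conj_deriv (h : LossBds ℓ) (x : ℝ) : conj ℓ (deriv ℓ x) = deriv ℓ x * x - ℓ x :=
  le_antisymm (conj_le (h.sub_le_of_deriv x)) (le_conj (h.bddAbove_conj_deriv x) x)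

theorem LossBds.conj_zero (h : LossBds ℓ) : 0 ≤ conj ℓ 0 := by
  have hb : BddAbove (range fun y : ℝ => 0 * y - ℓ y) :=
    ⟨0, by rintro _ ⟨y, rfl⟩; simpa using h.nonneg y⟩
  have h1 : Tendsto (fun x => 0 * x - ℓ x) atBot (𝓝 0) := by
    simpa using h.tendsto_atBot.neg
  exact le_of_tendsto h1 (Eventually.of_forall fun x => le_conj hb x)

theorem LossBds.tendsto_mul_deriv (h : LossBds ℓ) :
    Tendsto (fun x => deriv ℓ x * x) atBot (𝓝 0) := by
  have h1 : Tendsto (fun x => -(2 * ℓ (x / 2))) atBot (𝓝 0) := by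
    have h2 : Tendsto (fun x : ℝ => x / 2) atBot atBot :=
      tendsto_id.atBot_div_const (by norm_num)
    simpa using ((h.tendsto_atBot.comp h2).const_mul 2).neg
  refine tendsto_of_tendsto_of_tendsto_of_le_of_le' h1 tendsto_const_nhds ?_ ?_
  · filter_upwards with x
    have := h.tangent_le x (x / 2)
    have := h.nonneg x
    linarith
  · filter_upwards [eventually_le_atBot 0] with x hx
    exact mul_nonpos_of_nonneg_of_nonpos (h.deriv_nonneg x) hx

theorem LossBds.tendsto_deriv (h : LossBds ℓ) : Tendsto (deriv ℓ) atBot (𝓝 0) := by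
  refine tendsto_of_tendsto_of_tendsto_of_le_of_le' tendsto_const_nhds
    (by simpa using h.tendsto_mul_deriv.neg) (Eventually.of_forall h.deriv_nonneg) ?_
  filter_upwards [eventually_le_atBot (-1)] with x hx
  nlinarith [h.deriv_nonneg x]

/-- Every value in `[-ℓ(0), 0)` is attained by the conjugate on `[0, ℓ'(0)]`. -/
theorem LossBds.conjInv_spec (h : LossBds ℓ) {v : ℝ} (hv : 0 < v) (hv0 : v ≤ ℓ 0) :
    conjInv ℓ (-v) ∈ Ioc 0 (deriv ℓ 0) ∧ conj ℓ (conjInv ℓ (-v)) = -v := by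
  have hex : ∃ q ∈ Icc 0 (deriv ℓ 0), conj ℓ q = -v := by
    have ht : Tendsto (fun x => deriv ℓ x * x - ℓ x) atBot (𝓝 0) := by
      simpa using h.tendsto_mul_deriv.sub h.tendsto_atBot
    obtain ⟨x, hx, hx0⟩ := ((ht.eventually (lt_mem_nhds (neg_neg_of_pos hv))).and
      (eventually_le_atBot 0)).exists
    have hc : ContinuousOn (fun x => deriv ℓ x * x - ℓ x) (Icc x 0) :=
      ((h.continuous_deriv.mul continuous_id).sub h.continuous).continuousOn
    obtain ⟨y, hy, hyv⟩ := intermediate_value_Icc' hx0 hc (show -v ∈ _ from ⟨by simpa, hx.le⟩)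
    exact ⟨deriv ℓ y, ⟨h.deriv_nonneg y, h.deriv_mono hy.2⟩, by rw [h.conj_deriv]; exact hyv⟩
  have h1 : conjInv ℓ (-v) ∈ Icc 0 (deriv ℓ 0) := Function.invFunOn_mem hex
  have h2 : conj ℓ (conjInv ℓ (-v)) = -v := Function.invFunOn_eq hex
  refine ⟨⟨lt_of_le_of_ne h1.1 fun h0 => ?_, h1.2⟩, h2⟩
  rw [← h0] at h2
  linarith [h.conj_zero]

/-- The conjugate is strictly decreasing on `[0, ℓ'(0)]`, in the form needed for Jensen's
inequality. -/
theorem LossBds.le_of_forall_sub_le (h : LossBds ℓ) {q r : ℝ} (hq : q ∈ Ioc 0 (deriv ℓ 0))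
    (hr : ∀ x, r * x - ℓ x ≤ conj ℓ q) : q ≤ r := by
  by_contra! hlt
  obtain ⟨a, ha, ha0⟩ := ((h.tendsto_deriv.eventually (gt_mem_nhds hq.1)).and
    (eventually_le_atBot 0)).exists
  obtain ⟨x, hx, rfl⟩ := intermediate_value_Icc ha0 h.continuous_deriv.continuousOn
    (show q ∈ _ from ⟨ha.le, hq.2⟩)
  rw [h.conj_deriv] at hr
  have hB := h.gradLipConst_pos
  set s := (deriv ℓ x - r) / gradLipConst ℓ with hs
  have hs0 : 0 < s := div_pos (by linarith) hB
  have e1 : deriv ℓ x - r = gradLipConst ℓ * s := by rw [hs]; field_simp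
  have h1 := hr (x - s)
  have h2 := h.le_quadratic x (x - s)
  have h3 : 0 ≤ (r - deriv ℓ x) * x := mul_nonneg_of_nonpos_of_nonpos (by linarith) hx.2
  have h4 : 0 < gradLipConst ℓ * s ^ 2 := by positivity
  have h5 : (x - s - x) = -s := by ring
  rw [h5] at h2
  have h6 : (deriv ℓ x - r) * s = gradLipConst ℓ * s ^ 2 := by rw [e1]; ring
  nlinarith

end Conj

/-! ### Duality -/

section Duality
variable {X : Type u} [MeasurableSpace X] {H : Set (X → ℝ)} {ℓ : ℝ → ℝ} {μ : Measure (X × Bool)}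

theorem integrable_mul_of_bdd {Z : Type*} [MeasurableSpace Z] {ν : Measure Z}
    {f p : Z → ℝ} (hf : Measurable f) {C : ℝ} (h : ∀ z, |f z| ≤ C) (hp : Integrable p ν) :
    Integrable (fun z => f z * p z) ν :=
  hp.bdd_mul hf.aestronglyMeasurable (ae_of_all _ h)

/-- `⟨∇𝓛(Aλ), Aλ'⟩`. -/
noncomputable def gradRisk (ℓ : ℝ → ℝ) (μ : Measure (X × Bool)) (lam v : Weights H) : ℝ :=
  ∫ z, opA v z * deriv ℓ (opA lam z) ∂μ

theorem LossBds.integrable_deriv (h : LossBds ℓ) {Z : Type*} [MeasurableSpace Z] {ν : Measure Z}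
    [IsFiniteMeasure ν] {f : Z → ℝ} (hf : Measurable f) :
    Integrable (fun z => deriv ℓ (f z)) ν :=
  integrable_of_bdd (h.continuous_deriv.measurable.comp hf) fun z => by
    rw [abs_of_nonneg (h.deriv_nonneg _)]; exact h.deriv_le _

/-- The quadratic upper bound for the surrogate risk: `ℓ'` is `B₂`-Lipschitz and `A` is a contraction
from `ℓ¹` to the bounded functions. -/
theorem risk_add_le [IsProbabilityMeasure μ] (h : LossBds ℓ) (hb : IsBinary H)
    (hm : ∀ h ∈ H, Measurable h) (lam v : Weights H) :
    risk ℓ μ (lam + v) ≤ risk ℓ μ lam + gradRisk ℓ μ lam v + gradLipConst ℓ / 2 * ‖v‖ ^ 2 := by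
  have hA := measurable_opA hb hm
  have i1 := h.integrable_loss (ν := μ) (hA lam) (abs_opA_le hb lam)
  have i2 := integrable_mul_of_bdd (hA v) (abs_opA_le hb v) (h.integrable_deriv (ν := μ) (hA lam))
  have i3 : Integrable (fun _ => gradLipConst ℓ / 2 * ‖v‖ ^ 2) μ := integrable_const _
  have i4 : Integrable (fun z => ℓ (opA lam z) + opA v z * deriv ℓ (opA lam z)) μ := i1.add i2
  have e : risk ℓ μ lam + gradRisk ℓ μ lam v + gradLipConst ℓ / 2 * ‖v‖ ^ 2 =
      ∫ z, (ℓ (opA lam z) + opA v z * deriv ℓ (opA lam z)) + gradLipConst ℓ / 2 * ‖v‖ ^ 2 ∂μ := by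
    rw [integral_add i4 i3, integral_add i1 i2]
    simp [risk, gradRisk]
  rw [e]
  refine integral_mono (h.integrable_loss (hA _) (abs_opA_le hb _)) (i4.add i3)
    fun z => ?_
  have h1 := h.le_quadratic (opA lam z) (opA (lam + v) z)
  rw [opA_add hb, add_sub_cancel_left] at h1
  have h2 : opA v z ^ 2 ≤ ‖v‖ ^ 2 := sq_le_sq' (neg_le_of_abs_le (abs_opA_le hb v z))
    (le_of_abs_le (abs_opA_le hb v z))
  have h3 := h.gradLipConst_pos
  simp only [opA_add hb]
  nlinarith

theorem gradRisk_smul (c : ℝ) (lam v : Weights H) :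
    gradRisk ℓ μ lam (c • v) = c * gradRisk ℓ μ lam v := by
  unfold gradRisk
  rw [← integral_const_mul]
  congr 1; ext z
  rw [opA_smul]; ring

/-- Nearly optimal weightings whose risk does not decrease towards the origin. Along such a
sequence the gradients are almost annihilated by `Aᵀ`, since otherwise one coordinate step would
fall below the infimum. -/
theorem exists_nearly_optimal [IsProbabilityMeasure μ] (h : LossBds ℓ) (hb : IsBinary H)
    (hm : ∀ h ∈ H, Measurable h) {ε : ℝ} (hε : 0 < ε) :
    ∃ lam : Weights H, gradRisk ℓ μ lam lam ≤ 0 ∧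
      ∀ k : H, |gradRisk ℓ μ lam (unitWeight k)| ≤ ε := by
  have hB := h.gradLipConst_pos
  set e := ε ^ 2 / (2 * gradLipConst ℓ) with he
  have hepos : 0 < e := by positivity
  obtain ⟨l0, hl0⟩ := exists_lt_of_ciInf_lt (show optRisk ℓ μ H < optRisk ℓ μ H + e by linarith)
  have hcont : Continuous fun s : ℝ => risk ℓ μ (s • l0) :=
    (continuous_risk h hb hm).comp (continuous_id.smul continuous_const)
  obtain ⟨s, hs, hmin⟩ := isCompact_Icc.exists_isMinOn (nonempty_Icc.2 zero_le_one)
    hcont.continuousOn (s := Icc (0 : ℝ) 1)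
  rw [isMinOn_iff] at hmin
  refine ⟨s • l0, ?_, fun k => ?_⟩
  · by_contra! hpos
    set G := gradRisk ℓ μ (s • l0) (s • l0)
    set C := gradLipConst ℓ / 2 * ‖s • l0‖ ^ 2
    have hC : 0 ≤ C := by positivity
    have key : ∀ r ∈ Icc (0 : ℝ) 1, 0 ≤ -(r * G) + r ^ 2 * C := by
      intro r hr
      have h1 := risk_add_le (μ := μ) h hb hm (s • l0) ((-r) • (s • l0))
      rw [gradRisk_smul, norm_smul, Real.norm_eq_abs, abs_neg, abs_of_nonneg hr.1] at h1
      have h2 := hmin ((1 - r) * s) ⟨mul_nonneg (by linarith [hr.2]) hs.1,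
        mul_le_one₀ (by linarith [hr.1]) hs.1 hs.2⟩
      have h3 : s • l0 + (-r) • (s • l0) = ((1 - r) * s) • l0 := by module
      rw [h3] at h1
      have e1 : gradLipConst ℓ / 2 * (r * ‖s • l0‖) ^ 2 = r ^ 2 * C := by simp only [C]; ring
      rw [e1] at h1
      linarith
    have h1 := key (G / (G + 2 * C)) ⟨by positivity, div_le_one_of_le₀ (by linarith) (by positivity)⟩
    have hD : 0 < G + 2 * C := by positivity
    have e2 : -(G / (G + 2 * C) * G) + (G / (G + 2 * C)) ^ 2 * C
        = -(G ^ 2 * (G + C)) / (G + 2 * C) ^ 2 := by field_simp; ring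
    rw [e2] at h1
    have : 0 < G ^ 2 * (G + C) / (G + 2 * C) ^ 2 := by positivity
    rw [neg_div] at h1
    linarith
  · set G := gradRisk ℓ μ (s • l0) (unitWeight k)
    have h1 := risk_add_le (μ := μ) h hb hm (s • l0) ((-(G / gradLipConst ℓ)) • unitWeight k)
    have h2 := optRisk_le (μ := μ) h (s • l0 + (-(G / gradLipConst ℓ)) • unitWeight k)
    rw [gradRisk_smul, norm_smul, norm_unitWeight, mul_one, Real.norm_eq_abs, sq_abs] at h1
    have h3 := hmin 1 (right_mem_Icc.2 zero_le_one)
    rw [one_smul] at h3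
    have e1 : -(G / gradLipConst ℓ) * G + gradLipConst ℓ / 2 * (-(G / gradLipConst ℓ)) ^ 2 =
      -(G ^ 2 / (2 * gradLipConst ℓ)) := by field_simp; ring
    have h4 : G ^ 2 / (2 * gradLipConst ℓ) ≤ ε ^ 2 / (2 * gradLipConst ℓ) := by
      rw [← he]
      have e3 : gradRisk ℓ μ (s • l0) (unitWeight k) = G := rfl
      rw [e3] at h1
      change risk ℓ μ l0 < _ at hl0
      linarith
    rw [div_le_div_iff_of_pos_right (by positivity)] at h4
    exact abs_le_of_sq_le_sq h4 hε.le

theorem dual_integrable_mul [IsProbabilityMeasure μ] {p : X × Bool → ℝ}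
    (hb : IsBinary H) (hm : ∀ h ∈ H, Measurable h)
    (hp : Integrable p μ) (lam : Weights H) : Integrable (fun z => opA lam z * p z) μ :=
  integrable_mul_of_bdd (measurable_opA hb hm lam) (abs_opA_le hb lam) hp

/-- An integrable density orthogonal to all weak learners is orthogonal to all of `Λ`. -/
theorem integral_opA_mul_eq_zero [IsProbabilityMeasure μ] {p : X × Bool → ℝ}
    (hb : IsBinary H) (hm : ∀ h ∈ H, Measurable h) (hp : Integrable p μ)
    (h0 : ∀ k : H, ∫ z, opA (unitWeight k) z * p z ∂μ = 0) (lam : Weights H) :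
    ∫ z, opA lam z * p z ∂μ = 0 := by
  obtain ⟨s, hs⟩ := Weights.exists_seq_trunc lam
  have h1 : ∀ n, ∫ z, opA (Weights.trunc lam (s n)) z * p z ∂μ = 0 := by
    intro n
    have : ∀ z, opA (Weights.trunc lam (s n)) z * p z
        = ∑ k ∈ s n, lam k * (opA (unitWeight k) z * p z) := by
      intro z
      rw [opA_eq, opH_trunc hb, Finset.mul_sum, Finset.sum_mul]
      refine Finset.sum_congr rfl fun k _ => ?_
      rw [opA_unitWeight]; ring
    simp_rw [this]
    rw [integral_finsetSum _ fun k _ => (dual_integrable_mul hb hm hp _).const_mul _]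
    refine Finset.sum_eq_zero fun k _ => ?_
    rw [integral_const_mul, h0, mul_zero]
  have h2 : Tendsto (fun n => ∫ z, opA (Weights.trunc lam (s n)) z * p z ∂μ) atTop
      (𝓝 (∫ z, opA lam z * p z ∂μ)) := by
    refine tendsto_integral_of_dominated_convergence (fun z => ‖lam‖ * |p z|)
      (fun n => (dual_integrable_mul hb hm hp _).aestronglyMeasurable) (hp.abs.const_mul _)
      (fun n => ae_of_all _ fun z => ?_) (ae_of_all _ fun z => ?_)
    · rw [norm_mul]
      exact mul_le_mul_of_nonneg_right
        ((abs_opA_le hb _ z).trans (Weights.norm_trunc_le lam _)) (abs_nonneg _)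
    · exact (((continuous_opA hb z).tendsto lam).comp hs).mul_const _
  simp_rw [h1] at h2
  exact tendsto_nhds_unique h2 tendsto_const_nhds |>.symm ▸ rfl

/-- Weak duality. -/
theorem neg_integral_conj_le_optRisk [IsProbabilityMeasure μ] (h : LossBds ℓ) (hb : IsBinary H)
    (hm : ∀ h ∈ H, Measurable h) {q : Lp ℝ ⊤ μ} (hq : DualFeasible ℓ μ H q) :
    -∫ z, conj ℓ (q z) ∂μ ≤ optRisk ℓ μ H := by
  refine le_ciInf fun lam => ?_
  have hqi : Integrable q μ := (Lp.memLp q).integrable le_top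
  have i1 := dual_integrable_mul hb hm hqi lam
  have i2 := h.integrable_loss (ν := μ) (measurable_opA hb hm lam) (abs_opA_le hb lam)
  rw [← integral_neg]
  have e : risk ℓ μ lam = ∫ z, ℓ (opA lam z) - opA lam z * q z ∂μ := by
    rw [integral_sub i2 i1, hq.adjoint_eq_zero lam, sub_zero]; rfl
  rw [e]
  refine integral_mono_ae hq.conj_integrable.neg (i2.sub i1) ?_
  filter_upwards [hq.conj_finite] with z hz
  have := le_conj hz (opA lam z)
  linarith

/-- The maximizer of `x ↦ p x - ℓ(x)` over the first `n` points of a sequence starting at `0`. -/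
noncomputable def argMaxSeq (ℓ : ℝ → ℝ) (x : ℕ → ℝ) (p : ℝ) : ℕ → ℝ
  | 0 => 0
  | n + 1 => if p * argMaxSeq ℓ x p n - ℓ (argMaxSeq ℓ x p n) ≤ p * x n - ℓ (x n) then x n
      else argMaxSeq ℓ x p n

theorem argMaxSeq_succ_ge (x : ℕ → ℝ) (p : ℝ) (n : ℕ) :
    p * argMaxSeq ℓ x p n - ℓ (argMaxSeq ℓ x p n)
      ≤ p * argMaxSeq ℓ x p (n + 1) - ℓ (argMaxSeq ℓ x p (n + 1)) ∧
    p * x n - ℓ (x n) ≤ p * argMaxSeq ℓ x p (n + 1) - ℓ (argMaxSeq ℓ x p (n + 1)) := by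
  simp only [argMaxSeq]
  split_ifs with hc
  · exact ⟨hc, le_rfl⟩
  · exact ⟨le_rfl, (not_le.1 hc).le⟩

theorem argMaxSeq_bdd (x : ℕ → ℝ) (n : ℕ) : ∃ C, ∀ p, |argMaxSeq ℓ x p n| ≤ C := by
  induction n with
  | zero => exact ⟨0, fun p => by simp [argMaxSeq]⟩
  | succ n ih =>
    obtain ⟨C, hC⟩ := ih
    refine ⟨max C |x n|, fun p => ?_⟩
    simp only [argMaxSeq]
    split_ifs
    · exact le_max_right _ _
    · exact (hC p).trans (le_max_left _ _)

theorem measurable_argMaxSeq (hl : Measurable ℓ) (x : ℕ → ℝ) (n : ℕ) :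
    Measurable fun p => argMaxSeq ℓ x p n := by
  induction n with
  | zero => exact measurable_const
  | succ n ih =>
    simp only [argMaxSeq]
    refine Measurable.ite ?_ measurable_const ih
    exact measurableSet_le ((measurable_id.mul ih).sub (hl.comp ih))
      ((measurable_id.mul_const _).sub_const _)

/-- If `∫ (p f - ℓ(f)) ≤ C` for all bounded measurable `f`, then `ℓ*(p)` is integrable with
integral at most `C`. -/
theorem LossBds.conj_integrable_of_forall [IsProbabilityMeasure μ] (h : LossBds ℓ)
    {p : X × Bool → ℝ} (hpm : Measurable p) (hp : Integrable p μ) {C : ℝ}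
    (hC : ∀ f : X × Bool → ℝ, Measurable f → (∃ D, ∀ z, |f z| ≤ D) →
      ∫ z, f z * p z ∂μ - ∫ z, ℓ (f z) ∂μ ≤ C) :
    (∀ᵐ z ∂μ, BddAbove (range fun x : ℝ => p z * x - ℓ x)) ∧
      Integrable (fun z => conj ℓ (p z)) μ ∧ ∫ z, conj ℓ (p z) ∂μ ≤ C := by
  set x := TopologicalSpace.denseSeq ℝ
  have hx : DenseRange x := TopologicalSpace.denseRange_denseSeq ℝ
  let f : ℕ → X × Bool → ℝ := fun n z => argMaxSeq ℓ x (p z) n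
  let g : ℕ → X × Bool → ℝ := fun n z => f n z * p z - ℓ (f n z)
  have hfm : ∀ n, Measurable (f n) := fun n =>
    (measurable_argMaxSeq h.continuous.measurable x n).comp hpm
  have hfb : ∀ n, ∃ D, ∀ z, |f n z| ≤ D := fun n =>
    (argMaxSeq_bdd (ℓ := ℓ) x n).imp fun D hD z => hD (p z)
  have hgm : ∀ n, Measurable (g n) := fun n =>
    ((hfm n).mul hpm).sub (h.continuous.measurable.comp (hfm n))
  have hgi : ∀ n, Integrable (g n) μ := fun n => by
    obtain ⟨D, hD⟩ := hfb n
    exact (integrable_mul_of_bdd (hfm n) hD hp).sub (h.integrable_loss (hfm n) hD)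
  have hgC : ∀ n, ∫ z, g n z ∂μ ≤ C := fun n => by
    obtain ⟨D, hD⟩ := hfb n
    have := hC (f n) (hfm n) ⟨D, hD⟩
    rwa [← integral_sub (integrable_mul_of_bdd (hfm n) hD hp) (h.integrable_loss (hfm n) hD)]
      at this
  have hgs : ∀ n z, g n z ≤ g (n + 1) z ∧ p z * x n - ℓ (x n) ≤ g (n + 1) z := fun n z => by
    have := argMaxSeq_succ_ge (ℓ := ℓ) x (p z) n
    simp only [g, f, mul_comm _ (p z)]
    exact this
  have hmono : ∀ z, Monotone fun n => g n z := fun z => monotone_nat_of_le_succ fun n => (hgs n z).1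
  have hg0 : ∀ n z, 0 ≤ g n z + ℓ 0 := fun n z => by
    have h1 : g 0 z ≤ g n z := hmono z (Nat.zero_le n)
    have h2 : g 0 z = -ℓ 0 := by simp [g, f, argMaxSeq]
    linarith
  have hlint : ∀ n, ∫⁻ z, ENNReal.ofReal (g n z + ℓ 0) ∂μ ≤ ENNReal.ofReal (C + ℓ 0) := fun n => by
    have i5 : Integrable (fun z => g n z + ℓ 0) μ := (hgi n).add (integrable_const _)
    rw [← ofReal_integral_eq_lintegral_ofReal i5
      (ae_of_all _ (hg0 n)), integral_add (hgi n) (integrable_const _)]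
    refine ENNReal.ofReal_le_ofReal ?_
    simpa using hgC n
  have hsup : ∫⁻ z, ⨆ n, ENNReal.ofReal (g n z + ℓ 0) ∂μ ≤ ENNReal.ofReal (C + ℓ 0) := by
    rw [lintegral_iSup (fun n => ((hgm n).add_const _).ennreal_ofReal)
      (fun n m hnm z => ENNReal.ofReal_le_ofReal (by linarith [hmono z hnm]))]
    exact iSup_le hlint
  have hfin : ∀ᵐ z ∂μ, ⨆ n, ENNReal.ofReal (g n z + ℓ 0) < ⊤ :=
    ae_lt_top (Measurable.iSup fun n => ((hgm n).add_const _).ennreal_ofReal)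
      (hsup.trans_lt ENNReal.ofReal_lt_top).ne
  have hgbd : ∀ᵐ z ∂μ, ∃ D, ∀ n, g n z ≤ D := by
    filter_upwards [hfin] with z hz
    refine ⟨(⨆ n, ENNReal.ofReal (g n z + ℓ 0)).toReal, fun n => ?_⟩
    have h1 := ENNReal.toReal_mono hz.ne (le_iSup (fun n => ENNReal.ofReal (g n z + ℓ 0)) n)
    rw [ENNReal.toReal_ofReal (hg0 n z)] at h1
    linarith [h.nonneg 0]
  have hall : ∀ z D, (∀ n, g n z ≤ D) → ∀ y, p z * y - ℓ y ≤ D := by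
    intro z D hD y
    have hc : IsClosed {y | p z * y - ℓ y ≤ D} :=
      isClosed_le ((continuous_const.mul continuous_id).sub h.continuous) continuous_const
    refine hx.induction_on (p := fun y => p z * y - ℓ y ≤ D) y hc fun n => ?_
    exact (hgs n z).2.trans (hD _)
  have hbd : ∀ᵐ z ∂μ, BddAbove (range fun y : ℝ => p z * y - ℓ y) := by
    filter_upwards [hgbd] with z ⟨D, hD⟩
    exact ⟨D, by rintro _ ⟨y, rfl⟩; exact hall z D hD y⟩
  have hlim : ∀ᵐ z ∂μ, Tendsto (fun n => g n z) atTop (𝓝 (conj ℓ (p z))) := by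
    filter_upwards [hgbd, hbd] with z ⟨D, hD⟩ hz
    have hb : BddAbove (range fun n => g n z) := ⟨D, by rintro _ ⟨n, rfl⟩; exact hD n⟩
    have h1 := tendsto_atTop_ciSup (hmono z) hb
    have h2 : ⨆ n, g n z = conj ℓ (p z) := by
      refine le_antisymm (ciSup_le fun n => ?_) (conj_le (hall z _ fun n => le_ciSup hb n))
      have := le_conj hz (f n z)
      simpa [g, mul_comm] using this
    rwa [h2] at h1
  have hmeas : AEStronglyMeasurable (fun z => conj ℓ (p z)) μ :=
    aestronglyMeasurable_of_tendsto_ae atTop (fun n => (hgm n).aestronglyMeasurable) hlim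
  have hnn : ∀ᵐ z ∂μ, 0 ≤ conj ℓ (p z) + ℓ 0 := by
    filter_upwards [hbd] with z hz
    have := le_conj hz 0
    simp at this; linarith
  have hle : ∫⁻ z, ENNReal.ofReal (conj ℓ (p z) + ℓ 0) ∂μ ≤ ENNReal.ofReal (C + ℓ 0) := by
    refine le_trans (lintegral_mono_ae ?_) hsup
    filter_upwards [hlim] with z hz
    exact le_of_tendsto ((ENNReal.continuous_ofReal.tendsto _).comp (hz.add_const (ℓ 0)))
      (Eventually.of_forall fun n => le_iSup (fun n => ENNReal.ofReal (g n z + ℓ 0)) n)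
  have hi : Integrable (fun z => conj ℓ (p z) + ℓ 0) μ := by
    refine ⟨hmeas.add aestronglyMeasurable_const, ?_⟩
    rw [hasFiniteIntegral_iff_ofReal hnn]
    exact hle.trans_lt ENNReal.ofReal_lt_top
  have hi' : Integrable (fun z => conj ℓ (p z)) μ :=
    (hi.sub (integrable_const (ℓ 0))).congr (ae_of_all _ fun z => by simp)
  refine ⟨hbd, hi', ?_⟩
  have h1 := integral_eq_lintegral_of_nonneg_ae hnn hi.aestronglyMeasurable
  rw [integral_add hi' (integrable_const _)] at h1
  have hC0 : 0 ≤ C + ℓ 0 := by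
    have := hgC 0
    have e : ∫ z, g 0 z ∂μ = -ℓ 0 := by simp [g, f, argMaxSeq]
    linarith
  have h2 := ENNReal.toReal_mono ENNReal.ofReal_ne_top hle
  rw [ENNReal.toReal_ofReal hC0, ← h1] at h2
  simp at h2
  exact h2

end Duality

section Duality
variable {X : Type u} [MeasurableSpace X] {H : Set (X → ℝ)} {ℓ : ℝ → ℝ} {μ : Measure (X × Bool)}

theorem exists_clm_integral_mul {Z : Type*} [MeasurableSpace Z] {ν : Measure Z}
    [IsFiniteMeasure ν] {f : Z → ℝ} (hf : Measurable f) {C : ℝ} (hC : ∀ z, |f z| ≤ C) :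
    ∃ T : Lp ℝ 2 ν →L[ℝ] ℝ, ∀ p : Lp ℝ 2 ν, T p = ∫ z, f z * p z ∂ν := by
  have hm : MemLp f 2 ν := MemLp.of_bound hf.aestronglyMeasurable C (ae_of_all _ hC)
  refine ⟨innerSL ℝ (hm.toLp f), fun p => ?_⟩
  rw [innerSL_apply_apply, L2.inner_def]
  refine integral_congr_ae ?_
  filter_upwards [hm.coeFn_toLp] with z hz
  simp [hz, mul_comm]

/-- The convex sets whose common point is a dual optimum: densities whose dual value is at least
`𝓛̄`, and which are annihilated by `Aᵀ` up to `ε`. -/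
def dualApprox (ℓ : ℝ → ℝ) (μ : Measure (X × Bool)) (H : Set (X → ℝ)) (ε : ℝ) :
    Set (Lp ℝ 2 μ) :=
  {p | (∀ f : X × Bool → ℝ, Measurable f → (∃ D, ∀ z, |f z| ≤ D) →
      ∫ z, f z * p z ∂μ - ∫ z, ℓ (f z) ∂μ ≤ -optRisk ℓ μ H) ∧
    ∀ k : H, |∫ z, opA (unitWeight k) z * p z ∂μ| ≤ ε}

theorem isClosed_dualApprox [IsProbabilityMeasure μ] (hb : IsBinary H)
    (hm : ∀ h ∈ H, Measurable h) (ε : ℝ) : IsClosed (dualApprox ℓ μ H ε) := by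
  have e : dualApprox ℓ μ H ε = (⋂ f : X × Bool → ℝ, ⋂ (_ : Measurable f),
      ⋂ (_ : ∃ D, ∀ z, |f z| ≤ D),
        {p : Lp ℝ 2 μ | ∫ z, f z * p z ∂μ - ∫ z, ℓ (f z) ∂μ ≤ -optRisk ℓ μ H}) ∩
      ⋂ k : H, {p : Lp ℝ 2 μ | |∫ z, opA (unitWeight k) z * p z ∂μ| ≤ ε} := by
    ext p; simp [dualApprox]
  rw [e]
  refine IsClosed.inter (isClosed_iInter fun f => isClosed_iInter fun hf => isClosed_iInter
    fun ⟨D, hD⟩ => ?_) (isClosed_iInter fun k => ?_)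
  · obtain ⟨T, hT⟩ := exists_clm_integral_mul (ν := μ) hf hD
    simp_rw [← hT]
    exact isClosed_le (T.continuous.sub continuous_const) continuous_const
  · obtain ⟨T, hT⟩ := exists_clm_integral_mul (ν := μ) (measurable_opA hb hm (unitWeight k))
      (abs_opA_le hb _)
    simp_rw [← hT]
    exact isClosed_le T.continuous.abs continuous_const

theorem convex_dualApprox [IsProbabilityMeasure μ] (hb : IsBinary H)
    (hm : ∀ h ∈ H, Measurable h) (ε : ℝ) : Convex ℝ (dualApprox ℓ μ H ε) := by
  intro p hp q hq a b ha hb' hab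
  refine ⟨fun f hf ⟨D, hD⟩ => ?_, fun k => ?_⟩
  · obtain ⟨T, hT⟩ := exists_clm_integral_mul (ν := μ) hf hD
    have h1 := hp.1 f hf ⟨D, hD⟩
    have h2 := hq.1 f hf ⟨D, hD⟩
    rw [← hT] at h1 h2 ⊢
    rw [map_add, map_smul, map_smul, smul_eq_mul, smul_eq_mul]
    have h3 := mul_le_mul_of_nonneg_left h1 ha
    have h4 := mul_le_mul_of_nonneg_left h2 hb'
    have e1 : a = 1 - b := by linarith
    subst e1
    linarith
  · obtain ⟨T, hT⟩ := exists_clm_integral_mul (ν := μ) (measurable_opA hb hm (unitWeight k))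
      (abs_opA_le hb _)
    have h1 := hp.2 k
    have h2 := hq.2 k
    rw [← hT] at h1 h2 ⊢
    rw [map_add, map_smul, map_smul, smul_eq_mul, smul_eq_mul]
    refine (abs_add_le _ _).trans ?_
    rw [abs_mul, abs_mul, abs_of_nonneg ha, abs_of_nonneg hb']
    have h3 := mul_le_mul_of_nonneg_left h1 ha
    have h4 := mul_le_mul_of_nonneg_left h2 hb'
    have e1 : a = 1 - b := by linarith
    subst e1
    linarith

/-- The derivative of the loss at a nearly optimal weighting is an approximate dual optimum. -/
theorem exists_mem_dualApprox [IsProbabilityMeasure μ] (h : LossBds ℓ) (hb : IsBinary H)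
    (hm : ∀ h ∈ H, Measurable h) {ε : ℝ} (hε : 0 < ε) :
    ∃ p ∈ dualApprox ℓ μ H ε, ‖p‖ ≤ lipConst ℓ := by
  obtain ⟨lam, h0, hk⟩ := exists_nearly_optimal (μ := μ) h hb hm hε
  have hA := measurable_opA hb hm lam
  set p₀ : X × Bool → ℝ := fun z => deriv ℓ (opA lam z) with hp₀
  have hpb : ∀ z, ‖p₀ z‖ ≤ lipConst ℓ := fun z => by
    rw [Real.norm_eq_abs, abs_of_nonneg (h.deriv_nonneg _)]; exact h.deriv_le _
  have hpi : Integrable p₀ μ := h.integrable_deriv hA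
  have hpm : MemLp p₀ 2 μ := MemLp.of_bound hpi.aestronglyMeasurable _ (ae_of_all _ hpb)
  have hco := hpm.coeFn_toLp
  have hint : ∀ f : X × Bool → ℝ, ∫ z, f z * (hpm.toLp p₀) z ∂μ = ∫ z, f z * p₀ z ∂μ := fun f => by
    refine integral_congr_ae ?_
    filter_upwards [hco] with z hz
    rw [hz]
  refine ⟨hpm.toLp p₀, ⟨fun f hf ⟨D, hD⟩ => ?_, fun k => ?_⟩, ?_⟩
  · rw [hint]
    have i1 := integrable_mul_of_bdd hf hD hpi
    have i2 := h.integrable_loss (ν := μ) hf hD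
    have i3 := integrable_mul_of_bdd hA (abs_opA_le hb lam) hpi
    have i4 := h.integrable_loss (ν := μ) hA (abs_opA_le hb lam)
    have h1 : ∫ z, (f z * p₀ z - ℓ (f z)) ∂μ ≤ ∫ z, (opA lam z * p₀ z - ℓ (opA lam z)) ∂μ := by
      refine integral_mono (i1.sub i2) (i3.sub i4) fun z => ?_
      have := h.sub_le_of_deriv (opA lam z) (f z)
      simp only [hp₀]
      linarith
    rw [integral_sub i1 i2, integral_sub i3 i4] at h1
    have h2 := optRisk_le (μ := μ) h lam
    simp only [gradRisk] at h0
    simp only [risk] at h2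
    linarith
  · rw [hint]
    exact hk k
  · rw [Lp.norm_toLp]
    refine ENNReal.toReal_le_of_le_ofReal h.lipConst_pos.le ?_
    refine (eLpNorm_le_of_ae_bound (ae_of_all _ hpb)).trans ?_
    simp

/-- Densities with dual value at least `𝓛̄ ≥ 0` take values in `[0, β₂]`. -/
theorem mem_Icc_of_forall_integral_le [IsProbabilityMeasure μ] (h : LossBds ℓ)
    {p : X × Bool → ℝ} (hp : Integrable p μ) {C : ℝ}
    (hC : ∀ f : X × Bool → ℝ, Measurable f → (∃ D, ∀ z, |f z| ≤ D) →
      ∫ z, f z * p z ∂μ - ∫ z, ℓ (f z) ∂μ ≤ C) :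
    ∀ᵐ z ∂μ, p z ∈ Icc 0 (lipConst ℓ) := by
  -- testing against large multiples of indicators shows both inequalities
  have key : ∀ (s : Set (X × Bool)), MeasurableSet s → ∀ t : ℝ,
      t * ∫ z in s, p z ∂μ ≤ C + ℓ 0 + max t 0 * (lipConst ℓ * μ.real s) := by
    intro s hs t
    have hfm : Measurable (s.indicator fun _ => t) := measurable_const.indicator hs
    have hfb : ∀ z, |s.indicator (fun _ => t) z| ≤ |t| := fun z => by
      by_cases hz : z ∈ s <;> simp [hz]
    have h1 := hC _ hfm ⟨_, hfb⟩
    have e1 : ∫ z, s.indicator (fun _ => t) z * p z ∂μ = t * ∫ z in s, p z ∂μ := by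
      rw [← integral_const_mul, ← integral_indicator hs]
      refine integral_congr_ae (ae_of_all _ fun z => ?_)
      by_cases hz : z ∈ s <;> simp [hz]
    have h2 : ∫ z, ℓ (s.indicator (fun _ => t) z) ∂μ
        ≤ ∫ z, (ℓ 0 + s.indicator (fun _ => max t 0 * lipConst ℓ) z) ∂μ := by
      refine integral_mono (h.integrable_loss hfm hfb)
        ((integrable_const _).add ((integrable_const _).indicator hs)) fun z => ?_
      by_cases hz : z ∈ s
      · simp only [hz, indicator_of_mem]
        have h3 := h.le_zero_add (le_max_right t 0)
        have h4 := h.monotone (le_max_left t 0)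
        linarith
      · simp [hz]
    rw [integral_add (integrable_const _) ((integrable_const _).indicator hs),
      integral_indicator hs] at h2
    simp only [integral_const, probReal_univ, measureReal_restrict_apply_univ,
      smul_eq_mul] at h2
    rw [e1] at h1
    linarith
  have hpos : 0 ≤ᵐ[μ] p := by
    refine ae_nonneg_of_forall_setIntegral_nonneg hp fun s hs _ => ?_
    by_contra! hneg
    set I := ∫ z in s, p z ∂μ
    have h1 := key s hs (-((|C + ℓ 0| + 1) / (-I)))
    have hq : 0 < (|C + ℓ 0| + 1) / (-I) := div_pos (by positivity) (by linarith)
    have e : -((|C + ℓ 0| + 1) / -I) * I = |C + ℓ 0| + 1 := by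
      have : I ≠ 0 := hneg.ne
      field_simp
    rw [e, max_eq_right (by linarith)] at h1
    linarith [le_abs_self (C + ℓ 0)]
  have hle : 0 ≤ᵐ[μ] fun z => lipConst ℓ - p z := by
    refine ae_nonneg_of_forall_setIntegral_nonneg ((integrable_const _).sub hp) fun s hs _ => ?_
    rw [integral_sub (integrable_const _) hp.integrableOn]
    simp only [integral_const, measureReal_restrict_apply_univ, smul_eq_mul]
    by_contra! hneg
    set I := ∫ z in s, p z ∂μ
    have hJ : 0 < I - lipConst ℓ * μ.real s := by linarith [mul_comm (lipConst ℓ) (μ.real s)]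
    have hq : 0 < (|C + ℓ 0| + 1) / (I - lipConst ℓ * μ.real s) := div_pos (by positivity) hJ
    have h1 := key s hs ((|C + ℓ 0| + 1) / (I - lipConst ℓ * μ.real s))
    rw [max_eq_left hq.le] at h1
    have e : (|C + ℓ 0| + 1) / (I - lipConst ℓ * μ.real s) * (I - lipConst ℓ * μ.real s)
        = |C + ℓ 0| + 1 := div_mul_cancel₀ _ hJ.ne'
    rw [mul_sub] at e
    linarith [le_abs_self (C + ℓ 0)]
  filter_upwards [hpos, hle] with z h1 h2
  exact ⟨h1, by simpa using h2⟩

/-- A dual feasible density attaining the primal infimum. -/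
theorem exists_dualFeasible_ge [IsProbabilityMeasure μ] (h : LossBds ℓ) (hb : IsBinary H)
    (hm : ∀ h ∈ H, Measurable h) :
    ∃ p : Lp ℝ ⊤ μ, DualFeasible ℓ μ H p ∧ optRisk ℓ μ H ≤ -∫ z, conj ℓ (p z) ∂μ := by
  obtain ⟨p, hp⟩ := exists_mem_iInter_of_closed_convex
    (fun n : ℕ => dualApprox ℓ μ H (1 / ((n : ℝ) + 1)))
    (fun n m hnm q hq => ⟨hq.1, fun k => (hq.2 k).trans (Nat.one_div_le_one_div hnm)⟩)
    (fun n => isClosed_dualApprox hb hm _) (fun n => convex_dualApprox hb hm _) (lipConst ℓ)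
    (fun n => exists_mem_dualApprox h hb hm Nat.one_div_pos_of_nat)
  have hpi : Integrable p μ := (Lp.memLp p).integrable (by norm_num)
  have hpm : Measurable p := (Lp.stronglyMeasurable p).measurable
  have h01 := mem_Icc_of_forall_integral_le h hpi (hp 0).1
  obtain ⟨c1, c2, c3⟩ := h.conj_integrable_of_forall hpm hpi (hp 0).1
  have h0 : ∀ k : H, ∫ z, opA (unitWeight k) z * p z ∂μ = 0 := fun k => by
    rw [← abs_nonpos_iff]
    exact ge_of_tendsto' tendsto_one_div_add_atTop_nhds_zero_nat fun n => (hp n).2 k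
  have hmem : MemLp p ⊤ μ := by
    refine memLp_top_of_bound hpi.aestronglyMeasurable (lipConst ℓ) ?_
    filter_upwards [h01] with z hz
    rw [Real.norm_eq_abs, abs_of_nonneg hz.1]; exact hz.2
  have hco := hmem.coeFn_toLp
  refine ⟨hmem.toLp p, ⟨?_, fun lam => ?_, ?_, ?_⟩, ?_⟩
  · filter_upwards [hco, h01] with z hz h1
    rwa [hz]
  · rw [← integral_opA_mul_eq_zero hb hm hpi h0 lam]
    refine integral_congr_ae ?_
    filter_upwards [hco] with z hz
    rw [hz]
  · filter_upwards [hco, c1] with z hz h1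
    rwa [hz]
  · refine c2.congr ?_
    filter_upwards [hco] with z hz
    rw [hz]
  · have : ∫ z, conj ℓ ((hmem.toLp p) z) ∂μ = ∫ z, conj ℓ (p z) ∂μ := by
      refine integral_congr_ae ?_
      filter_upwards [hco] with z hz
      rw [hz]
    rw [this]
    linarith

theorem exists_isDualOptimum [IsProbabilityMeasure μ] (h : LossBds ℓ) (hb : IsBinary H)
    (hm : ∀ h ∈ H, Measurable h) : ∃ p : Lp ℝ ⊤ μ, IsDualOptimum ℓ μ H p := by
  obtain ⟨p, hp, hv⟩ := exists_dualFeasible_ge (μ := μ) h hb hm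
  exact ⟨p, hp, fun q hq => (neg_integral_conj_le_optRisk h hb hm hq).trans hv⟩

/-- Strong duality. -/
theorem IsDualOptimum.integral_conj [IsProbabilityMeasure μ] (h : LossBds ℓ) (hb : IsBinary H)
    (hm : ∀ h ∈ H, Measurable h) {p : Lp ℝ ⊤ μ} (hp : IsDualOptimum ℓ μ H p) :
    ∫ z, conj ℓ (p z) ∂μ = -optRisk ℓ μ H := by
  obtain ⟨q, hq, hv⟩ := exists_dualFeasible_ge (μ := μ) h hb hm
  have h1 := hp.2 q hq
  have h2 := neg_integral_conj_le_optRisk h hb hm hp.1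
  linarith

/-- Jensen's inequality gives `∫ p̄ ≥ (ℓ*)⁻¹(-𝓛̄)`, and `p̄ ≤ β₂` turns this lower bound of the
mean into one for the mass of an upper level set. -/
theorem dualLevel_spec [IsProbabilityMeasure μ] (h : LossBds ℓ) (hb : IsBinary H)
    (hm : ∀ h ∈ H, Measurable h) (hL : 0 < optRisk ℓ μ H) {p : Lp ℝ ⊤ μ}
    (hp : IsDualOptimum ℓ μ H p) :
    0 < dualLevel ℓ μ H ∧ dualLevel ℓ μ H ≤ μ.real {z | dualLevel ℓ μ H ≤ p z} := by
  have hL0 : optRisk ℓ μ H ≤ ℓ 0 := by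
    have := optRisk_le (μ := μ) h (0 : Weights H)
    rwa [risk_zero] at this
  obtain ⟨hq, hqv⟩ := h.conjInv_spec hL hL0
  set q := conjInv ℓ (-optRisk ℓ μ H) with hqdef
  have hM : 0 < max 1 (lipConst ℓ) := lt_max_of_lt_left one_pos
  have hτ : dualLevel ℓ μ H = q / (2 * max 1 (lipConst ℓ)) := rfl
  have hτ0 : 0 < dualLevel ℓ μ H := by rw [hτ]; exact div_pos hq.1 (by positivity)
  refine ⟨hτ0, ?_⟩
  set τ := dualLevel ℓ μ H
  have hpi : Integrable p μ := (Lp.memLp p).integrable le_top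
  have hpm : Measurable p := (Lp.stronglyMeasurable p).measurable
  have hmean : q ≤ ∫ z, p z ∂μ := by
    refine h.le_of_forall_sub_le hq fun x => ?_
    rw [hqv, ← hp.integral_conj h hb hm]
    have e : (∫ z, p z ∂μ) * x - ℓ x = ∫ z, (p z * x - ℓ x) ∂μ := by
      rw [integral_sub (hpi.mul_const x) (integrable_const _), integral_mul_const]
      simp
    rw [e]
    refine integral_mono_ae ((hpi.mul_const x).sub (integrable_const _)) hp.1.conj_integrable ?_
    filter_upwards [hp.1.conj_finite] with z hz using le_conj hz x
  have hs : MeasurableSet {z | τ ≤ p z} := measurableSet_le measurable_const hpm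
  have hup : ∫ z, p z ∂μ ≤ ∫ z, (τ + {z | τ ≤ p z}.indicator (fun _ => lipConst ℓ) z) ∂μ := by
    refine integral_mono_ae hpi ((integrable_const _).add ((integrable_const _).indicator hs)) ?_
    filter_upwards [hp.1.mem_Icc] with z hz
    by_cases hzs : τ ≤ p z
    · simp only [indicator, mem_ofPred_eq, hzs, if_true]
      linarith [hz.2]
    · simp only [indicator, mem_ofPred_eq, hzs, if_false]
      linarith
  rw [integral_add (integrable_const _) ((integrable_const _).indicator hs),
    integral_indicator hs] at hup
  simp only [integral_const, probReal_univ, measureReal_restrict_apply_univ,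
    smul_eq_mul] at hup
  have e1 : τ * (2 * max 1 (lipConst ℓ)) = q := by
    rw [hτ]; exact div_mul_cancel₀ _ (by positivity)
  set M := μ.real {z | τ ≤ p z}
  have hM0 : 0 ≤ M := measureReal_nonneg
  have h1 : M * lipConst ℓ ≤ M * max 1 (lipConst ℓ) :=
    mul_le_mul_of_nonneg_left (le_max_right _ _) hM0
  have h2 : τ * 1 ≤ τ * max 1 (lipConst ℓ) := mul_le_mul_of_nonneg_left (le_max_left _ _) hτ0.le
  have h3 : τ * max 1 (lipConst ℓ) ≤ M * max 1 (lipConst ℓ) := by linarith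
  exact le_of_mul_le_mul_right h3 hM

end Duality

/-! ### Calibration of the surrogate risk -/

section Calibration
variable {X : Type u} {H : Set (X → ℝ)} {ℓ : ℝ → ℝ}

theorem classErr_eq_zero_or_one (f : X → ℝ) (z : X × Bool) :
    classErr f z = 0 ∨ classErr f z = 1 := by
  unfold classErr; split_ifs <;> simp

theorem classErr_mem_Icc (f : X → ℝ) (z : X × Bool) : classErr f z ∈ Icc (0 : ℝ) 1 := by
  rcases classErr_eq_zero_or_one f z with h | h <;> simp [h]

theorem abs_classErr_le (f : X → ℝ) (z : X × Bool) : |classErr f z| ≤ 1 := by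
  rcases classErr_eq_zero_or_one f z with h | h <;> simp [h]

theorem opH_of_mem_span (hb : IsBinary H) {f : X → ℝ} (hf : f ∈ Submodule.span ℝ H) :
    ∃ lam : Weights H, ∀ x, opH lam x = f x := by
  induction hf using Submodule.span_induction with
  | mem g hg => exact ⟨unitWeight ⟨g, hg⟩, fun x => opH_unitWeight _ x⟩
  | zero => exact ⟨0, fun x => opH_zero x⟩
  | add f g _ _ hf hg =>
    obtain ⟨a, ha⟩ := hf
    obtain ⟨b, hb'⟩ := hg
    exact ⟨a + b, fun x => by rw [opH_add hb, ha, hb']; rfl⟩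
  | smul c f _ hf =>
    obtain ⟨a, ha⟩ := hf
    exact ⟨c • a, fun x => by rw [opH_smul, ha]; rfl⟩

variable [MeasurableSpace X] {μ : Measure (X × Bool)}

/-- The regression function `d(x) = 𝔼[y | x]`, with labels `y = ±1`. -/
theorem exists_regression (μ : Measure (X × Bool)) [IsProbabilityMeasure μ] :
    ∃ d : X → ℝ, Measurable d ∧ (∀ x, |d x| ≤ 1) ∧
      ∀ F : X × Bool → ℝ, Measurable F → (∃ C, ∀ z, |F z| ≤ C) →
        ∫ z, F z ∂μ = ∫ x, ((1 + d x) / 2 * F (x, true) + (1 - d x) / 2 * F (x, false))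
          ∂(μ.map Prod.fst) := by
  set ν := μ.map Prod.fst with hν
  have : IsProbabilityMeasure ν := Measure.isProbabilityMeasure_map measurable_fst.aemeasurable
  set s : Set (X × Bool) := {z | z.2 = true} with hsdef
  have hs : MeasurableSet s := measurable_snd (measurableSet_singleton true)
  set μ₁ := (μ.restrict s).map Prod.fst with hμ₁
  set μ₂ := (μ.restrict sᶜ).map Prod.fst with hμ₂
  have hadd : ν = μ₁ + μ₂ := by
    rw [hν, hμ₁, hμ₂, ← Measure.map_add _ _ measurable_fst, Measure.restrict_add_restrict_compl hs]
  have hle : μ₁ ≤ ν := by rw [hadd]; exact Measure.le_add_right le_rfl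
  have hac : μ₁ ≪ ν := Measure.absolutelyContinuous_of_le hle
  set η : X → ℝ := fun x => (μ₁.rnDeriv ν x).toReal with hη
  have hηm : Measurable η := (Measure.measurable_rnDeriv _ _).ennreal_toReal
  have hη1 : ∀ᵐ x ∂ν, η x ≤ 1 := by
    filter_upwards [Measure.rnDeriv_le_one_of_le hle] with x hx
    have := ENNReal.toReal_mono ENNReal.one_ne_top hx
    simpa using this
  set d : X → ℝ := fun x => max (-1) (min 1 (2 * η x - 1)) with hd
  have hdη : ∀ᵐ x ∂ν, d x = 2 * η x - 1 := by
    filter_upwards [hη1] with x hx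
    have : 0 ≤ η x := ENNReal.toReal_nonneg
    simp only [hd]
    rw [min_eq_right (by linarith), max_eq_right (by linarith)]
  refine ⟨d, measurable_const.max (measurable_const.min ((hηm.const_mul 2).sub_const 1)),
    fun x => abs_le.2 ⟨le_max_left _ _, max_le (by norm_num) (min_le_left _ _)⟩, ?_⟩
  rintro F hF ⟨C, hC⟩
  have hT : Measurable fun x => F (x, true) := hF.comp (measurable_id.prodMk measurable_const)
  have hU : Measurable fun x => F (x, false) := hF.comp (measurable_id.prodMk measurable_const)
  have hFi : Integrable F μ := integrable_of_bdd hF hC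
  have e1 : ∫ z in s, F z ∂μ = ∫ x, F (x, true) ∂μ₁ := by
    rw [hμ₁, integral_map measurable_fst.aemeasurable hT.aestronglyMeasurable]
    refine setIntegral_congr_fun hs fun z hz => ?_
    have : z = (z.1, true) := Prod.ext rfl hz
    rw [this]
  have e2 : ∫ z in sᶜ, F z ∂μ = ∫ x, F (x, false) ∂μ₂ := by
    rw [hμ₂, integral_map measurable_fst.aemeasurable hU.aestronglyMeasurable]
    refine setIntegral_congr_fun hs.compl fun z hz => ?_
    have : z = (z.1, false) := Prod.ext rfl (by simpa [hsdef] using hz)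
    rw [this]
  have : IsFiniteMeasure μ₂ := by rw [hμ₂]; infer_instance
  have : IsFiniteMeasure μ₁ := by rw [hμ₁]; infer_instance
  have iT : Integrable (fun x => F (x, true)) ν := integrable_of_bdd hT fun x => hC _
  have iU : Integrable (fun x => F (x, false)) ν := integrable_of_bdd hU fun x => hC _
  have iU1 : Integrable (fun x => F (x, false)) μ₁ := integrable_of_bdd hU fun x => hC _
  have iU2 : Integrable (fun x => F (x, false)) μ₂ := integrable_of_bdd hU fun x => hC _
  have e3 : ∫ x, F (x, true) ∂μ₁ = ∫ x, η x * F (x, true) ∂ν := by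
    rw [← integral_rnDeriv_smul hac]; rfl
  have e4 : ∫ x, F (x, false) ∂μ₂ = ∫ x, F (x, false) ∂ν - ∫ x, η x * F (x, false) ∂ν := by
    have h5 : ∫ x, F (x, false) ∂μ₁ = ∫ x, η x * F (x, false) ∂ν := by
      rw [← integral_rnDeriv_smul hac]; rfl
    rw [← h5, hadd, integral_add_measure iU1 iU2]; ring
  have hηi : Integrable η ν := Measure.integrable_toReal_rnDeriv
  have i1 : Integrable (fun x => η x * F (x, true)) ν :=
    hηi.mul_bdd hT.aestronglyMeasurable (ae_of_all _ fun x => hC _)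
  have i2 : Integrable (fun x => η x * F (x, false)) ν :=
    hηi.mul_bdd hU.aestronglyMeasurable (ae_of_all _ fun x => hC _)
  have i3 : Integrable (fun x => F (x, false) - η x * F (x, false)) ν := iU.sub i2
  rw [← integral_add_compl hs hFi, e1, e2, e3, e4, ← integral_sub iU i2,
    ← integral_add i1 i3]
  refine integral_congr_ae ?_
  filter_upwards [hdη] with x hx
  rw [hx]
  ring

theorem measurable_classErr {f : X → ℝ} (hf : Measurable f) : Measurable (classErr f) := by
  unfold classErr
  refine Measurable.ite ?_ measurable_const measurable_const
  have h1 : MeasurableSet {z : X × Bool | z.2 = true} :=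
    measurable_snd (measurableSet_singleton true)
  have h2 : MeasurableSet {z : X × Bool | z.2 = false} :=
    measurable_snd (measurableSet_singleton false)
  exact (h1.inter (measurableSet_lt (hf.comp measurable_fst) measurable_const)).union
    (h2.inter (measurableSet_le measurable_const (hf.comp measurable_fst)))

theorem classRisk_nonneg (f : X → ℝ) : 0 ≤ classRisk μ f :=
  integral_nonneg fun z => (classErr_mem_Icc f z).1

theorem bayesRisk_le {f : X → ℝ} (hf : Measurable f) : bayesRisk μ ≤ classRisk μ f :=
  ciInf_le (f := fun f : {f : X → ℝ // Measurable f} => classRisk μ f.1)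
    ⟨0, by rintro _ ⟨g, rfl⟩; exact classRisk_nonneg _⟩ ⟨f, hf⟩

/-- For a dense class no bounded measurable predictor has surrogate risk below `𝓛̄`. -/
theorem DenseClass.optRisk_le_integral [IsProbabilityMeasure μ] (h : LossBds ℓ) (hb : IsBinary H)
    (hm : ∀ h ∈ H, Measurable h) (hd : DenseClass H (μ.map Prod.fst)) {g : X → ℝ}
    (hg : Measurable g) {C : ℝ} (hC : ∀ x, |g x| ≤ C) :
    optRisk ℓ μ H ≤ ∫ z, ℓ (-sgn z.2 * g z.1) ∂μ := by
  have hsg : ∀ f : X → ℝ, Measurable f → Measurable fun z : X × Bool => -sgn z.2 * f z.1 :=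
    fun f hf => ((measurable_sgn.comp measurable_snd).neg).mul (hf.comp measurable_fst)
  refine le_of_forall_pos_le_add fun ε hε => ?_
  obtain ⟨f, hf, hfε⟩ := hd g hg ⟨C, hC⟩ (ε / lipConst ℓ) (div_pos hε h.lipConst_pos)
  obtain ⟨lam, hlam⟩ := opH_of_mem_span hb hf
  have hfe : f = opH lam := funext fun x => (hlam x).symm
  have hfm : Measurable f := hfe ▸ measurable_opH hb hm lam
  have hfb : ∀ x, |f x| ≤ ‖lam‖ := fun x => by rw [hfe]; exact abs_opH_le hb lam x
  have hgb : ∀ z : X × Bool, |-sgn z.2 * g z.1| ≤ C := fun z => by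
    rw [abs_mul, abs_neg, abs_sgn, one_mul]; exact hC _
  have hdm : Measurable fun x => |f x - g x| := (hfm.sub hg).abs
  have i0 : Integrable (fun z : X × Bool => |f z.1 - g z.1|) μ := by
    refine integrable_of_bdd (C := ‖lam‖ + C) (hdm.comp measurable_fst) fun z => ?_
    rw [abs_abs]
    exact (abs_sub _ _).trans (add_le_add (hfb _) (hC _))
  have i1 := h.integrable_loss (ν := μ) (hsg g hg) hgb
  rw [integral_map measurable_fst.aemeasurable hdm.aestronglyMeasurable] at hfε
  refine (optRisk_le h lam).trans ?_
  have h1 : risk ℓ μ lam ≤ ∫ z, (ℓ (-sgn z.2 * g z.1) + lipConst ℓ * |f z.1 - g z.1|) ∂μ := by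
    refine integral_mono (h.integrable_loss (measurable_opA hb hm lam) (abs_opA_le hb lam))
      (i1.add (i0.const_mul _)) fun z => ?_
    have h2 := h.abs_sub_le (opA lam z) (-sgn z.2 * g z.1)
    rw [opA_eq, hlam, ← mul_sub, abs_mul, abs_neg, abs_sgn, one_mul] at h2
    have h3 := le_abs_self (ℓ (-sgn z.2 * f z.1) - ℓ (-sgn z.2 * g z.1))
    simp only [opA_eq, hlam]
    linarith
  rw [integral_add i1 (i0.const_mul _), integral_const_mul] at h1
  have h4 : lipConst ℓ * ∫ z : X × Bool, |f z.1 - g z.1| ∂μ ≤ ε := by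
    have := mul_le_mul_of_nonneg_left hfε.le h.lipConst_pos.le
    rwa [mul_div_cancel₀ _ h.lipConst_pos.ne'] at this
  linarith

/-- Where `f` errs (its sign disagrees with the regression function `d`), replacing `f` by the
minimizer of the quadratic upper bound at `0` gains `ψ(|d|)` in conditional risk. Integrating this
gain and applying Jensen's inequality to the convex function `ψ` gives the claim. -/
theorem calib_classRisk_sub_le [IsProbabilityMeasure μ] (h : LossBds ℓ) (hb : IsBinary H)
    (hm : ∀ h ∈ H, Measurable h) (hd : DenseClass H (μ.map Prod.fst)) (lam : Weights H) :
    calib ℓ (classRisk μ (opH lam) - bayesRisk μ) ≤ risk ℓ μ lam - optRisk ℓ μ H := by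
  obtain ⟨d, hdm, hd1, hdi⟩ := exists_regression μ
  set ν := μ.map Prod.fst with hν
  have : IsProbabilityMeasure ν := Measure.isProbabilityMeasure_map measurable_fst.aemeasurable
  set f := opH lam with hf
  have hfm : Measurable f := measurable_opH hb hm lam
  have hfb : ∀ x, |f x| ≤ ‖lam‖ := abs_opH_le hb lam
  have hB := h.gradLipConst_pos
  have hD := h.deriv_zero_pos
  set s : Set X := {x | (0 ≤ f x ∧ d x < 0) ∨ (f x < 0 ∧ 0 ≤ d x)} with hsdef
  have hs : MeasurableSet s :=
    ((measurableSet_le measurable_const hfm).inter (measurableSet_lt hdm measurable_const)).union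
      ((measurableSet_lt hfm measurable_const).inter (measurableSet_le measurable_const hdm))
  set e : X → ℝ := s.indicator fun x => |d x| with he
  have hem : Measurable e := hdm.abs.indicator hs
  have heb : ∀ x, |e x| ≤ 1 := fun x => by
    by_cases hx : x ∈ s <;> simp [he, hx, hd1]
  have hei : Integrable e ν := integrable_of_bdd hem heb
  have hei2 : Integrable (fun x => e x ^ 2) ν :=
    integrable_of_bdd (C := 1) (hem.pow_const 2) fun x => by
      rw [abs_pow]; exact pow_le_one₀ (abs_nonneg _) (heb x)
  -- the excess classification risk is at most `∫ e`
  have hR : classRisk μ f - bayesRisk μ ≤ ∫ x, e x ∂ν := by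
    rw [sub_le_comm]
    have : Nonempty {f : X → ℝ // Measurable f} := ⟨⟨f, hfm⟩⟩
    refine le_ciInf fun g => ?_
    have h1 := hdi _ (measurable_classErr hfm) ⟨1, abs_classErr_le f⟩
    have h2 := hdi _ (measurable_classErr g.2) ⟨1, abs_classErr_le g.1⟩
    have hint : ∀ k : X → ℝ, Measurable k → Integrable (fun x =>
        (1 + d x) / 2 * classErr k (x, true) + (1 - d x) / 2 * classErr k (x, false)) ν := by
      intro k hk
      have m1 : Measurable fun x => classErr k (x, true) :=
        (measurable_classErr hk).comp (measurable_id.prodMk measurable_const)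
      have m2 : Measurable fun x => classErr k (x, false) :=
        (measurable_classErr hk).comp (measurable_id.prodMk measurable_const)
      refine integrable_of_bdd (C := 2) ((((hdm.const_add 1).div_const 2).mul m1).add
        (((hdm.const_sub 1).div_const 2).mul m2)) fun x => ?_
      have := abs_le.1 (hd1 x)
      have c1 := classErr_mem_Icc k (x, true)
      have c2 := classErr_mem_Icc k (x, false)
      rw [abs_le]
      constructor <;> nlinarith [c1.1, c1.2, c2.1, c2.2]
    unfold classRisk
    rw [h1, h2, sub_le_iff_le_add, ← integral_add (hint g.1 g.2) hei]
    refine integral_mono (hint f hfm) ((hint g.1 g.2).add hei) fun x => ?_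
    have hdx := abs_le.1 (hd1 x)
    by_cases hx : x ∈ s
    · simp only [he, indicator_of_mem hx]
      rcases hx with ⟨a, b⟩ | ⟨a, b⟩
      · rw [abs_of_neg b]
        rcases lt_or_ge (g.1 x) 0 with c | c
        · simp [classErr, c, not_le.2 c, not_lt.2 a, a]; linarith
        · simp [classErr, c, not_lt.2 c, not_lt.2 a, a]; linarith
      · rw [abs_of_nonneg b]
        rcases lt_or_ge (g.1 x) 0 with c | c
        · simp [classErr, c, not_le.2 c, not_le.2 a, a]; linarith
        · simp [classErr, c, not_lt.2 c, not_le.2 a, a]; linarith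
    · simp only [he, indicator_of_notMem hx, add_zero]
      simp only [hsdef, mem_ofPred_eq, not_or, not_and, not_lt, not_le] at hx
      rcases lt_or_ge (f x) 0 with a | a
      · have b := hx.2 a
        rcases lt_or_ge (g.1 x) 0 with c | c
        · simp [classErr, c, not_le.2 c, not_le.2 a, a]
        · simp [classErr, c, not_lt.2 c, not_le.2 a, a]; linarith
      · have b := hx.1 a
        rcases lt_or_ge (g.1 x) 0 with c | c
        · simp [classErr, c, not_le.2 c, not_lt.2 a, a]; linarith
        · simp [classErr, c, not_lt.2 c, not_lt.2 a, a]
  -- the comparator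
  set k := deriv ℓ 0 / gradLipConst ℓ with hk
  have hkpos : 0 < k := div_pos hD hB
  classical
  set g : X → ℝ := s.piecewise (fun x => k * d x) f with hg
  have hgm : Measurable g := Measurable.piecewise hs (hdm.const_mul k) hfm
  have hgb : ∀ x, |g x| ≤ max k ‖lam‖ := fun x => by
    by_cases hx : x ∈ s
    · simp only [hg, piecewise_eq_of_mem _ _ _ hx]
      rw [abs_mul, abs_of_pos hkpos]
      exact (mul_le_of_le_one_right hkpos.le (hd1 x)).trans (le_max_left _ _)
    · simp only [hg, piecewise_eq_of_notMem _ _ _ hx]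
      exact (hfb x).trans (le_max_right _ _)
  have hsg : ∀ f : X → ℝ, Measurable f → Measurable fun z : X × Bool => ℓ (-sgn z.2 * f z.1) :=
    fun f hf => h.continuous.measurable.comp
      (((measurable_sgn.comp measurable_snd).neg).mul (hf.comp measurable_fst))
  have hbd : ∀ (f : X → ℝ) (C : ℝ), (∀ x, |f x| ≤ C) → ∀ z : X × Bool,
      |ℓ (-sgn z.2 * f z.1)| ≤ ℓ C := fun f C hC z => h.abs_comp_le (by
    rw [abs_mul, abs_neg, abs_sgn, one_mul]; exact hC _)
  have hint : ∀ (f : X → ℝ) (C : ℝ), Measurable f → (∀ x, |f x| ≤ C) → Integrable (fun x =>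
      (1 + d x) / 2 * ℓ (-sgn true * f x) + (1 - d x) / 2 * ℓ (-sgn false * f x)) ν := by
    intro f C hf hC
    have m1 : Measurable fun x => ℓ (-sgn true * f x) :=
      (hsg f hf).comp (measurable_id.prodMk measurable_const)
    have m2 : Measurable fun x => ℓ (-sgn false * f x) :=
      (hsg f hf).comp (measurable_id.prodMk measurable_const)
    refine integrable_of_bdd (C := ℓ C) ((((hdm.const_add 1).div_const 2).mul m1).add
      (((hdm.const_sub 1).div_const 2).mul m2)) fun x => ?_
    have h0 := abs_le.1 (hd1 x)
    have c1 := h.nonneg (-sgn true * f x)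
    have c2 := h.nonneg (-sgn false * f x)
    have c3 := le_of_abs_le (hbd f C hC (x, true))
    have c4 := le_of_abs_le (hbd f C hC (x, false))
    simp only at c3 c4
    have w1 : 0 ≤ (1 + d x) / 2 := by linarith
    have w2 : 0 ≤ (1 - d x) / 2 := by linarith
    rw [abs_of_nonneg (by positivity)]
    have := mul_le_mul_of_nonneg_left c3 w1
    have := mul_le_mul_of_nonneg_left c4 w2
    linarith
  have hopt : optRisk ℓ μ H ≤ ∫ x, ((1 + d x) / 2 * ℓ (-sgn true * g x)
      + (1 - d x) / 2 * ℓ (-sgn false * g x)) ∂ν :=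
    (hd.optRisk_le_integral h hb hm hgm hgb (ℓ := ℓ)).trans_eq
      (hdi _ (hsg g hgm) ⟨_, hbd g _ hgb⟩)
  have r1 : risk ℓ μ lam = ∫ x, ((1 + d x) / 2 * ℓ (-sgn true * f x)
      + (1 - d x) / 2 * ℓ (-sgn false * f x)) ∂ν := hdi _ (hsg f hfm) ⟨_, hbd f _ hfb⟩
  have hgain : (∫ x, e x ^ 2 ∂ν) * (deriv ℓ 0 ^ 2 / (2 * gradLipConst ℓ))
      ≤ risk ℓ μ lam - optRisk ℓ μ H := by
    rw [r1, ← integral_mul_const]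
    refine le_trans ?_ (sub_le_sub_left hopt _)
    rw [← integral_sub (hint f _ hfm hfb) (hint g _ hgm hgb)]
    refine integral_mono (hei2.mul_const _) ((hint f _ hfm hfb).sub (hint g _ hgm hgb))
      fun x => ?_
    by_cases hx : x ∈ s
    · simp only [he, hg, indicator_of_mem hx, piecewise_eq_of_mem _ _ _ hx, sq_abs, sgn,
        if_true, Bool.false_eq_true, if_false]
      have q1 := h.le_quadratic 0 (-1 * (k * d x))
      have q2 := h.le_quadratic 0 (- -1 * (k * d x))
      have t1 := h.tangent_le 0 (-1 * f x)
      have t2 := h.tangent_le 0 (- -1 * f x)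
      have h0 := abs_le.1 (hd1 x)
      have w1 : 0 ≤ (1 + d x) / 2 := by linarith
      have w2 : 0 ≤ (1 - d x) / 2 := by linarith
      have sg : d x * f x ≤ 0 := by
        rcases hx with ⟨a, b⟩ | ⟨a, b⟩
        · exact mul_nonpos_of_nonpos_of_nonneg b.le a
        · exact mul_nonpos_of_nonneg_of_nonpos b a.le
      have q3 := mul_le_mul_of_nonneg_left q1 w1
      have q4 := mul_le_mul_of_nonneg_left q2 w2
      have t3 := mul_le_mul_of_nonneg_left t1 w1
      have t4 := mul_le_mul_of_nonneg_left t2 w2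
      have e1 : deriv ℓ 0 * k = deriv ℓ 0 ^ 2 / gradLipConst ℓ := by rw [hk]; ring
      have e2 : gradLipConst ℓ / 2 * k ^ 2 = deriv ℓ 0 ^ 2 / (2 * gradLipConst ℓ) := by
        rw [hk]; field_simp
      have e3 : deriv ℓ 0 ^ 2 / gradLipConst ℓ = 2 * (deriv ℓ 0 ^ 2 / (2 * gradLipConst ℓ)) := by
        field_simp
      rw [e3] at e1
      set G := deriv ℓ 0 ^ 2 / (2 * gradLipConst ℓ)
      have u1 : (1 + d x) / 2 * ℓ (-1 * f x) + (1 - d x) / 2 * ℓ (- -1 * f x) ≥ ℓ 0 := by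
        have : 0 ≤ -(deriv ℓ 0 * (d x * f x)) := by
          have := mul_nonneg hD.le (neg_nonneg.2 sg); linarith
        linarith
      have u2 : (1 + d x) / 2 * ℓ (-1 * (k * d x)) + (1 - d x) / 2 * ℓ (- -1 * (k * d x))
          ≤ ℓ 0 - d x ^ 2 * (deriv ℓ 0 * k) + gradLipConst ℓ / 2 * k ^ 2 * d x ^ 2 := by
        linarith
      rw [e1, e2] at u2
      linarith
    · simp [he, hg, indicator_of_notMem hx, piecewise_eq_of_notMem _ _ _ hx]
  have hjen : (∫ x, e x ∂ν) ^ 2 ≤ ∫ x, e x ^ 2 ∂ν := by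
    set M := ∫ x, e x ∂ν
    have h1 : 0 ≤ ∫ x, (e x - M) ^ 2 ∂ν := integral_nonneg fun x => sq_nonneg _
    have h2 : ∫ x, (e x - M) ^ 2 ∂ν = ∫ x, (e x ^ 2 - 2 * M * e x + M ^ 2) ∂ν := by
      congr 1; ext x; ring
    have i1 : Integrable (fun x => e x ^ 2 - 2 * M * e x) ν := hei2.sub (hei.const_mul _)
    rw [h2, integral_add i1 (integrable_const _),
      integral_sub hei2 (hei.const_mul _), integral_const_mul] at h1
    simp only [integral_const, probReal_univ, one_smul] at h1
    change 0 ≤ _ - 2 * M * M + M ^ 2 at h1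
    linarith
  have hR0 : 0 ≤ classRisk μ f - bayesRisk μ := sub_nonneg.2 (bayesRisk_le hfm)
  refine le_trans ?_ hgain
  have h5 : (classRisk μ f - bayesRisk μ) ^ 2 ≤ ∫ x, e x ^ 2 ∂ν :=
    (pow_le_pow_left₀ hR0 hR 2).trans hjen
  have h6 := mul_le_mul_of_nonneg_right h5
    (show 0 ≤ deriv ℓ 0 ^ 2 / (2 * gradLipConst ℓ) by positivity)
  unfold calib
  refine le_trans (le_of_eq ?_) h6
  ring

end Calibration

/-! ### The bounded difference inequality -/

section McDiarmid
variable {Z : Type*} [MeasurableSpace Z] {μ : Measure Z} [IsProbabilityMeasure μ]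

theorem piFinSuccAbove_symm_eq_cons {m : ℕ} (x : Z × (Fin m → Z)) :
    (MeasurableEquiv.piFinSuccAbove (fun _ : Fin (m + 1) => Z) 0).symm x
      = Fin.cons x.1 x.2 := by
  simp [MeasurableEquiv.piFinSuccAbove]
  rfl

theorem measurable_cons_uncurry {m : ℕ} {G : (Fin (m + 1) → Z) → ℝ} (hG : Measurable G) :
    Measurable fun x : Z × (Fin m → Z) => G (Fin.cons x.1 x.2) := by
  have := hG.comp (MeasurableEquiv.piFinSuccAbove (fun _ : Fin (m + 1) => Z) 0).symm.measurable
  have e : G ∘ (MeasurableEquiv.piFinSuccAbove (fun _ : Fin (m + 1) => Z) 0).symm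
      = fun x : Z × (Fin m → Z) => G (Fin.cons x.1 x.2) :=
    funext fun x => congrArg G (piFinSuccAbove_symm_eq_cons x)
  rwa [e] at this

theorem integral_pi_succ {m : ℕ} {G : (Fin (m + 1) → Z) → ℝ} (hG : Measurable G) {C : ℝ}
    (hC : ∀ S, |G S| ≤ C) :
    ∫ S, G S ∂(Measure.pi fun _ : Fin (m + 1) => μ)
      = ∫ z, ∫ w, G (Fin.cons z w) ∂(Measure.pi fun _ : Fin m => μ) ∂μ := by
  have hmp := (measurePreserving_piFinSuccAbove (fun _ : Fin (m + 1) => μ) 0).symm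
  rw [← hmp.integral_comp' (g := G)]
  simp_rw [piFinSuccAbove_symm_eq_cons]
  rw [integral_prod]
  exact integrable_of_bdd (C := C) (measurable_cons_uncurry hG) fun x => hC _

/-- Hoeffding's lemma for a bounded variable whose oscillation is at most `c`. -/
theorem integral_exp_mul_le_of_osc {g : Z → ℝ} (hg : Measurable g) {c : ℝ}
    (hc : ∀ z z', g z - g z' ≤ c) (s : ℝ) :
    ∫ z, Real.exp (s * g z) ∂μ ≤ Real.exp (s * ∫ z, g z ∂μ + s ^ 2 * c ^ 2 / 8) := by
  have hne : Nonempty Z := by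
    by_contra h
    rw [not_nonempty_iff] at h
    have := measure_univ (μ := μ)
    rw [univ_eq_empty_iff.2 h, measure_empty] at this
    exact zero_ne_one this
  obtain ⟨z₀⟩ := hne
  have hbd : BddBelow (range g) := ⟨g z₀ - c, by rintro _ ⟨z, rfl⟩; linarith [hc z₀ z]⟩
  set a := ⨅ z, g z
  have ha : ∀ z, a ≤ g z := fun z => ciInf_le hbd z
  have hb : ∀ z, g z ≤ a + c := fun z => by
    have : Nonempty Z := ⟨z₀⟩
    have : g z - c ≤ a := le_ciInf fun z' => by linarith [hc z z']
    linarith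
  have hc0 : 0 ≤ c := by simpa using hc z₀ z₀
  have h := (ProbabilityTheory.hasSubgaussianMGF_of_mem_Icc (μ := μ) (a := a) (b := a + c)
    hg.aemeasurable (ae_of_all _ fun z => ⟨ha z, hb z⟩)).mgf_le s
  unfold ProbabilityTheory.mgf at h
  have e : ∀ z, Real.exp (s * (g z - ∫ z, g z ∂μ))
      = Real.exp (s * g z) * Real.exp (-(s * ∫ z, g z ∂μ)) := fun z => by
    rw [← Real.exp_add]; ring_nf
  simp_rw [e] at h
  rw [integral_mul_const, Real.exp_neg, ← div_eq_mul_inv, div_le_iff₀ (Real.exp_pos _),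
    ← Real.exp_add] at h
  refine h.trans_eq ?_
  congr 1
  simp only [add_sub_cancel_left, NNReal.coe_pow, NNReal.coe_div, coe_nnnorm, Real.norm_eq_abs,
    NNReal.coe_ofNat, abs_of_nonneg hc0]
  ring

theorem integral_exp_mul_le_of_bounded_diff (m : ℕ) (F : (Fin m → Z) → ℝ) (hF : Measurable F)
    {C c : ℝ} (hC : ∀ S, |F S| ≤ C) (hc : ∀ S i z, |F (Function.update S i z) - F S| ≤ c)
    (s : ℝ) :
    ∫ S, Real.exp (s * F S) ∂(Measure.pi fun _ : Fin m => μ)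
      ≤ Real.exp (s * ∫ S, F S ∂(Measure.pi fun _ : Fin m => μ) + s ^ 2 * (m * c ^ 2) / 8) := by
  induction m with
  | zero =>
    have e : ∀ S, F S = F (fun i => i.elim0) := fun S => congrArg F (Subsingleton.elim _ _)
    simp_rw [e]
    simp
  | succ m ih =>
    have hexpb : ∀ S, |Real.exp (s * F S)| ≤ Real.exp (|s| * C) := fun S => by
      rw [abs_of_pos (Real.exp_pos _), Real.exp_le_exp]
      refine (le_abs_self _).trans ?_
      rw [abs_mul]
      exact mul_le_mul_of_nonneg_left (hC S) (abs_nonneg _)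
    have hexpm : Measurable fun S => Real.exp (s * F S) := (hF.const_mul s).exp
    rw [integral_pi_succ hexpm hexpb, integral_pi_succ hF hC]
    have hFz : ∀ z, Measurable fun w : Fin m → Z => F (Fin.cons z w) := fun z =>
      (measurable_cons_uncurry hF).comp (measurable_const.prodMk measurable_id)
    have hFi : ∀ z, Integrable (fun w : Fin m → Z => F (Fin.cons z w))
        (Measure.pi fun _ : Fin m => μ) := fun z => integrable_of_bdd (hFz z) fun w => hC _
    set g : Z → ℝ := fun z => ∫ w, F (Fin.cons z w) ∂(Measure.pi fun _ : Fin m => μ) with hg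
    have hgm : Measurable g :=
      (measurable_cons_uncurry hF).stronglyMeasurable.integral_prod_right.measurable
    have hgC : ∀ z, |g z| ≤ C := fun z => by
      have := norm_integral_le_of_norm_le_const (μ := Measure.pi fun _ : Fin m => μ)
        (f := fun w => F (Fin.cons z w)) (ae_of_all _ fun w => hC (Fin.cons z w))
      simpa using this
    have hosc : ∀ z z', g z - g z' ≤ c := fun z z' => by
      rw [hg, ← integral_sub (hFi z) (hFi z')]
      refine (integral_mono ((hFi z).sub (hFi z')) (integrable_const c) fun w => ?_).trans_eq
        (by simp)
      have := hc (Fin.cons z' w) 0 z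
      rw [Fin.update_cons_zero] at this
      exact (le_abs_self _).trans this
    have step : ∀ z, ∫ w, Real.exp (s * F (Fin.cons z w)) ∂(Measure.pi fun _ : Fin m => μ)
        ≤ Real.exp (s * g z) * Real.exp (s ^ 2 * (m * c ^ 2) / 8) := fun z => by
      rw [← Real.exp_add]
      refine ih (fun w => F (Fin.cons z w)) (hFz z) (fun w => hC _) fun S i z' => ?_
      rw [Fin.cons_update]
      exact hc _ _ _
    have h1 : ∫ z, ∫ w, Real.exp (s * F (Fin.cons z w)) ∂(Measure.pi fun _ : Fin m => μ) ∂μ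
        ≤ ∫ z, Real.exp (s * g z) * Real.exp (s ^ 2 * (m * c ^ 2) / 8) ∂μ := by
      refine integral_mono ?_ ?_ step
      · refine integrable_of_bdd (C := Real.exp (|s| * C))
          (measurable_cons_uncurry hexpm).stronglyMeasurable.integral_prod_right.measurable
          fun z => ?_
        have := norm_integral_le_of_norm_le_const (μ := Measure.pi fun _ : Fin m => μ)
          (f := fun w => Real.exp (s * F (Fin.cons z w)))
          (ae_of_all _ fun w => hexpb (Fin.cons z w))
        simpa using this
      · refine Integrable.mul_const (integrable_of_bdd (C := Real.exp (|s| * C))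
          (hgm.const_mul s).exp fun z => ?_) _
        rw [abs_of_pos (Real.exp_pos _), Real.exp_le_exp]
        refine (le_abs_self _).trans ?_
        rw [abs_mul]
        exact mul_le_mul_of_nonneg_left (hgC z) (abs_nonneg _)
    refine h1.trans ?_
    rw [integral_mul_const]
    refine (mul_le_mul_of_nonneg_right (integral_exp_mul_le_of_osc (μ := μ) hgm hosc s)
      (Real.exp_pos _).le).trans_eq ?_
    rw [← Real.exp_add]
    congr 1
    push_cast
    ring

/-- McDiarmid's inequality. -/
theorem measure_ge_le_of_bounded_diff (m : ℕ) (F : (Fin m → Z) → ℝ) (hF : Measurable F)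
    {C c u : ℝ} (hC : ∀ S, |F S| ≤ C) (hc : ∀ S i z, |F (Function.update S i z) - F S| ≤ c)
    (hc0 : 0 < c) (hm : 0 < m) (hu : 0 ≤ u) :
    (Measure.pi fun _ : Fin m => μ)
        {S | ∫ S, F S ∂(Measure.pi fun _ : Fin m => μ) + u ≤ F S}
      ≤ ENNReal.ofReal (Real.exp (-(2 * u ^ 2 / (m * c ^ 2)))) := by
  set π := Measure.pi fun _ : Fin m => μ
  set M := ∫ S, F S ∂π
  have hm' : (0 : ℝ) < m := Nat.cast_pos.2 hm
  set s := 4 * u / (m * c ^ 2) with hs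
  have hs0 : 0 ≤ s := by positivity
  have h1 := integral_exp_mul_le_of_bounded_diff (μ := μ) m F hF hC hc s
  have hi : Integrable (fun S => Real.exp (s * F S)) π := by
    refine integrable_of_bdd (C := Real.exp (|s| * C)) (hF.const_mul s).exp fun S => ?_
    rw [abs_of_pos (Real.exp_pos _), Real.exp_le_exp]
    refine (le_abs_self _).trans ?_
    rw [abs_mul]
    exact mul_le_mul_of_nonneg_left (hC S) (abs_nonneg _)
  have h2 := ProbabilityTheory.measure_ge_le_exp_mul_mgf (μ := π) (X := F) (M + u) hs0 hi
  rw [← ofReal_measureReal]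
  refine ENNReal.ofReal_le_ofReal (h2.trans ?_)
  unfold ProbabilityTheory.mgf
  refine (mul_le_mul_of_nonneg_left h1 (Real.exp_pos _).le).trans_eq ?_
  rw [← Real.exp_add]
  congr 1
  rw [hs]
  field_simp
  ring

end McDiarmid

/-! ### Symmetrization -/

section Symmetrization
variable {Z : Type*} [MeasurableSpace Z] {μ : Measure Z} [IsProbabilityMeasure μ]

/-- Exchange the coordinates of two samples selected by `σ`. -/
def swapPair {Z : Type*} {m : ℕ} (σ : Fin m → Bool) (x : (Fin m → Z) × (Fin m → Z)) :
    (Fin m → Z) × (Fin m → Z) :=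
  (fun i => if σ i then x.1 i else x.2 i, fun i => if σ i then x.2 i else x.1 i)

theorem measurePreserving_swapPair {m : ℕ} (σ : Fin m → Bool) :
    MeasurePreserving (swapPair (Z := Z) σ)
      ((Measure.pi fun _ : Fin m => μ).prod (Measure.pi fun _ : Fin m => μ))
      ((Measure.pi fun _ : Fin m => μ).prod (Measure.pi fun _ : Fin m => μ)) := by
  have h1 := measurePreserving_arrowProdEquivProdArrow Z Z (Fin m) (fun _ => μ) (fun _ => μ)
  have h2 : MeasurePreserving (fun (a : Fin m → Z × Z) i => if σ i then a i else (a i).swap)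
      (Measure.pi fun _ => μ.prod μ) (Measure.pi fun _ => μ.prod μ) := by
    refine measurePreserving_pi (f := fun i (b : Z × Z) => if σ i then b else b.swap) _ _
      fun i => ?_
    cases σ i
    · simpa using Measure.measurePreserving_swap (μ := μ) (ν := μ)
    · exact MeasurePreserving.id (μ.prod μ)
  have h3 := (h1.comp h2).comp h1.symm
  convert h3 using 1
  funext x
  refine Prod.ext (funext fun i => ?_) (funext fun i => ?_) <;>
  · simp only [swapPair, MeasurableEquiv.arrowProdEquivProdArrow, Equiv.arrowProdEquivProdArrow,
      Function.comp_apply]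
    cases h : σ i <;> simp [h]

/-- The integral of a function of two samples is the average over all exchanges of coordinates. -/
theorem integral_prod_eq_avg_swap {m : ℕ} {G : (Fin m → Z) × (Fin m → Z) → ℝ} (hG : Measurable G)
    {C : ℝ} (hC : ∀ x, |G x| ≤ C) :
    ∫ x, G x ∂((Measure.pi fun _ : Fin m => μ).prod (Measure.pi fun _ : Fin m => μ))
      = ∫ x, (1 / 2 ^ m : ℝ) * ∑ σ : Fin m → Bool, G (swapPair σ x)
        ∂((Measure.pi fun _ : Fin m => μ).prod (Measure.pi fun _ : Fin m => μ)) := by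
  have hmp := fun σ : Fin m → Bool => measurePreserving_swapPair (μ := μ) σ
  have hi : ∀ σ : Fin m → Bool, Integrable (fun x => G (swapPair σ x))
      ((Measure.pi fun _ : Fin m => μ).prod (Measure.pi fun _ => μ)) := fun σ =>
    integrable_of_bdd (hG.comp (hmp σ).measurable) fun x => hC _
  rw [integral_const_mul, integral_finsetSum _ fun σ _ => hi σ]
  have h : ∀ σ : Fin m → Bool,
      ∫ x, G (swapPair σ x) ∂((Measure.pi fun _ : Fin m => μ).prod (Measure.pi fun _ => μ))
        = ∫ x, G x ∂((Measure.pi fun _ : Fin m => μ).prod (Measure.pi fun _ => μ)) := fun σ => by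
    rw [← integral_map (hmp σ).measurable.aemeasurable hG.aestronglyMeasurable, (hmp σ).map_eq]
  simp_rw [h]
  simp

end Symmetrization

/-! ### Rademacher averages: contraction and finite classes -/

section Rademacher
theorem le_ciSup_finite {ι : Type*} [Finite ι] (f : ι → ℝ) (j : ι) : f j ≤ ⨆ j, f j :=
  le_ciSup (Set.finite_range f).bddAbove j

variable {ι : Type*} [Finite ι] [Nonempty ι]

/-- The Rademacher average `𝔼_σ sup_j ∑ᵢ σᵢ aⱼᵢ` of a family of vectors. -/
noncomputable def radAvg {ι : Type*} {n : ℕ} (a : ι → Fin n → ℝ) : ℝ :=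
  (1 / 2 ^ n : ℝ) * ∑ σ : Fin n → Bool, ⨆ j, ∑ i, sgn (σ i) * a j i

theorem sum_fin_succ_bool {n : ℕ} (g : (Fin (n + 1) → Bool) → ℝ) :
    ∑ σ, g σ = ∑ σ : Fin n → Bool, (g (Fin.cons true σ) + g (Fin.cons false σ)) := by
  rw [← (Fin.consEquiv fun _ : Fin (n + 1) => Bool).sum_comp g, Fintype.sum_prod_type,
    Fintype.sum_bool, ← Finset.sum_add_distrib]
  rfl

/-- The Ledoux-Talagrand contraction principle, with offsets `b` that make it amenable to
induction on the number of coordinates. -/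
theorem sum_ciSup_contraction (n : ℕ) (b : ι → ℝ) (a φ : ι → Fin n → ℝ)
    (h : ∀ j k i, |φ j i - φ k i| ≤ |a j i - a k i|) :
    ∑ σ : Fin n → Bool, ⨆ j, (b j + ∑ i, sgn (σ i) * φ j i)
      ≤ ∑ σ : Fin n → Bool, ⨆ j, (b j + ∑ i, sgn (σ i) * a j i) := by
  induction n generalizing b with
  | zero => simp
  | succ n ih =>
    have e : ∀ (v : ι → Fin (n + 1) → ℝ) (s : Bool) (σ : Fin n → Bool),
        (⨆ j, (b j + ∑ i, sgn ((Fin.cons s σ : Fin (n + 1) → Bool) i) * v j i))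
          = ⨆ j, ((b j + sgn s * v j 0) + ∑ i, sgn (σ i) * v j i.succ) := fun v s σ => by
      congr 1; funext j
      rw [Fin.sum_univ_succ]
      simp [add_assoc]
    rw [sum_fin_succ_bool, sum_fin_succ_bool, Finset.sum_add_distrib]
    simp_rw [e]
    have h1 := ih (fun j => b j + sgn true * φ j 0) (fun j i => a j i.succ)
      (fun j i => φ j i.succ) (fun j k i => h j k i.succ)
    have h2 := ih (fun j => b j + sgn false * φ j 0) (fun j i => a j i.succ)
      (fun j i => φ j i.succ) (fun j k i => h j k i.succ)
    refine (add_le_add h1 h2).trans ?_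
    rw [← Finset.sum_add_distrib]
    refine Finset.sum_le_sum fun σ _ => ?_
    set w : ι → ℝ := fun j => b j + ∑ i, sgn (σ i) * a j i.succ with hw
    have e2 : ∀ (v : ι → ℝ) (s : Bool),
        (⨆ j, (b j + sgn s * v j + ∑ i, sgn (σ i) * a j i.succ)) = ⨆ j, (w j + sgn s * v j) :=
      fun v s => by congr 1; funext j; simp only [hw]; ring
    rw [e2 (fun j => φ j 0), e2 (fun j => φ j 0), e2 (fun j => a j 0), e2 (fun j => a j 0)]
    obtain ⟨j, hj⟩ := exists_eq_ciSup_of_finite (f := fun j => w j + sgn true * φ j 0)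
    obtain ⟨k, hk⟩ := exists_eq_ciSup_of_finite (f := fun j => w j + sgn false * φ j 0)
    rw [← hj, ← hk]
    have g1 := le_ciSup_finite (fun j => w j + sgn true * a j 0)
    have g2 := le_ciSup_finite (fun j => w j + sgn false * a j 0)
    simp only [sgn, if_true, Bool.false_eq_true, if_false] at g1 g2 ⊢
    have h3 := (le_abs_self _).trans (h j k 0)
    rcases abs_cases (a j 0 - a k 0) with ⟨e3, _⟩ | ⟨e3, _⟩
    · linarith [g1 j, g2 k]
    · linarith [g1 k, g2 j]

theorem radAvg_contraction {n : ℕ} (a φ : ι → Fin n → ℝ) {L : ℝ} (hL : 0 ≤ L)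
    (h : ∀ j k i, |φ j i - φ k i| ≤ L * |a j i - a k i|) : radAvg φ ≤ L * radAvg a := by
  have h1 := sum_ciSup_contraction n (fun _ : ι => 0) (fun j i => L * a j i) φ fun j k i => by
    rw [← mul_sub, abs_mul, abs_of_nonneg hL]; exact h j k i
  have e : ∀ σ : Fin n → Bool, (⨆ j, (0 + ∑ i, sgn (σ i) * (L * a j i)))
      = L * ⨆ j, ∑ i, sgn (σ i) * a j i := fun σ => by
    rw [Real.mul_iSup_of_nonneg hL]
    congr 1; funext j
    rw [zero_add, Finset.mul_sum]
    exact Finset.sum_congr rfl fun i _ => by ring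
  simp_rw [e, zero_add] at h1
  unfold radAvg
  rw [← Finset.mul_sum] at h1
  have h2 : (0 : ℝ) ≤ 1 / 2 ^ n := by positivity
  nlinarith [mul_le_mul_of_nonneg_left h1 h2]

theorem le_two_mul_sqrt_of_forall {x A D : ℝ} (hA : 0 ≤ A) (hD : 0 ≤ D)
    (h : ∀ s : ℝ, 0 < s → x ≤ A / s + s * D) : x ≤ 2 * √(A * D) := by
  have key : ∀ ε : ℝ, 0 < ε → x ≤ 2 * √((A + ε) * (D + ε)) := fun ε hε => by
    have h1 := h (√(A + ε) / √(D + ε)) (by positivity)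
    have ha : 0 < √(A + ε) := by positivity
    have hd : 0 < √(D + ε) := by positivity
    have e1 : √(A + ε) * √(A + ε) = A + ε := Real.mul_self_sqrt (by positivity)
    have e2 : √(D + ε) * √(D + ε) = D + ε := Real.mul_self_sqrt (by positivity)
    rw [Real.sqrt_mul (by positivity)]
    have h2 : A / (√(A + ε) / √(D + ε)) ≤ √(A + ε) * √(D + ε) := by
      rw [div_div_eq_mul_div, div_le_iff₀ ha]
      nlinarith
    have h3 : √(A + ε) / √(D + ε) * D ≤ √(A + ε) * √(D + ε) := by
      rw [div_mul_eq_mul_div, div_le_iff₀ hd]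
      nlinarith
    linarith
  have hc : Continuous fun ε : ℝ => 2 * √((A + ε) * (D + ε)) := by fun_prop
  have h1 : Tendsto (fun ε : ℝ => 2 * √((A + ε) * (D + ε))) (𝓝[>] 0) (𝓝 (2 * √(A * D))) := by
    have := (hc.tendsto 0).mono_left (nhdsWithin_le_nhds (s := Ioi 0))
    simpa using this
  exact ge_of_tendsto h1 (by filter_upwards [self_mem_nhdsWithin] with ε hε using key ε hε)

theorem sum_exp_rademacher_le {n : ℕ} (v : Fin n → ℝ) {B : ℝ} (hv : ∀ i, |v i| ≤ B) (s : ℝ) :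
    ∑ σ : Fin n → Bool, Real.exp (s * ∑ i, sgn (σ i) * v i)
      ≤ 2 ^ n * Real.exp (s ^ 2 * (n * B ^ 2) / 2) := by
  have e1 : ∀ σ : Fin n → Bool, Real.exp (s * ∑ i, sgn (σ i) * v i)
      = ∏ i, Real.exp (s * (sgn (σ i) * v i)) := fun σ => by
    rw [Finset.mul_sum, Real.exp_sum]
  simp_rw [e1]
  have e2 := Finset.prod_univ_sum (fun _ : Fin n => (Finset.univ : Finset Bool))
    (fun i b => Real.exp (s * (sgn b * v i)))
  rw [Fintype.piFinset_univ] at e2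
  rw [← e2]
  calc ∏ i, ∑ b, Real.exp (s * (sgn b * v i)) ≤ ∏ _i : Fin n, 2 * Real.exp (s ^ 2 * B ^ 2 / 2) := by
        refine Finset.prod_le_prod (fun i _ => Finset.sum_nonneg fun b _ => (Real.exp_pos _).le)
          fun i _ => ?_
        rw [Fintype.sum_bool]
        have h1 := Real.cosh_le_exp_half_sq (s * v i)
        rw [Real.cosh_eq] at h1
        have h2 : Real.exp ((s * v i) ^ 2 / 2) ≤ Real.exp (s ^ 2 * B ^ 2 / 2) := by
          rw [Real.exp_le_exp, mul_pow]
          have : v i ^ 2 ≤ B ^ 2 := sq_le_sq' (neg_le_of_abs_le (hv i)) (le_of_abs_le (hv i))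
          nlinarith [sq_nonneg s]
        simp only [sgn, if_true, Bool.false_eq_true, if_false, one_mul, neg_mul, mul_neg]
        linarith
    _ = 2 ^ n * Real.exp (s ^ 2 * (n * B ^ 2) / 2) := by
        rw [Finset.prod_const, mul_pow, ← Real.exp_nat_mul, Finset.card_univ, Fintype.card_fin]
        congr 2
        ring

/-- Massart's finite class lemma, counting distinct vectors. -/
theorem radAvg_le_of_ncard {n : ℕ} (a : ι → Fin n → ℝ) {B : ℝ} (ha : ∀ j i, |a j i| ≤ B)
    (hB : 0 ≤ B) {N : ℝ} (hN : ((Set.range a).ncard : ℝ) ≤ N) :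
    radAvg a ≤ B * √(2 * n * Real.log N) := by
  have hfin : (Set.range a).Finite := Set.finite_range a
  have hN1 : 1 ≤ N := by
    refine le_trans ?_ hN
    exact_mod_cast (Set.ncard_pos hfin).2 (Set.range_nonempty a)
  have key : ∀ s : ℝ, 0 < s → radAvg a ≤ Real.log N / s + s * (n * B ^ 2 / 2) := by
    intro s hs
    set M := radAvg a
    have h2n : (0 : ℝ) < 2 ^ n := by positivity
    have h1 : ∀ σ : Fin n → Bool, Real.exp (s * M)
        * (1 + (s * (⨆ j, ∑ i, sgn (σ i) * a j i) - s * M))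
        ≤ ∑ v ∈ hfin.toFinset, Real.exp (s * ∑ i, sgn (σ i) * v i) := fun σ => by
      obtain ⟨j, hj⟩ := exists_eq_ciSup_of_finite (f := fun j => ∑ i, sgn (σ i) * a j i)
      rw [← hj]
      have h2 := Real.add_one_le_exp (s * (∑ i, sgn (σ i) * a j i) - s * M)
      have h3 : Real.exp (s * ∑ i, sgn (σ i) * a j i)
          ≤ ∑ v ∈ hfin.toFinset, Real.exp (s * ∑ i, sgn (σ i) * v i) :=
        Finset.single_le_sum (f := fun v : Fin n → ℝ => Real.exp (s * ∑ i, sgn (σ i) * v i))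
          (fun _ _ => (Real.exp_pos _).le) (hfin.mem_toFinset.2 ⟨j, rfl⟩)
      refine le_trans ?_ h3
      calc _ ≤ Real.exp (s * M) * Real.exp (s * (∑ i, sgn (σ i) * a j i) - s * M) :=
            mul_le_mul_of_nonneg_left (by linarith) (Real.exp_pos _).le
        _ = _ := by rw [← Real.exp_add]; congr 1; ring
    have h2 := Finset.sum_le_sum fun σ (_ : σ ∈ (Finset.univ : Finset (Fin n → Bool))) => h1 σ
    have hM : ∑ σ : Fin n → Bool, (⨆ j, ∑ i, sgn (σ i) * a j i) = 2 ^ n * M := by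
      simp only [M, radAvg]; field_simp
    have e1 : ∑ σ : Fin n → Bool, Real.exp (s * M)
        * (1 + (s * (⨆ j, ∑ i, sgn (σ i) * a j i) - s * M)) = 2 ^ n * Real.exp (s * M) := by
      rw [← Finset.mul_sum, Finset.sum_add_distrib, Finset.sum_sub_distrib, ← Finset.mul_sum, hM]
      simp
      ring
    rw [e1, Finset.sum_comm] at h2
    have h3 : ∑ v ∈ hfin.toFinset, ∑ σ : Fin n → Bool, Real.exp (s * ∑ i, sgn (σ i) * v i)
        ≤ ∑ _v ∈ hfin.toFinset, 2 ^ n * Real.exp (s ^ 2 * (n * B ^ 2) / 2) :=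
      Finset.sum_le_sum fun v hv => sum_exp_rademacher_le v (fun i => by
        obtain ⟨j, rfl⟩ := hfin.mem_toFinset.1 hv
        exact ha j i) s
    rw [Finset.sum_const, nsmul_eq_mul, ← Set.ncard_eq_toFinset_card _ hfin] at h3
    have h4 : Real.exp (s * M) ≤ N * Real.exp (s ^ 2 * (n * B ^ 2) / 2) := by
      have h5 := h2.trans h3
      have h6 := mul_le_mul_of_nonneg_right hN
        (show 0 ≤ 2 ^ n * Real.exp (s ^ 2 * (n * B ^ 2) / 2) by positivity)
      have h7 : 2 ^ n * Real.exp (s * M) ≤ 2 ^ n * (N * Real.exp (s ^ 2 * (n * B ^ 2) / 2)) := by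
        linarith
      exact le_of_mul_le_mul_left h7 h2n
    have h5 : s * M ≤ Real.log N + s ^ 2 * (n * B ^ 2) / 2 := by
      have h6 := Real.log_le_log (Real.exp_pos _) h4
      rwa [Real.log_exp, Real.log_mul (by linarith) (Real.exp_pos _).ne', Real.log_exp] at h6
    have h6 : M ≤ (Real.log N + s ^ 2 * (n * B ^ 2) / 2) / s := by
      rw [le_div_iff₀ hs]; linarith
    refine h6.trans_eq ?_
    field_simp
  have h1 := le_two_mul_sqrt_of_forall (Real.log_nonneg hN1) (by positivity) key
  refine h1.trans_eq ?_
  have e : B * √(2 * n * Real.log N) = √(B ^ 2 * (2 * n * Real.log N)) := by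
    rw [Real.sqrt_mul (sq_nonneg B), Real.sqrt_sq hB]
  have e2 : (2 : ℝ) * √(Real.log N * (n * B ^ 2 / 2))
      = √(2 ^ 2 * (Real.log N * (n * B ^ 2 / 2))) := by
    rw [Real.sqrt_mul (by norm_num) (Real.log N * (n * B ^ 2 / 2)), Real.sqrt_sq (by norm_num)]
  rw [e, e2]
  congr 1
  ring

theorem radAvg_neg {ι : Type*} {n : ℕ} (a : ι → Fin n → ℝ) :
    radAvg (fun j i => -a j i) = radAvg a := by
  unfold radAvg
  congr 1
  have hinv : Function.Involutive fun σ : Fin n → Bool => fun i => !σ i := fun σ => by simp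
  rw [← Equiv.sum_comp (hinv.toPerm _)]
  refine Finset.sum_congr rfl fun σ _ => ?_
  congr 1; funext j
  refine Finset.sum_congr rfl fun i _ => ?_
  change sgn (!σ i) * -a j i = _
  cases σ i <;> simp [sgn]

end Rademacher

/-! ### Uniform deviations -/

section Deviation
variable {Z : Type*} [MeasurableSpace Z] {μ : Measure Z} [IsProbabilityMeasure μ]

/-- The mean of `f` over the sample `S`. -/
noncomputable def empMean {Z : Type*} {m : ℕ} (f : Z → ℝ) (S : Fin m → Z) : ℝ :=
  (1 / (m : ℝ)) * ∑ i, f (S i)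

theorem measurable_empMean {m : ℕ} {f : Z → ℝ} (hf : Measurable f) :
    Measurable (empMean (m := m) f) :=
  (Finset.measurable_sum _ fun i _ => hf.comp (measurable_pi_apply i)).const_mul _

theorem abs_empMean_le {Z : Type*} {m : ℕ} {f : Z → ℝ} {C : ℝ} (hC0 : 0 ≤ C) (hC : ∀ z, |f z| ≤ C)
    (S : Fin m → Z) : |empMean f S| ≤ C := by
  rcases Nat.eq_zero_or_pos m with rfl | hm
  · simpa [empMean] using hC0
  have hm' : (0 : ℝ) < m := Nat.cast_pos.2 hm
  unfold empMean
  rw [abs_mul, abs_of_pos (by positivity : (0 : ℝ) < 1 / m), one_div, inv_mul_le_iff₀ hm']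
  refine (Finset.abs_sum_le_sum_abs _ _).trans ((Finset.sum_le_sum fun i _ => hC (S i)).trans ?_)
  simp

theorem integral_empMean {m : ℕ} (hm : 0 < m) {f : Z → ℝ} (hf : Integrable f μ) :
    ∫ S, empMean f S ∂(Measure.pi fun _ : Fin m => μ) = ∫ z, f z ∂μ := by
  unfold empMean
  rw [integral_const_mul]
  have hp := fun i : Fin m => measurePreserving_eval (fun _ : Fin m => μ) i
  have hi : ∀ i : Fin m, Integrable (fun S : Fin m → Z => f (S i)) (Measure.pi fun _ => μ) :=
    fun i => (hp i).integrable_comp_of_integrable hf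
  rw [integral_finsetSum _ fun i _ => hi i]
  have h : ∀ i : Fin m, ∫ S : Fin m → Z, f (S i) ∂(Measure.pi fun _ => μ) = ∫ z, f z ∂μ :=
    fun i => by
      have := integral_map (μ := Measure.pi fun _ : Fin m => μ) (φ := Function.eval i) (f := f)
        (hp i).measurable.aemeasurable (by rw [(hp i).map_eq]; exact hf.aestronglyMeasurable)
      rw [(hp i).map_eq] at this
      exact this.symm
  simp_rw [h]
  have hm' : (m : ℝ) ≠ 0 := Nat.cast_ne_zero.2 hm.ne'
  simp
  field_simp

section Family
variable {ι : Type*} [Finite ι] [Nonempty ι]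

theorem abs_ciSup_le {f : ι → ℝ} {C : ℝ} (h : ∀ j, |f j| ≤ C) : |⨆ j, f j| ≤ C := by
  obtain ⟨j, hj⟩ := exists_eq_ciSup_of_finite (f := f)
  rw [← hj]; exact h j

/-- The expected largest deviation is at most twice a bound on the Rademacher averages. -/
theorem integral_sup_deviation_le {m : ℕ} (hm : 0 < m) (f : ι → Z → ℝ)
    (hf : ∀ j, Measurable (f j)) {C : ℝ} (hC : ∀ j z, |f j z| ≤ C) {r : ℝ}
    (hr : ∀ S : Fin m → Z, radAvg (fun j i => f j (S i)) ≤ m * r) :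
    ∫ S, ⨆ j, (∫ z, f j z ∂μ - empMean (f j) S) ∂(Measure.pi fun _ : Fin m => μ) ≤ 2 * r := by
  set π := Measure.pi fun _ : Fin m => μ
  have hm' : (0 : ℝ) < m := Nat.cast_pos.2 hm
  have hZ : Nonempty Z := by
    by_contra h
    rw [not_nonempty_iff] at h
    have := measure_univ (μ := μ)
    rw [univ_eq_empty_iff.2 h, measure_empty] at this
    exact zero_ne_one this
  have hC0 : 0 ≤ C := (abs_nonneg _).trans (hC (Classical.arbitrary ι) (Classical.arbitrary Z))
  have hfi : ∀ j, Integrable (f j) μ := fun j => integrable_of_bdd (hf j) (hC j)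
  have hemp : ∀ j, Measurable (empMean (m := m) (f j)) := fun j => measurable_empMean (hf j)
  have hempb : ∀ j (S : Fin m → Z), |empMean (f j) S| ≤ C := fun j S => abs_empMean_le hC0 (hC j) S
  -- `G (S, S')` is the largest difference of the means over two samples
  set G : (Fin m → Z) × (Fin m → Z) → ℝ := fun x => ⨆ j, (empMean (f j) x.1 - empMean (f j) x.2)
    with hG
  have hGm : Measurable G := Measurable.iSup fun j =>
    ((hemp j).comp measurable_fst).sub ((hemp j).comp measurable_snd)
  have hGb : ∀ x, |G x| ≤ 2 * C := fun x => abs_ciSup_le fun j =>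
    (abs_sub _ _).trans (by linarith [hempb j x.1, hempb j x.2])
  have hGi : Integrable G (π.prod π) := integrable_of_bdd hGm hGb
  have hint : ∀ j, |∫ z, f j z ∂μ| ≤ C := fun j => by
    simpa using norm_integral_le_of_norm_le_const (μ := μ) (f := f j) (ae_of_all _ (hC j))
  have hFm : Measurable fun S : Fin m → Z => ⨆ j, (∫ z, f j z ∂μ - empMean (f j) S) :=
    Measurable.iSup fun j => (hemp j).const_sub _
  have step1 : ∫ S, ⨆ j, (∫ z, f j z ∂μ - empMean (f j) S) ∂π ≤ ∫ x, G x ∂(π.prod π) := by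
    rw [integral_prod_symm _ hGi]
    refine integral_mono (integrable_of_bdd (C := 2 * C) hFm fun S => abs_ciSup_le fun j =>
      (abs_sub _ _).trans (by linarith [hempb j S, hint j])) hGi.integral_prod_right fun S => ?_
    refine ciSup_le fun j => ?_
    have i1 : Integrable (empMean (m := m) (f j)) π := integrable_of_bdd (hemp j) (hempb j)
    have e : ∫ z, f j z ∂μ - empMean (f j) S
        = ∫ S', (empMean (f j) S' - empMean (f j) S) ∂π := by
      rw [integral_sub i1 (integrable_const _), integral_empMean hm (hfi j)]
      simp
    rw [e]
    refine integral_mono (i1.sub (integrable_const _)) (integrable_of_bdd (C := 2 * C)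
      (hGm.comp (measurable_id.prodMk measurable_const)) fun S' => hGb _) fun S' => ?_
    exact le_ciSup_finite (fun j => empMean (f j) S' - empMean (f j) S) j
  have step2 : ∀ x : (Fin m → Z) × (Fin m → Z),
      (1 / 2 ^ m : ℝ) * ∑ σ : Fin m → Bool, G (swapPair σ x) ≤ 2 * r := fun x => by
    have h1 : ∀ σ : Fin m → Bool, G (swapPair σ x)
        ≤ (1 / (m : ℝ)) * ((⨆ j, ∑ i, sgn (σ i) * f j (x.1 i))
          + ⨆ j, ∑ i, sgn (σ i) * (-f j (x.2 i))) := fun σ => by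
      refine ciSup_le fun j => ?_
      have e : empMean (f j) (swapPair σ x).1 - empMean (f j) (swapPair σ x).2
          = (1 / (m : ℝ)) * (∑ i, sgn (σ i) * f j (x.1 i) + ∑ i, sgn (σ i) * (-f j (x.2 i))) := by
        unfold empMean
        rw [← mul_sub, ← Finset.sum_sub_distrib, ← Finset.sum_add_distrib]
        congr 1
        refine Finset.sum_congr rfl fun i _ => ?_
        simp only [swapPair, sgn]
        cases σ i <;> simp <;> ring
      rw [e]
      refine mul_le_mul_of_nonneg_left ?_ (by positivity)
      exact add_le_add (le_ciSup_finite (fun j => ∑ i, sgn (σ i) * f j (x.1 i)) j)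
        (le_ciSup_finite (fun j => ∑ i, sgn (σ i) * (-f j (x.2 i))) j)
    have h2 : (1 / 2 ^ m : ℝ) * ∑ σ : Fin m → Bool, G (swapPair σ x)
        ≤ (1 / (m : ℝ)) * (radAvg (fun j i => f j (x.1 i)) + radAvg (fun j i => -f j (x.2 i))) := by
      refine (mul_le_mul_of_nonneg_left (Finset.sum_le_sum fun σ _ => h1 σ)
        (by positivity)).trans_eq ?_
      unfold radAvg
      rw [← Finset.mul_sum, Finset.sum_add_distrib]
      ring
    rw [radAvg_neg] at h2
    refine h2.trans ?_
    rw [one_div, inv_mul_le_iff₀ hm']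
    linarith [hr x.1, hr x.2]
  refine step1.trans ?_
  rw [integral_prod_eq_avg_swap hGm hGb]
  have hsm : ∀ σ : Fin m → Bool, Measurable (swapPair (Z := Z) σ) := fun σ =>
    (measurePreserving_swapPair (μ := μ) σ).measurable
  have h3 : ∫ x, (1 / 2 ^ m : ℝ) * ∑ σ : Fin m → Bool, G (swapPair σ x) ∂(π.prod π)
      ≤ ∫ _, 2 * r ∂(π.prod π) := by
    refine integral_mono ?_ (integrable_const _) step2
    exact (integrable_finsetSum _ fun σ _ =>
      integrable_of_bdd (hGm.comp (hsm σ)) fun x => hGb _).const_mul _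
  simpa using h3

theorem measure_exists_deviation_le_of_finite {m : ℕ} (hm : 0 < m) (f : ι → Z → ℝ)
    (hf : ∀ j, Measurable (f j)) {lo hi : ℝ} (hlt : lo < hi) (hC : ∀ j z, f j z ∈ Icc lo hi)
    {r u : ℝ} (hr : ∀ S : Fin m → Z, radAvg (fun j i => f j (S i)) ≤ m * r) (hu : 0 ≤ u) :
    (Measure.pi fun _ : Fin m => μ) {S | ∃ j, 2 * r + u ≤ ∫ z, f j z ∂μ - empMean (f j) S}
      ≤ ENNReal.ofReal (Real.exp (-(2 * m * u ^ 2 / (hi - lo) ^ 2))) := by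
  have hm' : (0 : ℝ) < m := Nat.cast_pos.2 hm
  have hD : 0 < hi - lo := sub_pos.2 hlt
  set C := max |lo| |hi|
  have hC' : ∀ j z, |f j z| ≤ C := fun j z => abs_le_max_abs_abs (hC j z).1 (hC j z).2
  have hC0 : 0 ≤ C := (abs_nonneg _).trans (le_max_left _ _)
  set F : (Fin m → Z) → ℝ := fun S => ⨆ j, (∫ z, f j z ∂μ - empMean (f j) S) with hF
  have hFm : Measurable F := Measurable.iSup fun j => (measurable_empMean (hf j)).const_sub _
  have hint : ∀ j, |∫ z, f j z ∂μ| ≤ C := fun j => by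
    simpa using norm_integral_le_of_norm_le_const (μ := μ) (f := f j) (ae_of_all _ (hC' j))
  have hFb : ∀ S, |F S| ≤ 2 * C := fun S => abs_ciSup_le fun j =>
    (abs_sub _ _).trans (by linarith [abs_empMean_le hC0 (hC' j) S, hint j])
  have hone : ∀ j (S : Fin m → Z) i z,
      |empMean (f j) (Function.update S i z) - empMean (f j) S| ≤ (hi - lo) / m := by
    intro j S i z
    unfold empMean
    rw [← mul_sub, ← Finset.sum_sub_distrib, Finset.sum_eq_single i]
    · rw [Function.update_self, abs_mul, abs_of_pos (by positivity : (0 : ℝ) < 1 / m), one_div,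
        inv_mul_le_iff₀ hm', mul_div_cancel₀ _ hm'.ne']
      have h1 := hC j z
      have h2 := hC j (S i)
      exact abs_le.2 ⟨by linarith [h1.1, h2.2], by linarith [h1.2, h2.1]⟩
    · intro k _ hk
      rw [Function.update_of_ne hk, sub_self]
    · simp
  have hdiff : ∀ S i z, |F (Function.update S i z) - F S| ≤ (hi - lo) / m := by
    intro S i z
    have h1 : F (Function.update S i z) ≤ F S + (hi - lo) / m := ciSup_le fun j => by
      have h2 := le_ciSup_finite (fun j => ∫ z, f j z ∂μ - empMean (f j) S) j
      have h3 := (abs_le.1 (hone j S i z)).1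
      change _ ≤ F S at h2
      linarith
    have h2 : F S ≤ F (Function.update S i z) + (hi - lo) / m := ciSup_le fun j => by
      have h2 := le_ciSup_finite
        (fun j => ∫ z, f j z ∂μ - empMean (f j) (Function.update S i z)) j
      have h3 := (abs_le.1 (hone j S i z)).2
      change _ ≤ F (Function.update S i z) at h2
      linarith
    exact abs_le.2 ⟨by linarith, by linarith⟩
  have h1 := measure_ge_le_of_bounded_diff (μ := μ) m F hFm hFb hdiff (div_pos hD hm') hm hu
  have h2 := integral_sup_deviation_le (μ := μ) hm f hf hC' hr
  refine (measure_mono ?_).trans (h1.trans_eq ?_)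
  · rintro S ⟨j, hj⟩
    have h3 := le_ciSup_finite (fun j => ∫ z, f j z ∂μ - empMean (f j) S) j
    simp only [mem_ofPred_eq]
    exact (add_le_add_left h2 u).trans (hj.trans h3)
  · congr 3
    field_simp

end Family

/-- A countable union bound from finite subfamilies, by continuity from below. -/
theorem measure_exists_le_of_countable {ι : Type*} [Countable ι] {Ω : Type*} [MeasurableSpace Ω]
    (π : Measure Ω) (p : ι → Ω → Prop) {C : ENNReal}
    (h : ∀ (n : ℕ) (g : Fin (n + 1) → ι), π {S | ∃ k, p (g k) S} ≤ C) :
    π {S | ∃ j, p j S} ≤ C := by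
  rcases isEmpty_or_nonempty ι with he | hne
  · simp
  obtain ⟨e, he⟩ := exists_surjective_nat ι
  set A : ℕ → Set Ω := fun n => {S | ∃ k : Fin (n + 1), p (e k) S}
  have hA : Monotone A := fun n n' hn S ⟨k, hk⟩ =>
    ⟨⟨k, k.2.trans_le (Nat.succ_le_succ hn)⟩, hk⟩
  have hsub : {S | ∃ j, p j S} ⊆ ⋃ n, A n := by
    rintro S ⟨j, hj⟩
    obtain ⟨n, rfl⟩ := he j
    exact mem_iUnion.2 ⟨n, ⟨Fin.last n, hj⟩⟩
  refine (measure_mono hsub).trans ?_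
  rw [hA.measure_iUnion]
  exact iSup_le fun n => h n fun k => e k

/-- Uniform deviations over a countable family, all of whose finite subfamilies have Rademacher
averages at most `r`. -/
theorem measure_exists_deviation_le {ι : Type*} [Countable ι] {m : ℕ} (hm : 0 < m)
    (f : ι → Z → ℝ) (hf : ∀ j, Measurable (f j)) {lo hi : ℝ} (hlt : lo < hi)
    (hC : ∀ j z, f j z ∈ Icc lo hi) {r u : ℝ}
    (hr : ∀ (S : Fin m → Z) (n : ℕ) (g : Fin (n + 1) → ι),
      radAvg (fun k i => f (g k) (S i)) ≤ m * r) (hu : 0 ≤ u) :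
    (Measure.pi fun _ : Fin m => μ) {S | ∃ j, 2 * r + u ≤ ∫ z, f j z ∂μ - empMean (f j) S}
      ≤ ENNReal.ofReal (Real.exp (-(2 * m * u ^ 2 / (hi - lo) ^ 2))) :=
  measure_exists_le_of_countable _ _ fun n g =>
    measure_exists_deviation_le_of_finite hm (fun k => f (g k)) (fun _ => hf _) hlt (fun _ => hC _)
      (fun S => hr S n g) hu

/-- The two-sided form of `measure_exists_deviation_le`. -/
theorem measure_exists_abs_deviation_le {ι : Type*} [Countable ι] {m : ℕ} (hm : 0 < m)
    (f : ι → Z → ℝ) (hf : ∀ j, Measurable (f j)) {lo hi : ℝ} (hlt : lo < hi)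
    (hC : ∀ j z, f j z ∈ Icc lo hi) {r u : ℝ}
    (hr : ∀ (S : Fin m → Z) (n : ℕ) (g : Fin (n + 1) → ι),
      radAvg (fun k i => f (g k) (S i)) ≤ m * r) (hu : 0 ≤ u) :
    (Measure.pi fun _ : Fin m => μ) {S | ∃ j, 2 * r + u ≤ |∫ z, f j z ∂μ - empMean (f j) S|}
      ≤ 2 * ENNReal.ofReal (Real.exp (-(2 * m * u ^ 2 / (hi - lo) ^ 2))) := by
  have h1 := measure_exists_deviation_le (μ := μ) hm f hf hlt hC hr hu
  have h2 := measure_exists_deviation_le (μ := μ) hm (fun j z => -f j z) (fun j => (hf j).neg)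
    (neg_lt_neg hlt) (fun j z => ⟨neg_le_neg (hC j z).2, neg_le_neg (hC j z).1⟩)
    (fun S n g => (radAvg_neg fun k i => f (g k) (S i)).trans_le (hr S n g)) hu
  rw [show -lo - -hi = hi - lo by ring] at h2
  refine (measure_mono ?_).trans (((measure_union_le _ _).trans (add_le_add h1 h2)).trans_eq
    (two_mul _).symm)
  rintro S ⟨j, hj⟩
  rcases le_abs'.1 hj with h | h
  · refine Or.inr ⟨j, ?_⟩
    have e : empMean (fun z => -f j z) S = -empMean (f j) S := by simp [empMean]
    rw [e, integral_neg]; linarith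
  · exact Or.inl ⟨j, h⟩

end Deviation

/-! ### Relative deviations -/

section RelativeDeviation
variable {Z : Type*} [MeasurableSpace Z] {μ : Measure Z} [IsProbabilityMeasure μ]

/-- The inequality behind the relative deviations: with weight `b - b²` on one sample and `-b` on the
other, a coordinate on which exactly one of them errs has exponential moment at most `1`. -/
theorem exp_sub_sq_add_exp_neg_le {b : ℝ} (h0 : 0 ≤ b) (h1 : b ≤ 1) :
    Real.exp (b - b ^ 2) + Real.exp (-b) ≤ 2 := by
  set x := b - b ^ 2 with hx
  have hx0 : 0 ≤ x := by rw [hx]; nlinarith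
  have hxb : x ≤ b := by rw [hx]; nlinarith [sq_nonneg b]
  have e1 : Real.exp x ≤ 1 + x + x ^ 2 / 2 + x ^ 3 * (2 / 9) := by
    have h := Real.exp_bound' hx0 (by linarith) (n := 3) (by norm_num)
    norm_num [Finset.sum_range_succ, Nat.factorial] at h
    linarith
  have e2 : Real.exp (-b) ≤ 1 - b + b ^ 2 / 2 := by
    have hd : ∀ t : ℝ, HasDerivAt (fun t => 1 - t + t ^ 2 / 2 - Real.exp (-t))
        (-1 + t + Real.exp (-t)) t := fun t => by
      have a1 := ((hasDerivAt_id t).const_sub 1).add (((hasDerivAt_id t).pow 2).div_const 2)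
      have a2 := ((hasDerivAt_id t).neg).exp
      refine (a1.sub a2).congr_deriv ?_
      simp
    have hm : MonotoneOn (fun t => 1 - t + t ^ 2 / 2 - Real.exp (-t)) (Ici 0) := by
      refine monotoneOn_of_deriv_nonneg (convex_Ici 0)
        (fun t _ => (hd t).continuousAt.continuousWithinAt)
        (fun t _ => (hd t).differentiableAt.differentiableWithinAt) fun t _ => ?_
      rw [(hd t).deriv]
      linarith [Real.add_one_le_exp (-t)]
    have := hm (mem_Ici.2 le_rfl) (mem_Ici.2 h0) h0
    norm_num at this
    linarith
  have e3 : x ^ 3 ≤ b ^ 3 := pow_le_pow_left₀ hx0 hxb 3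
  have e4 : x + x ^ 2 / 2 = b - b ^ 2 / 2 - b ^ 3 + b ^ 4 / 2 := by rw [hx]; ring
  have e5 : b ^ 4 ≤ b ^ 3 := by nlinarith [pow_nonneg h0 3]
  have e6 : 0 ≤ b ^ 3 := pow_nonneg h0 3
  linarith

section Family
variable {ι : Type*} [Finite ι] [Nonempty ι]

/-- Jensen's inequality, which replaces a mean by the mean over a second sample. -/
theorem exp_mul_mean_le_integral {m : ℕ} (hm : 0 < m) {f : Z → ℝ} (hf : Measurable f)
    (hC : ∀ z, |f z| ≤ 1) (s : ℝ) :
    Real.exp (s * ∫ z, f z ∂μ)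
      ≤ ∫ S, Real.exp (s * empMean f S) ∂(Measure.pi fun _ : Fin m => μ) := by
  have hemp := measurable_empMean (m := m) hf
  have hb : ∀ S : Fin m → Z, |empMean f S| ≤ 1 := abs_empMean_le zero_le_one hC
  have i1 : Integrable (empMean (m := m) f) (Measure.pi fun _ : Fin m => μ) :=
    integrable_of_bdd hemp hb
  rw [← integral_empMean hm (integrable_of_bdd hf hC), ← integral_const_mul]
  have := convexOn_exp.map_integral_le (μ := Measure.pi fun _ : Fin m => μ)
    (f := fun S : Fin m → Z => s * empMean f S) Real.continuous_exp.continuousOn isClosed_univ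
    (by simp) (i1.const_mul s) (integrable_of_bdd (C := Real.exp |s|) (hemp.const_mul s).exp
      fun S => by
        rw [Function.comp_apply, abs_of_pos (Real.exp_pos _), Real.exp_le_exp]
        refine (le_abs_self _).trans ?_
        rw [abs_mul]
        exact mul_le_of_le_one_right (abs_nonneg _) (hb S))
  exact this

/-- For a fixed pair of samples, the exchange of coordinates makes the expectation of the
exponential at most `1` for each pattern. -/
theorem avg_swap_exp_le {m : ℕ} {α β : ℝ} (hαβ : α ≤ β) (h2 : Real.exp α + Real.exp (-β) ≤ 2)
    (v w : Fin m → ℝ) (hv : ∀ i, v i = 0 ∨ v i = 1) (hw : ∀ i, w i = 0 ∨ w i = 1) :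
    (1 / 2 ^ m : ℝ) * ∑ σ : Fin m → Bool,
      Real.exp (∑ i, (α * (if σ i then v i else w i) - β * (if σ i then w i else v i))) ≤ 1 := by
  have e2 := Finset.prod_univ_sum (fun _ : Fin m => (Finset.univ : Finset Bool))
    (fun i b => Real.exp (α * (if b then v i else w i) - β * (if b then w i else v i)))
  rw [Fintype.piFinset_univ] at e2
  simp_rw [Real.exp_sum]
  rw [← e2]
  have h3 : ∏ i, ∑ b : Bool,
      Real.exp (α * (if b then v i else w i) - β * (if b then w i else v i)) ≤ ∏ _i : Fin m, 2 := by
    refine Finset.prod_le_prod (fun i _ => Finset.sum_nonneg fun b _ => (Real.exp_pos _).le)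
      fun i _ => ?_
    rw [Fintype.sum_bool]
    have h4 : Real.exp (α - β) ≤ 1 := Real.exp_le_one_iff.2 (by linarith)
    rcases hv i with a | a <;> rcases hw i with b | b <;> simp [a, b] <;> linarith
  rw [Finset.prod_const, Finset.card_univ, Fintype.card_fin] at h3
  have h5 : (0 : ℝ) < 2 ^ m := by positivity
  rw [one_div, inv_mul_le_iff₀ h5]
  linarith

theorem integral_sup_exp_relative_le {m : ℕ} (hm : 0 < m) (f : ι → Z → ℝ)
    (hf : ∀ j, Measurable (f j)) (h01 : ∀ j z, f j z = 0 ∨ f j z = 1) {N : ℝ}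
    (hN : ∀ x : (Fin m → Z) × (Fin m → Z),
      ((Set.range fun j => ((fun i => f j (x.1 i)), fun i => f j (x.2 i))).ncard : ℝ) ≤ N)
    {α β : ℝ} (hαβ : α ≤ β) (h2 : Real.exp α + Real.exp (-β) ≤ 2) :
    ∫ x : (Fin m → Z) × (Fin m → Z),
      ⨆ j, Real.exp (m * (α * empMean (f j) x.1 - β * empMean (f j) x.2))
        ∂((Measure.pi fun _ : Fin m => μ).prod (Measure.pi fun _ : Fin m => μ)) ≤ N := by
  have hm' : (0 : ℝ) < m := Nat.cast_pos.2 hm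
  have hC : ∀ j z, |f j z| ≤ 1 := fun j z => by rcases h01 j z with h | h <;> simp [h]
  set G : (Fin m → Z) × (Fin m → Z) → ℝ := fun x =>
    ⨆ j, Real.exp (m * (α * empMean (f j) x.1 - β * empMean (f j) x.2)) with hG
  have hemp : ∀ j, Measurable (empMean (m := m) (f j)) := fun j => measurable_empMean (hf j)
  have hGm : Measurable G := Measurable.iSup fun j => (((((hemp j).comp measurable_fst).const_mul α).sub
    (((hemp j).comp measurable_snd).const_mul β)).const_mul _).exp
  have hGb : ∀ x, |G x| ≤ Real.exp (m * (|α| + |β|)) := fun x => abs_ciSup_le fun j => by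
    rw [abs_of_pos (Real.exp_pos _), Real.exp_le_exp]
    refine mul_le_mul_of_nonneg_left ?_ hm'.le
    have a1 := abs_empMean_le zero_le_one (hC j) x.1
    have a2 := abs_empMean_le zero_le_one (hC j) x.2
    have a3 : α * empMean (f j) x.1 ≤ |α| := (le_abs_self _).trans (by
      rw [abs_mul]; exact mul_le_of_le_one_right (abs_nonneg _) a1)
    have a4 : -(β * empMean (f j) x.2) ≤ |β| := (neg_le_abs _).trans (by
      rw [abs_mul]; exact mul_le_of_le_one_right (abs_nonneg _) a2)
    linarith
  rw [integral_prod_eq_avg_swap hGm hGb]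
  have hsm : ∀ σ : Fin m → Bool, Measurable (swapPair (Z := Z) σ) := fun σ =>
    (measurePreserving_swapPair (μ := μ) σ).measurable
  have step : ∀ x : (Fin m → Z) × (Fin m → Z),
      (1 / 2 ^ m : ℝ) * ∑ σ : Fin m → Bool, G (swapPair σ x) ≤ N := fun x => by
    set P : ι → (Fin m → ℝ) × (Fin m → ℝ) := fun j =>
      ((fun i => f j (x.1 i)), fun i => f j (x.2 i)) with hP
    have hfin : (Set.range P).Finite := Set.finite_range P
    have h1 : ∀ σ : Fin m → Bool, G (swapPair σ x) ≤ ∑ p ∈ hfin.toFinset,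
        Real.exp (∑ i, (α * (if σ i then p.1 i else p.2 i)
          - β * (if σ i then p.2 i else p.1 i))) := fun σ => by
      refine ciSup_le fun j => ?_
      have h3 := Finset.single_le_sum (f := fun p : (Fin m → ℝ) × (Fin m → ℝ) =>
        Real.exp (∑ i, (α * (if σ i then p.1 i else p.2 i) - β * (if σ i then p.2 i else p.1 i))))
        (fun _ _ => (Real.exp_pos _).le) (hfin.mem_toFinset.2 ⟨j, rfl⟩)
      refine le_trans (le_of_eq ?_) h3
      congr 1
      simp only [empMean, swapPair, hP]
      rw [Finset.sum_sub_distrib, ← Finset.mul_sum, ← Finset.mul_sum]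
      have e : ∀ (a b : Fin m → Z), ∀ i, f j (if σ i then a i else b i)
          = if σ i then f j (a i) else f j (b i) := fun a b i => by split_ifs <;> rfl
      simp_rw [e]
      field_simp
    have h3 : (1 / 2 ^ m : ℝ) * ∑ σ : Fin m → Bool, G (swapPair σ x)
        ≤ ∑ p ∈ hfin.toFinset, (1 : ℝ) := by
      refine (mul_le_mul_of_nonneg_left (Finset.sum_le_sum fun σ _ => h1 σ)
        (by positivity)).trans ?_
      rw [Finset.sum_comm, Finset.mul_sum]
      refine Finset.sum_le_sum fun p hp => ?_
      obtain ⟨j, rfl⟩ := hfin.mem_toFinset.1 hp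
      exact avg_swap_exp_le hαβ h2 _ _ (fun i => h01 j _) (fun i => h01 j _)
    rw [Finset.sum_const, nsmul_eq_mul, mul_one, ← Set.ncard_eq_toFinset_card _ hfin] at h3
    exact h3.trans (hN x)
  have h3 : ∫ x, (1 / 2 ^ m : ℝ) * ∑ σ : Fin m → Bool, G (swapPair σ x)
      ∂((Measure.pi fun _ : Fin m => μ).prod (Measure.pi fun _ : Fin m => μ))
      ≤ ∫ _, N ∂((Measure.pi fun _ : Fin m => μ).prod (Measure.pi fun _ : Fin m => μ)) := by
    refine integral_mono ?_ (integrable_const _) step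
    exact (integrable_finsetSum _ fun σ _ =>
      integrable_of_bdd (hGm.comp (hsm σ)) fun x => hGb _).const_mul _
  simpa using h3

/-- Markov's inequality for the exponential of a supremum. -/
theorem measure_exists_le_of_integral_sup_exp {m : ℕ} (A : ι → (Fin m → Z) → ℝ)
    (hA : ∀ j, Measurable (A j)) {C N q : ℝ} (hC : ∀ j S, |A j S| ≤ C)
    (hN : ∫ S, ⨆ j, Real.exp (m * A j S) ∂(Measure.pi fun _ : Fin m => μ) ≤ N) :
    (Measure.pi fun _ : Fin m => μ) {S | ∃ j, q ≤ A j S}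
      ≤ ENNReal.ofReal (N * Real.exp (-(m * q))) := by
  set π := Measure.pi fun _ : Fin m => μ
  set F : (Fin m → Z) → ℝ := fun S => ⨆ j, Real.exp (m * A j S) with hF
  have hFm : Measurable F := Measurable.iSup fun j => ((hA j).const_mul _).exp
  have hFi : Integrable F π := integrable_of_bdd (C := Real.exp (m * C)) hFm fun S =>
    abs_ciSup_le fun j => by
      rw [abs_of_pos (Real.exp_pos _), Real.exp_le_exp]
      exact mul_le_mul_of_nonneg_left ((le_abs_self _).trans (hC j S)) (Nat.cast_nonneg _)
  have hF0 : ∀ S, 0 ≤ F S := fun S =>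
    (Real.exp_pos _).le.trans (le_ciSup_finite (fun j => Real.exp (m * A j S))
      (Classical.arbitrary ι))
  have h1 := mul_meas_ge_le_integral_of_nonneg (μ := π) (ae_of_all _ hF0) hFi (Real.exp (m * q))
  have h2 : π {S | ∃ j, q ≤ A j S} ≤ π {S | Real.exp (m * q) ≤ F S} := by
    refine measure_mono ?_
    rintro S ⟨j, hj⟩
    refine le_trans ?_ (le_ciSup_finite (fun j => Real.exp (m * A j S)) j)
    exact Real.exp_le_exp.2 (mul_le_mul_of_nonneg_left hj (Nat.cast_nonneg _))
  refine h2.trans ?_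
  rw [← ofReal_measureReal]
  refine ENNReal.ofReal_le_ofReal ?_
  rw [Real.exp_neg, ← div_eq_mul_inv, le_div_iff₀ (Real.exp_pos _), mul_comm]
  exact h1.trans hN

theorem measure_exists_relative_le_of_finite {m : ℕ} (hm : 0 < m) (f : ι → Z → ℝ)
    (hf : ∀ j, Measurable (f j)) (h01 : ∀ j z, f j z = 0 ∨ f j z = 1) {N : ℝ}
    (hN : ∀ x : (Fin m → Z) × (Fin m → Z),
      ((Set.range fun j => ((fun i => f j (x.1 i)), fun i => f j (x.2 i))).ncard : ℝ) ≤ N)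
    {α β q : ℝ} (hαβ : α ≤ β) (h2 : Real.exp α + Real.exp (-β) ≤ 2) :
    (Measure.pi fun _ : Fin m => μ) {S | ∃ j, q ≤ α * ∫ z, f j z ∂μ - β * empMean (f j) S}
        ≤ ENNReal.ofReal (N * Real.exp (-(m * q))) ∧
    (Measure.pi fun _ : Fin m => μ) {S | ∃ j, q ≤ α * empMean (f j) S - β * ∫ z, f j z ∂μ}
        ≤ ENNReal.ofReal (N * Real.exp (-(m * q))) := by
  set π := Measure.pi fun _ : Fin m => μ
  have hm' : (0 : ℝ) < m := Nat.cast_pos.2 hm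
  have hC : ∀ j z, |f j z| ≤ 1 := fun j z => by rcases h01 j z with h | h <;> simp [h]
  have hemp : ∀ j, Measurable (empMean (m := m) (f j)) := fun j => measurable_empMean (hf j)
  have hempb : ∀ j (S : Fin m → Z), |empMean (f j) S| ≤ 1 := fun j S =>
    abs_empMean_le zero_le_one (hC j) S
  have hint : ∀ j, |∫ z, f j z ∂μ| ≤ 1 := fun j => by
    simpa using norm_integral_le_of_norm_le_const (μ := μ) (f := f j) (ae_of_all _ (hC j))
  have hlin : ∀ a b : ℝ, |a| ≤ 1 → |b| ≤ 1 → |α * a - β * b| ≤ |α| + |β| := fun a b ha hb => by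
    refine (abs_sub _ _).trans ?_
    rw [abs_mul, abs_mul]
    exact add_le_add (mul_le_of_le_one_right (abs_nonneg _) ha)
      (mul_le_of_le_one_right (abs_nonneg _) hb)
  set G : (Fin m → Z) × (Fin m → Z) → ℝ := fun x =>
    ⨆ j, Real.exp (m * (α * empMean (f j) x.1 - β * empMean (f j) x.2)) with hG
  have hGN : ∫ x, G x ∂(π.prod π) ≤ N := integral_sup_exp_relative_le hm f hf h01 hN hαβ h2
  have hexpb : ∀ t : ℝ, |t| ≤ |α| + |β| → |Real.exp (m * t)| ≤ Real.exp (m * (|α| + |β|)) :=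
    fun t ht => by
      rw [abs_of_pos (Real.exp_pos _), Real.exp_le_exp]
      exact mul_le_mul_of_nonneg_left ((le_abs_self _).trans ht) hm'.le
  have hGm : Measurable G := Measurable.iSup fun j =>
    (((((hemp j).comp measurable_fst).const_mul α).sub
      (((hemp j).comp measurable_snd).const_mul β)).const_mul _).exp
  have hGb : ∀ x, |G x| ≤ Real.exp (m * (|α| + |β|)) := fun x => abs_ciSup_le fun j =>
    hexpb _ (hlin _ _ (hempb j _) (hempb j _))
  have hGi : Integrable G (π.prod π) := integrable_of_bdd hGm hGb
  constructor
  · refine measure_exists_le_of_integral_sup_exp _ (fun j => ((hemp j).const_mul β).const_sub _)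
      (fun j S => hlin _ _ (hint j) (hempb j S)) (le_trans ?_ hGN)
    rw [integral_prod_symm _ hGi]
    refine integral_mono (integrable_of_bdd (C := Real.exp (m * (|α| + |β|)))
      (Measurable.iSup fun j => ((((hemp j).const_mul β).const_sub _).const_mul _).exp) fun S =>
        abs_ciSup_le fun j => hexpb _ (hlin _ _ (hint j) (hempb j S))) hGi.integral_prod_right
      fun S => ciSup_le fun j => ?_
    have h3 := exp_mul_mean_le_integral (μ := μ) hm (hf j) (hC j) (m * α)
    have h4 : Real.exp (m * (α * ∫ z, f j z ∂μ - β * empMean (f j) S))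
        = Real.exp (-(m * (β * empMean (f j) S))) * Real.exp (m * α * ∫ z, f j z ∂μ) := by
      rw [← Real.exp_add]; ring_nf
    rw [h4]
    refine (mul_le_mul_of_nonneg_left h3 (Real.exp_pos _).le).trans ?_
    rw [← integral_const_mul]
    have e : ∀ S' : Fin m → Z, Real.exp (-(m * (β * empMean (f j) S)))
        * Real.exp (m * α * empMean (f j) S')
        = Real.exp (m * (α * empMean (f j) S' - β * empMean (f j) S)) := fun S' => by
      rw [← Real.exp_add]; ring_nf
    simp_rw [e]
    refine integral_mono (integrable_of_bdd (C := Real.exp (m * (|α| + |β|)))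
      ((((hemp j).const_mul α).sub_const _).const_mul _).exp fun S' =>
        hexpb _ (hlin _ _ (hempb j S') (hempb j S)))
      (integrable_of_bdd (hGm.comp (measurable_id.prodMk measurable_const)) fun S' => hGb _)
      fun S' => ?_
    exact le_ciSup_finite (fun j => Real.exp (m * (α * empMean (f j) S' - β * empMean (f j) S))) j
  · refine measure_exists_le_of_integral_sup_exp _ (fun j => ((hemp j).const_mul α).sub_const _)
      (fun j S => hlin _ _ (hempb j S) (hint j)) (le_trans ?_ hGN)
    rw [integral_prod _ hGi]
    refine integral_mono (integrable_of_bdd (C := Real.exp (m * (|α| + |β|)))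
      (Measurable.iSup fun j => ((((hemp j).const_mul α).sub_const _).const_mul _).exp) fun S =>
        abs_ciSup_le fun j => hexpb _ (hlin _ _ (hempb j S) (hint j))) hGi.integral_prod_left
      fun S => ciSup_le fun j => ?_
    have h3 := exp_mul_mean_le_integral (μ := μ) hm (hf j) (hC j) (-(m * β))
    have h4 : Real.exp (m * (α * empMean (f j) S - β * ∫ z, f j z ∂μ))
        = Real.exp (m * (α * empMean (f j) S)) * Real.exp (-(m * β) * ∫ z, f j z ∂μ) := by
      rw [← Real.exp_add]; ring_nf
    rw [h4]
    refine (mul_le_mul_of_nonneg_left h3 (Real.exp_pos _).le).trans ?_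
    rw [← integral_const_mul]
    have e : ∀ S' : Fin m → Z, Real.exp (m * (α * empMean (f j) S))
        * Real.exp (-(m * β) * empMean (f j) S')
        = Real.exp (m * (α * empMean (f j) S - β * empMean (f j) S')) := fun S' => by
      rw [← Real.exp_add]; ring_nf
    simp_rw [e]
    refine integral_mono (integrable_of_bdd (C := Real.exp (m * (|α| + |β|)))
      ((((hemp j).const_mul β).const_sub _).const_mul _).exp fun S' =>
        hexpb _ (hlin _ _ (hempb j S) (hempb j S')))
      (integrable_of_bdd (hGm.comp (measurable_const.prodMk measurable_id)) fun S' => hGb _)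
      fun S' => ?_
    exact le_ciSup_finite (fun j => Real.exp (m * (α * empMean (f j) S - β * empMean (f j) S'))) j

end Family

/-- The empirical mean of a `{0,1}`-valued function is one of `0, 1/m, …, 1`. -/
theorem exists_empMean_eq_div {Z : Type*} {m : ℕ} {f : Z → ℝ} (h01 : ∀ z, f z = 0 ∨ f z = 1) (S : Fin m → Z) :
    ∃ k ∈ Finset.range (m + 1), empMean f S = k / m := by
  classical
  refine ⟨(Finset.univ.filter fun i => f (S i) = 1).card, ?_, ?_⟩
  · rw [Finset.mem_range, Nat.lt_succ_iff]
    exact (Finset.card_filter_le _ _).trans (by simp)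
  · unfold empMean
    rw [one_div, inv_mul_eq_div]
    congr 1
    rw [Finset.card_filter, Nat.cast_sum]
    refine Finset.sum_congr rfl fun i _ => ?_
    rcases h01 (S i) with h | h <;> simp [h]

/-- Relative deviations of the means of a countable family of events with at most `N` patterns on
any two samples. The parameter of the exponential moment is optimized separately for each of the
`m + 1` possible values of the empirical mean. -/
theorem measure_exists_relative_deviation_le {ι : Type*} [Countable ι] {m : ℕ} (hm : 0 < m)
    (f : ι → Z → ℝ) (hf : ∀ j, Measurable (f j)) (h01 : ∀ j z, f j z = 0 ∨ f j z = 1) {N : ℝ}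
    (hN : ∀ (x : (Fin m → Z) × (Fin m → Z)) (n : ℕ) (g : Fin (n + 1) → ι),
      ((Set.range fun k => ((fun i => f (g k) (x.1 i)), fun i => f (g k) (x.2 i))).ncard : ℝ) ≤ N)
    (hN0 : 0 ≤ N) {Q : ℝ} (hQ : 0 < Q) :
    (Measure.pi fun _ : Fin m => μ)
      {S | ∃ j, ∫ z, f j z ∂μ > empMean (f j) S + 2 * √(Q * empMean (f j) S) + 8 * Q ∨
        empMean (f j) S > ∫ z, f j z ∂μ + 2 * √(Q * empMean (f j) S)}
      ≤ ENNReal.ofReal (2 * ((m + 1) * (N * Real.exp (-(m * Q))))) := by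
  set π := Measure.pi fun _ : Fin m => μ
  set y := √Q with hy
  have hy0 : 0 < y := Real.sqrt_pos.2 hQ
  have hyQ : y ^ 2 = Q := Real.sq_sqrt hQ.le
  set x : ℕ → ℝ := fun k => √((k : ℝ) / m) with hx
  have hx0 : ∀ k, 0 ≤ x k := fun k => Real.sqrt_nonneg _
  have hxk : ∀ k, x k ^ 2 = k / m := fun k => Real.sq_sqrt (by positivity)
  -- `x k ^ 2` is the `k`th possible empirical mean. The parameters `b k` and `d k` make the linear
  -- inequalities below imply the two deviation bounds; `d k = 0` marks the values of `k` for which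
  -- the second deviation cannot occur.
  set b : ℕ → ℝ := fun k => y / (x k + 2 * y) with hb
  set d : ℕ → ℝ := fun k => if 2 * y < x k then y / x k else 0 with hd
  have hb0 : ∀ k, 0 ≤ b k := fun k => by have := hx0 k; positivity
  have hb1 : ∀ k, b k ≤ 1 := fun k => div_le_one_of_le₀ (by linarith [hx0 k])
    (by linarith [hx0 k])
  have hd0 : ∀ k, 0 ≤ d k := fun k => by
    simp only [hd]; split_ifs with h
    · have := hx0 k; positivity
    · exact le_rfl
  have hd1 : ∀ k, d k ≤ 1 := fun k => by
    simp only [hd]; split_ifs with h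
    · exact div_le_one_of_le₀ (by linarith) (hx0 k)
    · exact zero_le_one
  have hfwd : ∀ k, π {S | ∃ j, Q ≤ (b k - b k ^ 2) * ∫ z, f j z ∂μ - b k * empMean (f j) S}
      ≤ ENNReal.ofReal (N * Real.exp (-(m * Q))) := fun k =>
    measure_exists_le_of_countable π _ fun n g =>
      (measure_exists_relative_le_of_finite hm (fun k => f (g k)) (fun _ => hf _) (fun _ => h01 _)
        (fun x => hN x n g) (by nlinarith [sq_nonneg (b k)])
        (exp_sub_sq_add_exp_neg_le (hb0 k) (hb1 k))).1
  have hrev : ∀ k, π {S | ∃ j, Q ≤ (d k - d k ^ 2) * empMean (f j) S - d k * ∫ z, f j z ∂μ}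
      ≤ ENNReal.ofReal (N * Real.exp (-(m * Q))) := fun k =>
    measure_exists_le_of_countable π _ fun n g =>
      (measure_exists_relative_le_of_finite hm (fun k => f (g k)) (fun _ => hf _) (fun _ => h01 _)
        (fun x => hN x n g) (by nlinarith [sq_nonneg (d k)])
        (exp_sub_sq_add_exp_neg_le (hd0 k) (hd1 k))).2
  have hsub : {S : Fin m → Z | ∃ j, ∫ z, f j z ∂μ > empMean (f j) S + 2 * √(Q * empMean (f j) S) + 8 * Q ∨
        empMean (f j) S > ∫ z, f j z ∂μ + 2 * √(Q * empMean (f j) S)} ⊆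
      ⋃ k ∈ Finset.range (m + 1),
        ({S : Fin m → Z | ∃ j, Q ≤ (b k - b k ^ 2) * ∫ z, f j z ∂μ - b k * empMean (f j) S} ∪
         {S : Fin m → Z | ∃ j, Q ≤ (d k - d k ^ 2) * empMean (f j) S - d k * ∫ z, f j z ∂μ}) := by
    rintro S ⟨j, hj⟩
    obtain ⟨k, hk, he⟩ := exists_empMean_eq_div (h01 j) S
    refine mem_iUnion₂.2 ⟨k, hk, ?_⟩
    have e1 : empMean (f j) S = x k ^ 2 := by rw [he, hxk]
    have e2 : √(Q * empMean (f j) S) = y * x k := by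
      rw [e1, Real.sqrt_mul hQ.le, Real.sqrt_sq (hx0 k)]
    set M := ∫ z, f j z ∂μ with hM
    have hM0 : 0 ≤ M := integral_nonneg fun z => by rcases h01 j z with h | h <;> simp [h]
    rw [e2] at hj
    have hxk0 := hx0 k
    rcases hj with hj | hj
    · left
      refine ⟨j, ?_⟩
      rw [e1] at hj ⊢
      rw [← hyQ] at hj ⊢
      rw [← hM]
      have hs : 0 < x k + 2 * y := by linarith
      have e3 : (b k - b k ^ 2) * M - b k * x k ^ 2
          = y * ((x k + y) * M - (x k + 2 * y) * x k ^ 2) / (x k + 2 * y) ^ 2 := by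
        simp only [hb]; field_simp; ring
      rw [e3, le_div_iff₀ (by positivity)]
      have h5 : (x k + y) * (x k ^ 2 + 2 * (y * x k) + 8 * y ^ 2) ≤ (x k + y) * M :=
        mul_le_mul_of_nonneg_left hj.le (by linarith)
      have h6 : y * (x k + 2 * y) ^ 2 ≤ (x k + y) * M - (x k + 2 * y) * x k ^ 2 := by
        have : 0 ≤ x k * y ^ 2 := by positivity
        have : 0 ≤ y ^ 3 := by positivity
        nlinarith
      nlinarith [mul_le_mul_of_nonneg_left h6 hy0.le]
    · right
      refine ⟨j, ?_⟩
      rw [e1] at hj ⊢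
      rw [← hM]
      have hxp : 0 < x k := by
        rcases hxk0.eq_or_lt with h | h
        · rw [← h] at hj; norm_num at hj; linarith
        · exact h
      have h2y : 2 * y < x k := by
        by_contra! h
        nlinarith
      have e3 : d k = y / x k := by simp only [hd, h2y, if_true]
      have e4 : (d k - d k ^ 2) * x k ^ 2 - d k * M = y / x k * (x k ^ 2 - y * x k - M) := by
        rw [e3]; field_simp
      rw [e4, ← hyQ]
      have h7 : y * x k ≤ x k ^ 2 - y * x k - M := by linarith
      calc y ^ 2 = y / x k * (y * x k) := by field_simp
        _ ≤ _ := mul_le_mul_of_nonneg_left h7 (by positivity)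
  refine (measure_mono hsub).trans ((measure_biUnion_finset_le _ _).trans ?_)
  have hE : 0 ≤ N * Real.exp (-(m * Q)) := mul_nonneg hN0 (Real.exp_pos _).le
  have h8 : ∀ k ∈ Finset.range (m + 1),
      π ({S | ∃ j, Q ≤ (b k - b k ^ 2) * ∫ z, f j z ∂μ - b k * empMean (f j) S} ∪
         {S | ∃ j, Q ≤ (d k - d k ^ 2) * empMean (f j) S - d k * ∫ z, f j z ∂μ})
        ≤ ENNReal.ofReal (2 * (N * Real.exp (-(m * Q)))) := fun k _ => by
    refine (measure_union_le _ _).trans ((add_le_add (hfwd k) (hrev k)).trans_eq ?_)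
    rw [← ENNReal.ofReal_add hE hE]; ring_nf
  refine (Finset.sum_le_sum h8).trans_eq ?_
  rw [Finset.sum_const, Finset.card_range, nsmul_eq_mul, ← ENNReal.ofReal_natCast,
    ← ENNReal.ofReal_mul (Nat.cast_nonneg _)]
  congr 1
  push_cast
  ring

end RelativeDeviation

/-! ### Growth functions -/

section Growth

theorem sum_choose_le_pow (n d : ℕ) : ∑ k ∈ Finset.Iic d, n.choose k ≤ (n + 1) ^ d := by
  induction d with
  | zero => simp [Finset.Iic_eq_Icc]
  | succ d ih =>
    have e : Finset.Iic (d + 1) = insert (d + 1) (Finset.Iic d) := by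
      ext; simp only [Finset.mem_Iic, Finset.mem_insert]; omega
    rw [e, Finset.sum_insert (by simp)]
    have h1 : n.choose (d + 1) ≤ n ^ (d + 1) := Nat.choose_le_pow _ _
    have h2 : n ^ (d + 1) ≤ n * (n + 1) ^ d := by
      rw [pow_succ, mul_comm]
      exact Nat.mul_le_mul_left _ (Nat.pow_le_pow_left (Nat.le_succ n) d)
    calc _ ≤ n * (n + 1) ^ d + (n + 1) ^ d := by omega
      _ = (n + 1) ^ (d + 1) := by ring

/-- The Sauer–Shelah bound in its polynomial form. -/
theorem card_le_pow_of_shatters {ι : Type*} [Fintype ι] [DecidableEq ι]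
    (𝒜 : Finset (Finset ι)) {d : ℕ} (h : ∀ s, 𝒜.Shatters s → s.card ≤ d) :
    𝒜.card ≤ (Fintype.card ι + 1) ^ d := by
  refine (Finset.card_le_card_shatterer 𝒜).trans
    (Finset.card_shatterer_le_sum_vcDim.trans ((sum_choose_le_pow _ _).trans ?_))
  exact Nat.pow_le_pow_right (Nat.succ_pos _)
    (Finset.sup_le fun s hs => h s (Finset.mem_shatterer.1 hs))

variable {X : Type u} {H : Set (X → ℝ)}

/-- A binary class of VC dimension `V` has at most `(n + 1) ^ V` traces on `n` points. -/
theorem ncard_trace_le (hb : IsBinary H) (hV : FiniteVC H) {ι : Type*} [Fintype ι] (x : ι → X) :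
    {v : ι → ℝ | ∃ h ∈ H, v = fun i => h (x i)}.Finite ∧
    {v : ι → ℝ | ∃ h ∈ H, v = fun i => h (x i)}.ncard ≤ (Fintype.card ι + 1) ^ vcDim H := by
  classical
  set 𝒜 : Finset (Finset ι) :=
    Finset.univ.filter fun A => ∃ h ∈ H, A = Finset.univ.filter fun i => h (x i) = 1 with h𝒜
  have hcard : 𝒜.card ≤ (Fintype.card ι + 1) ^ vcDim H := by
    refine card_le_pow_of_shatters 𝒜 fun s hs => ?_
    have hreal : ∀ t ⊆ s, ∃ h ∈ H, ∀ i ∈ s, h (x i) = 1 ↔ i ∈ t := fun t ht => by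
      obtain ⟨A, hA, hAt⟩ := hs ht
      obtain ⟨h, hH, rfl⟩ := (Finset.mem_filter.1 hA).2
      refine ⟨h, hH, fun i hi => ?_⟩
      rw [← hAt]; simp [hi]
    have hinj : Set.InjOn x s := fun i hi j hj hij => by
      obtain ⟨h, -, hh⟩ := hreal {i} (by simpa using hi)
      have h1 := (hh i hi).2 (by simp)
      rw [hij] at h1
      exact (Finset.mem_singleton.1 ((hh j hj).1 h1)).symm
    refine le_csSup hV ⟨s.image x, Finset.card_image_of_injOn hinj, fun b _ => ?_⟩
    obtain ⟨h, hH, hh⟩ := hreal (s.filter fun i => x i ∈ b) (Finset.filter_subset _ _)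
    refine ⟨h, hH, fun y hy => ?_⟩
    obtain ⟨i, hi, rfl⟩ := Finset.mem_image.1 hy
    rw [hh i hi]; simp [hi]
  have hsub : {v : ι → ℝ | ∃ h ∈ H, v = fun i => h (x i)} ⊆
      ((𝒜.image fun A i => if i ∈ A then (1 : ℝ) else -1 : Finset (ι → ℝ)) : Set (ι → ℝ)) := by
    rintro _ ⟨h, hH, rfl⟩
    refine Finset.mem_coe.2 (Finset.mem_image.2
      ⟨Finset.univ.filter fun i => h (x i) = 1,
        Finset.mem_filter.2 ⟨Finset.mem_univ _, h, hH, rfl⟩, funext fun i => ?_⟩)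
    rcases hb h hH (x i) with e | e <;> norm_num [e]
  refine ⟨(Finset.finite_toSet _).subset hsub,
    (Set.ncard_le_ncard hsub (Finset.finite_toSet _)).trans ?_⟩
  rw [Set.ncard_coe_finset]
  exact Finset.card_image_le.trans hcard

open Classical in
/-- The sets cut out by a `d`-dimensional affine family of functions shatter no set of more than `d`
points: on such a set there is a relation `∑ i, c i * g j i = 0`. The function of the family that is
nonnegative exactly where `c ≥ 0` shows `0 ≤ ∑ i, c i * f i`, the one belonging to `-c` shows the
opposite inequality, and one of the two is strict. -/
theorem card_affine_trace_le {ι : Type*} [Fintype ι] {d : ℕ} (f : ι → ℝ) (g : Fin d → ι → ℝ) :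
    (Finset.univ.filter fun A : Finset ι => ∃ w : Fin d → ℝ,
      A = Finset.univ.filter fun i => 0 ≤ f i + ∑ j, w j * g j i).card
      ≤ (Fintype.card ι + 1) ^ d := by
  refine card_le_pow_of_shatters _ fun s hs => ?_
  by_contra! hd
  set F : (s → ℝ) →ₗ[ℝ] (Fin d → ℝ) :=
    { toFun := fun c j => ∑ i : s, c i * g j i
      map_add' := fun c c' => by
        funext j; simp [add_mul, Finset.sum_add_distrib]
      map_smul' := fun r c => by
        funext j; simp [mul_assoc, Finset.mul_sum] } with hF
  have hker : LinearMap.ker F ≠ ⊥ := LinearMap.ker_ne_bot_of_finrank_lt (by simpa using hd)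
  obtain ⟨c, hc, hc0⟩ := Submodule.exists_mem_ne_zero_of_ne_bot hker
  have key : ∀ c : s → ℝ, F c = 0 →
      0 ≤ ∑ i, c i * f i ∧ ((∃ i, c i < 0) → 0 < ∑ i, c i * f i) := fun c hc => by
    obtain ⟨A, hA, hAt⟩ := hs (t := s.filter fun i => ∃ hi : i ∈ s, 0 ≤ c ⟨i, hi⟩)
      (Finset.filter_subset _ _)
    obtain ⟨w, rfl⟩ := (Finset.mem_filter.1 hA).2
    have hw : ∀ i : s, 0 ≤ f i + ∑ j, w j * g j i ↔ 0 ≤ c i := fun i => by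
      have := Finset.ext_iff.1 hAt i
      simpa using this
    have hsum : ∑ i : s, c i * f i = ∑ i : s, c i * (f i + ∑ j, w j * g j i) := by
      have h0 : ∑ i : s, c i * ∑ j, w j * g j i = 0 := by
        simp_rw [Finset.mul_sum]
        rw [Finset.sum_comm]
        refine Finset.sum_eq_zero fun j _ => ?_
        have hj : ∑ i : s, c i * g j i = 0 := congrFun hc j
        have e : ∀ i : s, c i * (w j * g j i) = w j * (c i * g j i) := fun i => by ring
        simp_rw [e, ← Finset.mul_sum, hj, mul_zero]
      simp_rw [mul_add, Finset.sum_add_distrib, h0, add_zero]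
    have hnn : ∀ i : s, 0 ≤ c i * (f i + ∑ j, w j * g j i) := fun i => by
      rcases le_or_gt 0 (c i) with h | h
      · exact mul_nonneg h ((hw i).2 h)
      · exact mul_nonneg_of_nonpos_of_nonpos h.le (not_le.1 fun h' => h.not_ge ((hw i).1 h')).le
    refine ⟨hsum ▸ Finset.sum_nonneg fun i _ => hnn i, fun ⟨i, hi⟩ => ?_⟩
    rw [hsum]
    refine Finset.sum_pos' (fun i _ => hnn i) ⟨i, Finset.mem_univ _, ?_⟩
    exact mul_pos_of_neg_of_neg hi (not_le.1 fun h' => hi.not_ge ((hw i).1 h'))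
  have h1 := key c hc
  have h2 := key (-c) (by rw [map_neg, LinearMap.mem_ker.1 hc, neg_zero])
  simp only [Pi.neg_apply, neg_mul, Finset.sum_neg_distrib] at h2
  apply hc0
  funext i
  by_contra hi
  rcases lt_or_gt_of_ne hi with h | h
  · linarith [h1.2 ⟨i, h⟩, h2.1]
  · linarith [h2.2 ⟨i, by simpa using h⟩, h1.1]

open Classical in
/-- The number of traces on `n` points of the thresholded combinations of `d + 1` members of a
binary class. The first weight is normalized to `1`, `-1` or `0`. -/
theorem card_combination_trace_le (hb : IsBinary H) (hV : FiniteVC H) {ι : Type*} [Fintype ι]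
    (x : ι → X) (d : ℕ) :
    (Finset.univ.filter fun A : Finset ι => ∃ (w : Fin (d + 1) → ℝ) (h : Fin (d + 1) → H),
      A = Finset.univ.filter fun i => 0 ≤ ∑ j, w j * (h j).1 (x i)).card
      ≤ ((Fintype.card ι + 1) ^ vcDim H) ^ (d + 1) * (3 * (Fintype.card ι + 1) ^ d) := by
  obtain ⟨hfin, hcard⟩ := ncard_trace_le hb hV x
  set P : Finset (ι → ℝ) := hfin.toFinset with hP
  have hPc : P.card ≤ (Fintype.card ι + 1) ^ vcDim H := by
    rwa [← Set.ncard_eq_toFinset_card _ hfin]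
  set D : Finset ℝ := {1, -1, 0} with hD
  set B : (Fin (d + 1) → ι → ℝ) → ℝ → Finset (Finset ι) := fun u r =>
    Finset.univ.filter fun A : Finset ι => ∃ w : Fin d → ℝ,
      A = Finset.univ.filter fun i => 0 ≤ r * u 0 i + ∑ j, w j * u j.succ i with hB
  have hsub : (Finset.univ.filter fun A : Finset ι =>
      ∃ (w : Fin (d + 1) → ℝ) (h : Fin (d + 1) → H),
        A = Finset.univ.filter fun i => 0 ≤ ∑ j, w j * (h j).1 (x i)) ⊆
      (Fintype.piFinset fun _ : Fin (d + 1) => P).biUnion fun u => D.biUnion (B u) := by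
    intro A hA
    obtain ⟨w, h, rfl⟩ := (Finset.mem_filter.1 hA).2
    refine Finset.mem_biUnion.2 ⟨fun j i => (h j).1 (x i),
      Fintype.mem_piFinset.2 fun j => hfin.mem_toFinset.2 ⟨_, (h j).2, rfl⟩, ?_⟩
    have hstep : ∀ r : ℝ, r ∈ D → ∀ s : ℝ, 0 < s → w 0 = s * r →
        (Finset.univ.filter fun i => 0 ≤ ∑ j, w j * (h j).1 (x i)) ∈
          D.biUnion (B fun j i => (h j).1 (x i)) := fun r hr s hs hw => by
      refine Finset.mem_biUnion.2 ⟨r, hr, Finset.mem_filter.2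
        ⟨Finset.mem_univ _, fun j => w j.succ / s, Finset.filter_congr fun i _ => ?_⟩⟩
      have e : ∑ j, w j * (h j).1 (x i)
          = s * (r * (h 0).1 (x i) + ∑ j : Fin d, w j.succ / s * (h j.succ).1 (x i)) := by
        rw [Fin.sum_univ_succ, hw, mul_add, Finset.mul_sum]
        congr 1
        · ring
        · refine Finset.sum_congr rfl fun j _ => ?_
          field_simp
      rw [e, mul_nonneg_iff_of_pos_left hs]
    rcases lt_trichotomy (w 0) 0 with h0 | h0 | h0
    · exact hstep (-1) (by simp [hD]) (-w 0) (by linarith) (by ring)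
    · exact hstep 0 (by simp [hD]) 1 one_pos (by rw [h0]; ring)
    · exact hstep 1 (by simp [hD]) (w 0) h0 (by ring)
  refine (Finset.card_le_card hsub).trans ?_
  refine (Finset.card_biUnion_le_card_mul _ _ (3 * (Fintype.card ι + 1) ^ d) fun u _ => ?_).trans ?_
  · refine (Finset.card_biUnion_le_card_mul _ _ ((Fintype.card ι + 1) ^ d) fun r _ => ?_).trans ?_
    · exact card_affine_trace_le (fun i => r * u 0 i) fun j => u j.succ
    · exact Nat.mul_le_mul_right _ Finset.card_le_three
  · refine Nat.mul_le_mul_right _ ?_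
    rw [Fintype.card_piFinset_const]
    exact Nat.pow_le_pow_left hPc _

end Growth

/-! ### Curvature of the empirical risk along the algorithm -/

section Curvature
variable {X : Type u} {H : Set (X → ℝ)} {ℓ : ℝ → ℝ} {m : ℕ} {S : Fin m → X × Bool}

theorem empMean_mono {Z : Type*} {S : Fin m → Z} {f g : Z → ℝ} (h : ∀ i, f (S i) ≤ g (S i)) :
    empMean f S ≤ empMean g S :=
  mul_le_mul_of_nonneg_left (Finset.sum_le_sum fun i _ => h i) (by positivity)

theorem empMean_le_empMean {Z : Type*} (S : Fin m → Z) {f g : Z → ℝ} (h : ∀ z, f z ≤ g z) :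
    empMean f S ≤ empMean g S := empMean_mono fun _ => h _

theorem empMean_add {Z : Type*} (S : Fin m → Z) (f g : Z → ℝ) :
    empMean (fun z => f z + g z) S = empMean f S + empMean g S := by
  simp [empMean, Finset.sum_add_distrib, mul_add]

theorem empMean_const_mul {Z : Type*} (S : Fin m → Z) (c : ℝ) (f : Z → ℝ) :
    empMean (fun z => c * f z) S = c * empMean f S := by
  simp only [empMean, ← Finset.mul_sum]; ring

theorem empRisk_eq (lam : Weights H) : empRisk ℓ S lam = empMean (fun z => ℓ (opA lam z)) S := rfl

theorem empGrad_eq (lam v : Weights H) :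
    empGrad ℓ S lam v = empMean (fun z => deriv ℓ (opA lam z) * opA v z) S := rfl

theorem empRisk_zero (hm : 0 < m) : empRisk ℓ S (0 : Weights H) = ℓ 0 := by
  have : (m : ℝ) ≠ 0 := by positivity
  simp [empRisk, opA_zero, this]

theorem empMean_nonneg {Z : Type*} {S : Fin m → Z} {f : Z → ℝ} (h : ∀ i, 0 ≤ f (S i)) :
    0 ≤ empMean f S := mul_nonneg (by positivity) (Finset.sum_nonneg fun i _ => h i)

theorem opA_add_smul (hb : IsBinary H) (lam v : Weights H) (s : ℝ) (z : X × Bool) :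
    opA (lam + s • v) z = opA lam z + s * opA v z := by rw [opA_add hb, opA_smul]

theorem hasDerivAt_empRisk_line (h : LossBds ℓ) (hb : IsBinary H) (S : Fin m → X × Bool)
    (lam v : Weights H) (s : ℝ) :
    HasDerivAt (fun s : ℝ => empRisk ℓ S (lam + s • v)) (empGrad ℓ S (lam + s • v) v) s := by
  unfold empRisk empGrad
  refine HasDerivAt.const_mul _ (HasDerivAt.fun_sum fun i _ => ?_)
  simp only [opA_add_smul hb]
  have h1 : HasDerivAt (fun s : ℝ => opA lam (S i) + s * opA v (S i)) (opA v (S i)) s := by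
    simpa using ((hasDerivAt_id s).mul_const (opA v (S i))).const_add (opA lam (S i))
  exact (h.hasDerivAt _).comp s h1

theorem hasDerivAt_empGrad_line (htd : LossTd ℓ) (hb : IsBinary H) (S : Fin m → X × Bool)
    (lam v : Weights H) (s : ℝ) :
    HasDerivAt (fun s : ℝ => empGrad ℓ S (lam + s • v) v)
      (empMean (fun z => deriv (deriv ℓ) (opA (lam + s • v) z) * opA v z ^ 2) S) s := by
  unfold empGrad empMean
  refine HasDerivAt.const_mul _ (HasDerivAt.fun_sum fun i _ => ?_)
  simp only [opA_add_smul hb]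
  have h1 : HasDerivAt (fun s : ℝ => opA lam (S i) + s * opA v (S i)) (opA v (S i)) s := by
    simpa using ((hasDerivAt_id s).mul_const (opA v (S i))).const_add (opA lam (S i))
  refine (((htd.hasDerivAt_deriv _).comp s h1).mul_const (opA v (S i))).congr_deriv ?_
  ring

/-- The properties of a sample on which the curvature of the empirical risk rests: many sample
points carry dual weight at least `τ`, and the dual weights `q` nearly annihilate the predictions of
all weightings of norm up to `R + 2c`. -/
structure IsCurvedSample (H : Set (X → ℝ)) (S : Fin m → X × Bool) (q : X × Bool → ℝ)
    (τ P c R : ℝ) : Prop where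
  nonneg : ∀ z, 0 ≤ q z
  le : ∀ z, q z ≤ P
  mass : τ / 2 ≤ empMean (fun z => if τ ≤ q z then 1 else 0) S
  corr : ∀ lam : Weights H, ‖lam‖ ≤ R + 2 * c →
    |empMean (fun z => opA lam z * q z) S| ≤ c * τ ^ 2 / 8

variable {q : X × Bool → ℝ} {τ P R : ℝ}

theorem cConst_pos (h : LossBds ℓ) (h0 : 0 < ℓ 0) (hτ : 0 < τ) : 0 < cConst ℓ τ P := by
  have := h.deriv_zero_pos
  unfold cConst
  positivity

/-- The two lower bounds on the constant `c` that the analysis uses. -/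
theorem le_cConst (h : LossBds ℓ) (hτ : 0 < τ) :
    P * (ℓ 0 / deriv ℓ 0) ≤ cConst ℓ τ P * τ ^ 2 / 16 ∧
      τ * (ℓ 0 / deriv ℓ 0) ≤ cConst ℓ τ P * τ ^ 2 / 16 := by
  have hd := h.deriv_zero_pos
  have h0 := h.nonneg 0
  have e : cConst ℓ τ P * τ ^ 2 / 16 = ℓ 0 / deriv ℓ 0 * (τ * max 1 (1 / τ)) * max 1 P := by
    unfold cConst; field_simp
  have hx : 0 ≤ ℓ 0 / deriv ℓ 0 := div_nonneg h0 hd.le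
  have h1 : 1 ≤ τ * max 1 (1 / τ) := by
    calc 1 = τ * (1 / τ) := by field_simp
      _ ≤ _ := mul_le_mul_of_nonneg_left (le_max_right _ _) hτ.le
  have h2 : τ ≤ τ * max 1 (1 / τ) := le_mul_of_one_le_right hτ.le (le_max_left _ _)
  have h3 : (1 : ℝ) ≤ max 1 P := le_max_left _ _
  have h4 : P ≤ max 1 P := le_max_right _ _
  rw [e]
  constructor
  · calc P * (ℓ 0 / deriv ℓ 0) ≤ max 1 P * (ℓ 0 / deriv ℓ 0) := by gcongr
      _ = ℓ 0 / deriv ℓ 0 * 1 * max 1 P := by ring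
      _ ≤ _ := by gcongr
  · calc τ * (ℓ 0 / deriv ℓ 0) = ℓ 0 / deriv ℓ 0 * τ * 1 := by ring
      _ ≤ _ := by gcongr

/-- Weightings of small empirical risk make predictions larger than `c` on only few of the points
that carry dual weight: large positive values of `Aλ` cost risk, and large negative ones would have
to be balanced by positive ones, since the dual weights nearly annihilate `Aλ`. -/
theorem IsCurvedSample.bad_mass_lt (hm : 0 < m) (h : LossBds ℓ) (h0 : 0 < ℓ 0) (hτ : 0 < τ)
    (hS : IsCurvedSample H S q τ P (cConst ℓ τ P) R) {lam : Weights H}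
    (hlam : ‖lam‖ ≤ R + 2 * cConst ℓ τ P) (hrisk : empRisk ℓ S lam ≤ ℓ 0) :
    empMean (fun z => if τ ≤ q z ∧ cConst ℓ τ P < |opA lam z| then 1 else 0) S < τ / 4 := by
  set c := cConst ℓ τ P with hc
  have hc0 : 0 < c := cConst_pos h h0 hτ
  have hd := h.deriv_zero_pos
  have hP : 0 ≤ P := by
    obtain ⟨i⟩ : Nonempty (Fin m) := ⟨⟨0, hm⟩⟩
    exact (hS.nonneg (S i)).trans (hS.le _)
  have hm' : (0 : ℝ) < m := by exact_mod_cast hm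
  have hpos : ∀ x : ℝ, deriv ℓ 0 * max x 0 ≤ ℓ x := fun x => by
    rcases le_total x 0 with hx | hx
    · rw [max_eq_right hx, mul_zero]; exact h.nonneg x
    · rw [max_eq_left hx]; have := h.tangent_le 0 x; linarith
  have hplus : empMean (fun z => max (opA lam z) 0) S < ℓ 0 / deriv ℓ 0 := by
    rw [lt_div_iff₀ hd, mul_comm, ← empMean_const_mul]
    by_cases hex : ∃ i, 0 ≤ opA lam (S i)
    · obtain ⟨i, hi⟩ := hex
      refine lt_of_lt_of_le ?_ hrisk
      refine mul_lt_mul_of_pos_left (Finset.sum_lt_sum (fun i _ => hpos _) ⟨i, Finset.mem_univ _, ?_⟩)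
        (by positivity)
      beta_reduce
      rw [max_eq_left hi]; have := h.tangent_le 0 (opA lam (S i)); linarith
    · push Not at hex
      have : empMean (fun z => deriv ℓ 0 * max (opA lam z) 0) S = 0 := by
        unfold empMean
        rw [Finset.sum_eq_zero fun i _ => by beta_reduce; rw [max_eq_right (hex i).le, mul_zero],
          mul_zero]
      rw [this]; exact h0
  have hpt : ∀ z, c * τ * (if τ ≤ q z ∧ c < |opA lam z| then 1 else 0)
      ≤ -1 * (opA lam z * q z) + (P + τ) * max (opA lam z) 0 := fun z => by
    have hq := hS.nonneg z
    have hqP := hS.le z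
    rcases le_total (opA lam z) 0 with hx | hx
    · rw [max_eq_right hx]
      split_ifs with hz
      · rw [abs_of_nonpos hx] at hz
        nlinarith [mul_le_mul hz.2.le hz.1 hτ.le (by linarith)]
      · nlinarith
    · rw [max_eq_left hx]
      split_ifs with hz
      · rw [abs_of_nonneg hx] at hz
        nlinarith [mul_le_mul_of_nonneg_right hz.2.le hτ.le, mul_le_mul_of_nonneg_left hqP hx]
      · nlinarith [mul_le_mul_of_nonneg_left hqP hx, mul_nonneg hτ.le hx]
  have h1 := empMean_le_empMean S hpt
  rw [empMean_const_mul, empMean_add, empMean_const_mul, empMean_const_mul] at h1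
  have h2 := (abs_le.1 (hS.corr lam hlam)).1
  have h3 := mul_lt_mul_of_pos_left hplus (show 0 < P + τ by linarith)
  obtain ⟨h4, h5⟩ := le_cConst (P := P) h hτ
  rw [← hc] at h4 h5
  have h6 : c * τ * empMean (fun z => if τ ≤ q z ∧ c < |opA lam z| then 1 else 0) S
      < c * τ * (τ / 4) := by nlinarith
  exact lt_of_mul_lt_mul_left h6 (by positivity)

/-- Two weightings of small empirical risk both have predictions bounded by `c` at a common sample
point. -/
theorem IsCurvedSample.exists_common (hm : 0 < m) (h : LossBds ℓ) (h0 : 0 < ℓ 0) (hτ : 0 < τ)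
    (hS : IsCurvedSample H S q τ P (cConst ℓ τ P) R) {a b : Weights H}
    (ha : ‖a‖ ≤ R + 2 * cConst ℓ τ P) (hra : empRisk ℓ S a ≤ ℓ 0)
    (hb : ‖b‖ ≤ R + 2 * cConst ℓ τ P) (hrb : empRisk ℓ S b ≤ ℓ 0) :
    ∃ i, |opA a (S i)| ≤ cConst ℓ τ P ∧ |opA b (S i)| ≤ cConst ℓ τ P := by
  by_contra! hne
  have h1 := hS.bad_mass_lt hm h h0 hτ ha hra
  have h2 := hS.bad_mass_lt hm h h0 hτ hb hrb
  have h3 := hS.mass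
  have h4 := empMean_add S
    (fun z => if τ ≤ q z ∧ cConst ℓ τ P < |opA a z| then (1 : ℝ) else 0)
    (fun z => if τ ≤ q z ∧ cConst ℓ τ P < |opA b z| then (1 : ℝ) else 0)
  have h5 : empMean (fun z => if τ ≤ q z then (1 : ℝ) else 0) S ≤ _ :=
    (empMean_mono fun i => ?_).trans_eq h4
  · linarith
  · by_cases hq : τ ≤ q (S i)
    · rcases le_or_gt |opA a (S i)| (cConst ℓ τ P) with hi | hi
      · have := hne i hi
        simp only [hq, this, true_and, if_true]
        split_ifs <;> norm_num
      · simp only [hq, hi, true_and, if_true]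
        split_ifs <;> norm_num
    · simp [hq]

theorem bddBelow_deriv2_image (h : LossBds ℓ) (c : ℝ) :
    BddBelow (deriv (deriv ℓ) '' Icc (-c) c) :=
  ⟨0, by rintro _ ⟨z, -, rfl⟩; exact h.deriv_deriv_nonneg z⟩

theorem B1_nonneg (h : LossBds ℓ) (hτ : 0 < τ) : 0 ≤ B1 ℓ τ P :=
  mul_nonneg (by positivity) (Real.sInf_nonneg (by
    rintro _ ⟨z, -, rfl⟩; exact h.deriv_deriv_nonneg z))

/-- Sample points of total mass at least `τ / 4` have predictions in `[-c, c]`, where `ℓ''` is bounded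
below. -/
theorem IsCurvedSample.two_mul_B1_le (hm : 0 < m) (h : LossBds ℓ) (h0 : 0 < ℓ 0)
    (hτ : 0 < τ) (hS : IsCurvedSample H S q τ P (cConst ℓ τ P) R) {lam : Weights H}
    (hlam : ‖lam‖ ≤ R + 2 * cConst ℓ τ P) (hrisk : empRisk ℓ S lam ≤ ℓ 0) :
    2 * B1 ℓ τ P ≤ empMean (fun z => deriv (deriv ℓ) (opA lam z)) S := by
  set c := cConst ℓ τ P with hc
  set I := sInf (deriv (deriv ℓ) '' Icc (-c) c) with hI
  have hI0 : 0 ≤ I := Real.sInf_nonneg (by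
    rintro _ ⟨z, -, rfl⟩; exact h.deriv_deriv_nonneg z)
  have h1 : 2 * B1 ℓ τ P = I * (τ / 4) := by unfold B1; rw [← hc, ← hI]; ring
  have h2 := hS.bad_mass_lt hm h h0 hτ hlam hrisk
  have h3 := hS.mass
  have hpt : ∀ z, I * (if τ ≤ q z then 1 else 0) ≤
      deriv (deriv ℓ) (opA lam z) + I * (if τ ≤ q z ∧ c < |opA lam z| then 1 else 0) := fun z => by
    have hnn := h.deriv_deriv_nonneg (opA lam z)
    by_cases hq : τ ≤ q z
    · rcases le_or_gt |opA lam z| c with hi | hi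
      · have : I ≤ deriv (deriv ℓ) (opA lam z) :=
          csInf_le (bddBelow_deriv2_image h c) ⟨_, abs_le.1 hi, rfl⟩
        simp only [hq, hi.not_gt, and_false, if_true, if_false]; linarith
      · simp only [hq, hi, and_self, if_true]; linarith
    · simp only [hq, false_and, if_false]; linarith
  have h4 := empMean_le_empMean S hpt
  rw [empMean_const_mul, empMean_add, empMean_const_mul] at h4
  rw [h1]
  nlinarith

end Curvature

/-! ### Step sizes -/

section Steps

/-- The two tangent inequalities at the endpoints for a strongly convex function of one variable. -/
theorem strong_tangent_le {φ D : ℝ → ℝ} (hφ : ∀ s, HasDerivAt φ (D s) s) {α B : ℝ} (hα : 0 ≤ α)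
    (hD : ∀ x ∈ Icc 0 α, ∀ y ∈ Icc 0 α, x ≤ y → 2 * B * (y - x) ≤ D y - D x) :
    φ 0 + D 0 * α + B * α ^ 2 ≤ φ α ∧ φ α - D α * α + B * α ^ 2 ≤ φ 0 := by
  have h0 : (0 : ℝ) ∈ Icc 0 α := ⟨le_rfl, hα⟩
  have h1 : α ∈ Icc 0 α := ⟨hα, le_rfl⟩
  constructor
  · have hd : ∀ s, HasDerivAt (fun s => φ s - D 0 * s - B * s ^ 2) (D s - D 0 - 2 * B * s) s :=
      fun s => (((hφ s).sub ((hasDerivAt_id s).const_mul (D 0))).sub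
        (((hasDerivAt_id s).pow 2).const_mul B)).congr_deriv (by simp; ring)
    have hm : MonotoneOn (fun s => φ s - D 0 * s - B * s ^ 2) (Icc 0 α) := by
      refine monotoneOn_of_deriv_nonneg (convex_Icc _ _)
        (fun s _ => (hd s).continuousAt.continuousWithinAt)
        (fun s _ => (hd s).differentiableAt.differentiableWithinAt) fun s hs => ?_
      rw [interior_Icc] at hs
      rw [(hd s).deriv]
      have := hD 0 h0 s ⟨hs.1.le, hs.2.le⟩ hs.1.le
      linarith
    have := hm h0 h1 hα
    simp only at this
    linarith
  · have hd : ∀ s, HasDerivAt (fun s => φ s - D α * s - B * (α - s) ^ 2)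
        (D s - D α + 2 * B * (α - s)) s :=
      fun s => (((hφ s).sub ((hasDerivAt_id s).const_mul (D α))).sub
        ((((hasDerivAt_id s).const_sub α).pow 2).const_mul B)).congr_deriv (by simp; ring)
    have hm : AntitoneOn (fun s => φ s - D α * s - B * (α - s) ^ 2) (Icc 0 α) := by
      refine antitoneOn_of_deriv_nonpos (convex_Icc _ _)
        (fun s _ => (hd s).continuousAt.continuousWithinAt)
        (fun s _ => (hd s).differentiableAt.differentiableWithinAt) fun s hs => ?_
      rw [interior_Icc] at hs
      rw [(hd s).deriv]
      have := hD s ⟨hs.1.le, hs.2.le⟩ α h1 hs.2.le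
      linarith
    have := hm h0 h1 hα
    simp only at this
    linarith

end Steps

section Progress
variable {X : Type u} {H : Set (X → ℝ)} {ℓ : ℝ → ℝ} {m : ℕ} {S : Fin m → X × Bool}

theorem empGrad_line_le (h : LossBds ℓ) (hb : IsBinary H) (hm : 0 < m) (lam v : Weights H)
    (hv : ∀ z, opA v z ^ 2 = 1) {x y : ℝ} (hxy : x ≤ y) :
    empGrad ℓ S (lam + x • v) v ≤ empGrad ℓ S (lam + y • v) v ∧
    empGrad ℓ S (lam + y • v) v ≤ empGrad ℓ S (lam + x • v) v + gradLipConst ℓ * (y - x) := by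
  have hpt : ∀ z, deriv ℓ (opA (lam + x • v) z) * opA v z ≤ deriv ℓ (opA (lam + y • v) z) * opA v z
      ∧ deriv ℓ (opA (lam + y • v) z) * opA v z
        ≤ deriv ℓ (opA (lam + x • v) z) * opA v z + gradLipConst ℓ * (y - x) := fun z => by
    rw [opA_add_smul hb, opA_add_smul hb]
    rcases sq_eq_sq_iff_eq_or_eq_neg.1 ((hv z).trans (one_pow 2).symm) with e | e
    · rw [e]
      have h1 := h.deriv_mono (show opA lam z + x * 1 ≤ opA lam z + y * 1 by linarith)
      have h2 := h.deriv_sub_le (show opA lam z + x * 1 ≤ opA lam z + y * 1 by linarith)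
      constructor <;> linarith
    · rw [e]
      have h1 := h.deriv_mono (show opA lam z + y * -1 ≤ opA lam z + x * -1 by linarith)
      have h2 := h.deriv_sub_le (show opA lam z + y * -1 ≤ opA lam z + x * -1 by linarith)
      constructor <;> linarith
  rw [empGrad_eq, empGrad_eq]
  refine ⟨empMean_le_empMean S fun z => (hpt z).1, ?_⟩
  refine (empMean_le_empMean S fun z => (hpt z).2).trans_eq ?_
  rw [empMean_add]
  congr 1
  have : (m : ℝ) ≠ 0 := by positivity
  simp [empMean, this]

theorem abs_empGrad_le (h : LossBds ℓ) (hb : IsBinary H) (lam : Weights H) (k : H) :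
    |empGrad ℓ S lam (unitWeight k)| ≤ lipConst ℓ :=
  abs_empMean_le (f := fun z => deriv ℓ (opA lam z) * opA (unitWeight k) z) h.lipConst_pos.le
    (fun z => by
    rw [abs_mul, hb.abs_opA_unitWeight, mul_one, abs_of_nonneg (h.deriv_nonneg _)]
    exact h.deriv_le _) S

theorem gradSup_nonneg (lam : Weights H) : 0 ≤ gradSup ℓ S lam :=
  Real.iSup_nonneg fun _ => abs_nonneg _

/-- A linear functional of the predictions `Aλ` on a sample is bounded by its values at unit
weightings. -/
theorem abs_sum_mul_opA_le (hb : IsBinary H) (w : Fin m → ℝ) {C : ℝ} (hC0 : 0 ≤ C)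
    (hC : ∀ k : H, |∑ i, w i * opA (unitWeight k) (S i)| ≤ C) (v : Weights H) :
    |∑ i, w i * opA v (S i)| ≤ C * ‖v‖ := by
  have hcont : Continuous fun v : Weights H => ∑ i, w i * opA v (S i) :=
    continuous_finsetSum _ fun i _ => continuous_const.mul (continuous_opA hb _)
  obtain ⟨s, hs⟩ := Weights.exists_seq_trunc v
  refine le_of_tendsto ((hcont.tendsto v).comp hs).abs (Eventually.of_forall fun n => ?_)
  have e : ∑ i, w i * opA (Weights.trunc v (s n)) (S i)
      = ∑ k ∈ s n, v k * ∑ i, w i * opA (unitWeight k) (S i) := by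
    have : ∀ z, opA (Weights.trunc v (s n)) z = ∑ k ∈ s n, v k * opA (unitWeight k) z := fun z => by
      rw [opA_eq, opH_trunc hb, Finset.mul_sum]
      refine Finset.sum_congr rfl fun k _ => ?_
      rw [opA_unitWeight]; ring
    simp_rw [this, Finset.mul_sum]
    rw [Finset.sum_comm]
    refine Finset.sum_congr rfl fun k _ => Finset.sum_congr rfl fun i _ => ?_
    ring
  simp only [Function.comp_apply]
  rw [e]
  calc _ ≤ ∑ k ∈ s n, |v k| * C :=
        (Finset.abs_sum_le_sum_abs _ _).trans (Finset.sum_le_sum fun k _ => by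
          rw [abs_mul]
          exact mul_le_mul_of_nonneg_left (hC k) (abs_nonneg _))
    _ = C * ∑ k ∈ s n, |v k| := by rw [← Finset.sum_mul, mul_comm]
    _ ≤ _ := mul_le_mul_of_nonneg_left (Weights.sum_abs_le v _) hC0

theorem empMean_mul_opA_eq (w : X × Bool → ℝ) (v : Weights H) :
    empMean (fun z => w z * opA v z) S = ∑ i, (1 / (m : ℝ)) * w (S i) * opA v (S i) := by
  simp only [empMean, Finset.mul_sum, mul_assoc]

/-- Hölder's inequality for the gradient and a weighting. -/
theorem abs_empGrad_le_gradSup (h : LossBds ℓ) (hb : IsBinary H) (lam v : Weights H) :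
    |empGrad ℓ S lam v| ≤ gradSup ℓ S lam * ‖v‖ := by
  have hbdd : BddAbove (range fun k : H => |empGrad ℓ S lam (unitWeight k)|) :=
    ⟨lipConst ℓ, by rintro _ ⟨k, rfl⟩; exact abs_empGrad_le h hb lam k⟩
  rw [empGrad_eq, empMean_mul_opA_eq (fun z => deriv ℓ (opA lam z))]
  refine abs_sum_mul_opA_le hb _ (gradSup_nonneg _) (fun k => ?_) v
  rw [← empMean_mul_opA_eq (fun z => deriv ℓ (opA lam z))]
  exact le_ciSup hbdd k

theorem empRisk_add_empGrad_le (h : LossBds ℓ) (hb : IsBinary H) (a b : Weights H) :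
    empRisk ℓ S a + empGrad ℓ S a (b - a) ≤ empRisk ℓ S b := by
  rw [empRisk_eq, empGrad_eq, ← empMean_add, empRisk_eq]
  refine empMean_le_empMean S fun z => ?_
  rw [opA_sub hb]
  exact h.tangent_le _ _

variable {q : X × Bool → ℝ} {τ P R : ℝ}

/-- A step that does not increase the empirical risk has length at most `2c`, and the empirical risk
is strongly convex along it. -/
theorem IsCurvedSample.step_le (hm : 0 < m) (h : LossBds ℓ) (htd : LossTd ℓ)
    (hb : IsBinary H) (h0 : 0 < ℓ 0) (hτ : 0 < τ)
    (hS : IsCurvedSample H S q τ P (cConst ℓ τ P) R) {lam v : Weights H}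
    (hlam : ‖lam‖ < R) (hrisk : empRisk ℓ S lam ≤ ℓ 0) (hv1 : ‖v‖ = 1)
    (hv : ∀ z, opA v z ^ 2 = 1) {α : ℝ}
    (hd : empRisk ℓ S (lam + α • v) ≤ empRisk ℓ S lam) :
    ∀ x ∈ Icc 0 α, ∀ y ∈ Icc 0 α, x ≤ y → 2 * B1 ℓ τ P * (y - x)
      ≤ empGrad ℓ S (lam + y • v) v - empGrad ℓ S (lam + x • v) v := by
  set c := cConst ℓ τ P with hc
  have hc0 : 0 < c := cConst_pos h h0 hτ
  have hφ := hasDerivAt_empRisk_line h hb S lam v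
  have hseg : ∀ s ∈ Icc 0 α, empRisk ℓ S (lam + s • v) ≤ ℓ 0 := fun s hs => by
    have hconv : ConvexOn ℝ univ fun s : ℝ => empRisk ℓ S (lam + s • v) := by
      refine MonotoneOn.convexOn_of_deriv convex_univ
        (fun s _ => (hφ s).continuousAt.continuousWithinAt)
        (fun s _ => (hφ s).differentiableAt.differentiableWithinAt) ?_
      intro x _ y _ hxy
      rw [(hφ x).deriv, (hφ y).deriv]
      exact (empGrad_line_le h hb hm lam v hv hxy).1
    have h1 := hconv.le_max_of_mem_Icc (mem_univ 0) (mem_univ α) hs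
    simp only [zero_smul, add_zero] at h1
    exact h1.trans (max_le hrisk (hd.trans hrisk))
  have hnorm : ∀ s : ℝ, 0 ≤ s → ‖lam + s • v‖ ≤ ‖lam‖ + s := fun s hs => by
    refine (norm_add_le _ _).trans_eq ?_
    rw [norm_smul, hv1, Real.norm_of_nonneg hs, mul_one]
  have hα2 : α ≤ 2 * c := by
    by_contra! hlt
    set s := min α (2 * c + (R - ‖lam‖)) with hs
    have hs2 : 2 * c < s := lt_min hlt (by linarith)
    have hs0 : 0 ≤ s := by linarith
    obtain ⟨i, hi1, hi2⟩ := hS.exists_common hm h h0 hτ (a := lam) (b := lam + s • v)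
      (by linarith) hrisk
      ((hnorm s hs0).trans (by have := min_le_right α (2 * c + (R - ‖lam‖)); linarith))
      (hseg s ⟨hs0, min_le_left _ _⟩)
    rw [opA_add_smul hb] at hi2
    have h3 : |s * opA v (S i)| = s := by
      rw [abs_mul, abs_of_nonneg hs0, ← Real.sqrt_sq_eq_abs, hv, Real.sqrt_one, mul_one]
    have h4 := abs_sub (opA lam (S i) + s * opA v (S i)) (opA lam (S i))
    rw [add_sub_cancel_left, h3] at h4
    linarith
  have hdd := hasDerivAt_empGrad_line htd hb S lam v
  intro x hx y hy hxy
  refine Convex.mul_sub_le_image_sub_of_le_deriv (convex_Icc 0 α)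
    (fun s _ => (hdd s).continuousAt.continuousWithinAt)
    (fun s _ => (hdd s).differentiableAt.differentiableWithinAt) (fun s hs => ?_) x hx y hy hxy
  have hs' := interior_subset hs
  rw [(hdd s).deriv]
  simp only [hv, mul_one]
  exact hS.two_mul_B1_le hm h h0 hτ ((hnorm s hs'.1).trans (by linarith [hs'.2])) (hseg s hs')

/-- A step that every optimal step exceeds goes downhill up to its end: otherwise the minimizer of the
empirical risk over the step would, by convexity, be an optimal step. -/
theorem empGrad_step_nonpos (h : LossBds ℓ) (hb : IsBinary H) (hm : 0 < m) {lam v : Weights H}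
    (hv : ∀ z, opA v z ^ 2 = 1) {α : ℝ} (hα : 0 ≤ α)
    (hopt : ∀ β, IsOptStep ℓ S lam v β → α < β) : empGrad ℓ S (lam + α • v) v ≤ 0 := by
  by_contra! hpos
  have hφ := hasDerivAt_empRisk_line h hb S lam v
  have hcont : Continuous fun s : ℝ => empRisk ℓ S (lam + s • v) :=
    continuous_iff_continuousAt.2 fun s => (hφ s).continuousAt
  obtain ⟨β, hβ, hmin⟩ := isCompact_Icc.exists_isMinOn (nonempty_Icc.2 hα) hcont.continuousOn
  refine (hopt β ⟨hβ.1, fun s hs => ?_⟩).not_ge hβ.2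
  rcases le_total s α with hsα | hsα
  · exact hmin ⟨hs, hsα⟩
  · have hmono : MonotoneOn (fun s : ℝ => empRisk ℓ S (lam + s • v)) (Ici α) := by
      refine monotoneOn_of_deriv_nonneg (convex_Ici α) hcont.continuousOn
        (fun s _ => (hφ s).differentiableAt.differentiableWithinAt) fun s hs => ?_
      rw [(hφ s).deriv]
      rw [interior_Ici] at hs
      exact hpos.le.trans (empGrad_line_le h hb hm lam v hv (le_of_lt hs)).1
    exact (hmin ⟨hα, le_rfl⟩).trans (hmono self_mem_Ici hsα hsα)

/-- Progress made by a round of the algorithm, in terms of the length of its step. -/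
theorem IsCurvedSample.round_progress (hm : 0 < m) (h : LossBds ℓ) (htd : LossTd ℓ)
    (hb : IsBinary H) (h0 : 0 < ℓ 0) (hτ : 0 < τ) (hτ1 : τ ≤ 1)
    (hS : IsCurvedSample H S q τ P (cConst ℓ τ P) R) {lam lam' : Weights H}
    (hlam : ‖lam‖ < R) (hrisk : empRisk ℓ S lam ≤ ℓ 0) {ρ : ℝ} (hρ : 0 < ρ)
    (hround : IsRound ℓ S ρ lam lam') :
    ∃ α : ℝ, 0 ≤ α ∧ ‖lam'‖ ≤ ‖lam‖ + α ∧
      B1 ℓ τ P / 2 * α ^ 2 ≤ empRisk ℓ S lam - empRisk ℓ S lam' ∧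
      B1 ℓ τ P / (2 * gradLipConst ℓ) * (ρ * gradSup ℓ S lam) * α
        ≤ empRisk ℓ S lam - empRisk ℓ S lam' ∧
      ρ * gradSup ℓ S lam / (2 * gradLipConst ℓ) ≤ α := by
  obtain ⟨k, v, α, -, hvk, hg, -, hstep, rfl⟩ := hround
  have hv1 : ‖v‖ = 1 := by
    rcases hvk with rfl | rfl
    · exact norm_unitWeight k
    · rw [norm_neg, norm_unitWeight]
  have hv : ∀ z, opA v z ^ 2 = 1 := fun z => by
    rcases hvk with rfl | rfl
    · exact hb.opA_unitWeight_sq k z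
    · rw [opA_neg, neg_sq, hb.opA_unitWeight_sq]
  set B := B1 ℓ τ P with hB
  set B2 := gradLipConst ℓ with hB2
  have hB0 : 0 ≤ B := B1_nonneg h hτ
  have hB20 : 0 < B2 := h.gradLipConst_pos
  have hc0 := cConst_pos (P := P) h h0 hτ
  have hBB : B ≤ B2 / 8 := by
    have h1 : sInf (deriv (deriv ℓ) '' Icc (-cConst ℓ τ P) (cConst ℓ τ P)) ≤ B2 :=
      (csInf_le (bddBelow_deriv2_image h _) ⟨0, ⟨by linarith, hc0.le⟩, rfl⟩).trans
        (h.deriv_deriv_le htd 0)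
    rw [hB, B1]
    nlinarith
  set g := -empGrad ℓ S lam v with hgdef
  set G := ρ * gradSup ℓ S lam with hG
  have hgG : G ≤ g := by rw [hgdef]; linarith
  have hG0 : 0 ≤ G := mul_nonneg hρ.le (gradSup_nonneg _)
  have hφ := hasDerivAt_empRisk_line h hb S lam v
  have hz : lam + (0 : ℝ) • v = lam := by rw [zero_smul, add_zero]
  have hlip : ∀ α : ℝ, 0 ≤ α → empGrad ℓ S (lam + α • v) v ≤ -g + B2 * α := fun α hα => by
    have := (empGrad_line_le h hb hm (S := S) lam v hv hα).2
    rw [hz, sub_zero] at this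
    linarith
  have hstrong : 0 ≤ α → empRisk ℓ S (lam + α • v) ≤ empRisk ℓ S lam →
      empRisk ℓ S lam - g * α + B * α ^ 2 ≤ empRisk ℓ S (lam + α • v) ∧
      empRisk ℓ S (lam + α • v) - empGrad ℓ S (lam + α • v) v * α + B * α ^ 2
        ≤ empRisk ℓ S lam := fun hα hd => by
    have h1 := strong_tangent_le hφ hα
      (hS.step_le hm h htd hb h0 hτ hlam hrisk hv1 hv hd)
    rw [hz] at h1
    exact ⟨by linarith [h1.1], h1.2⟩
  have hnorm : 0 ≤ α → ‖lam + α • v‖ ≤ ‖lam‖ + α := fun hα => by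
    refine (norm_add_le _ _).trans_eq ?_
    rw [norm_smul, hv1, Real.norm_of_nonneg hα, mul_one]
  -- A step that is downhill up to its end and no shorter than the minimizer of the quadratic bound.
  have hdown : 0 ≤ α → g ≤ B2 * α → empGrad ℓ S (lam + α • v) v ≤ 0 →
      empRisk ℓ S (lam + α • v) ≤ empRisk ℓ S lam →
      B / 2 * α ^ 2 ≤ empRisk ℓ S lam - empRisk ℓ S (lam + α • v) ∧
      B / (2 * B2) * G * α ≤ empRisk ℓ S lam - empRisk ℓ S (lam + α • v) ∧
      G / (2 * B2) ≤ α := fun hα hgα hD hd => by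
    have h1 := (hstrong hα hd).2
    have h2 : 0 ≤ -empGrad ℓ S (lam + α • v) v * α := mul_nonneg (by linarith) hα
    have h3 : 0 ≤ B * α ^ 2 := by positivity
    have h4 : G / (2 * B2) ≤ α / 2 := by
      rw [div_le_div_iff₀ (by positivity) two_pos]; linarith
    refine ⟨by linarith, ?_, by linarith⟩
    calc B / (2 * B2) * G * α = B * α * (G / (2 * B2)) := by ring
      _ ≤ B * α * (α / 2) := by gcongr
      _ ≤ _ := by linarith
  refine ⟨α, ?_⟩
  rcases hstep with hopt | ⟨hlow, hopt⟩ | ⟨hα, hw1, hw2⟩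
  · have hα := hopt.1
    refine ⟨hα, hnorm hα, ?_⟩
    have hd := hopt.2 0 le_rfl
    rw [hz] at hd
    -- The derivative is nonnegative at the minimizer, and vanishes if the minimizer is interior.
    have hDnn : 0 ≤ empGrad ℓ S (lam + α • v) v := by
      have hsl := (hφ α).tendsto_slope.mono_left
        (nhdsWithin_mono α fun (s : ℝ) (hs : s ∈ Ioi α) => ne_of_gt hs)
      refine ge_of_tendsto hsl ?_
      filter_upwards [self_mem_nhdsWithin] with s hs
      rw [slope_def_field]
      exact div_nonneg (sub_nonneg.2 (hopt.2 s (hα.trans (le_of_lt hs))))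
        (sub_nonneg.2 (le_of_lt hs))
    have hgα : g ≤ B2 * α := by linarith [hlip α hα]
    rcases hα.eq_or_lt with rfl | hαp
    · have : empGrad ℓ S (lam + (0 : ℝ) • v) v ≤ 0 := by rw [hz]; linarith
      exact hdown hα hgα this hd
    · have hD0 : empGrad ℓ S (lam + α • v) v = 0 := by
        have hloc : IsLocalMin (fun s : ℝ => empRisk ℓ S (lam + s • v)) α := by
          filter_upwards [lt_mem_nhds hαp] with s hs using hopt.2 s hs.le
        exact hloc.hasDerivAt_eq_zero (hφ α)
      exact hdown hα hgα hD0.le hd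
  · have hgα : g ≤ B2 * α := by
      have : g / B2 ≤ α := hlow
      rwa [div_le_iff₀ hB20, mul_comm] at this
    have hα : 0 ≤ α := nonneg_of_mul_nonneg_right (show 0 ≤ B2 * α by linarith) hB20
    have hD := empGrad_step_nonpos h hb hm hv hα hopt
    refine ⟨hα, hnorm hα, hdown hα hgα hD ?_⟩
    have hanti : AntitoneOn (fun s : ℝ => empRisk ℓ S (lam + s • v)) (Iic α) := by
      refine antitoneOn_of_deriv_nonpos (convex_Iic α)
        (fun s _ => (hφ s).continuousAt.continuousWithinAt)
        (fun s _ => (hφ s).differentiableAt.differentiableWithinAt) fun s hs => ?_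
      rw [(hφ s).deriv]
      rw [interior_Iic] at hs
      exact (empGrad_line_le h hb hm lam v hv (le_of_lt hs)).1.trans hD
    have := hanti (mem_Iic.2 hα) self_mem_Iic hα
    simpa only [hz] using this
  · refine ⟨hα, hnorm hα, ?_⟩
    have hgα : 0 ≤ g * α := mul_nonneg (hG0.trans hgG) hα
    have hd : g * α / 3 ≤ empRisk ℓ S lam - empRisk ℓ S (lam + α • v) := by
      rw [hgdef]; linarith
    have h1 := (hstrong hα (by linarith)).1
    have h2 : g / 2 ≤ B2 * α := by linarith [hlip α hα]
    refine ⟨by nlinarith, ?_, ?_⟩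
    · have h3 : B / (2 * B2) ≤ 1 / 16 := by
        rw [div_le_div_iff₀ (by positivity) (by norm_num)]; linarith
      calc B / (2 * B2) * G * α ≤ 1 / 16 * g * α :=
            mul_le_mul_of_nonneg_right (mul_le_mul h3 hgG hG0 (by norm_num)) hα
        _ ≤ _ := by linarith
    · rw [div_le_iff₀ (by positivity)]; linarith

end Progress

/-! ### Convergence of the empirical risk -/

section Convergence
variable {X : Type u} {H : Set (X → ℝ)} {ℓ : ℝ → ℝ} {m : ℕ} {S : Fin m → X × Bool}

/-- Turns the contraction of the excess risk in one round, a factor `1 - p α / u` with `u` a bound on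
the norms and `α` the step length, into a power of a ratio that telescopes. -/
theorem one_sub_mul_div_le_rpow {u α p : ℝ} (hu : 0 < u) (hα : 0 ≤ α) (hp : 0 ≤ p) :
    1 - p * α / u ≤ (u / (u + α)) ^ p := by
  have hx : 0 < u / (u + α) := by positivity
  have h1 := Real.one_sub_inv_le_log_of_pos hx
  rw [Real.rpow_def_of_pos hx]
  have h2 := Real.add_one_le_exp (Real.log (u / (u + α)) * p)
  have h3 : 1 - (u / (u + α))⁻¹ = -(α / u) := by field_simp; ring
  rw [h3] at h1
  have h4 := mul_le_mul_of_nonneg_right h1 hp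
  calc 1 - p * α / u = -(α / u) * p + 1 := by ring
    _ ≤ _ := by linarith

/-- The factor `16 / 25` is at least `√(2 / 5)`, where `5` is the lower bound of the maximum in the
definition of `R_i`. -/
theorem sqrt_mul_le_normBound (h0 : 0 ≤ ℓ 0) {ρ τ P : ℝ} (hρ : 0 < ρ) (hB : 0 < B1 ℓ τ P) (i : ℕ) :
    √(2 * ℓ 0 * i / B1 ℓ τ P) ≤ 16 / 25 * ρ * normBound ℓ ρ τ P i := by
  set M := max 5 (2 * B1 ℓ τ P / gradLipConst ℓ) with hM
  have hM5 : 5 ≤ M := le_max_left _ _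
  refine Real.sqrt_le_iff.2 ⟨by unfold normBound; positivity, ?_⟩
  rw [mul_pow, normBound, mul_pow √(i : ℝ), Real.sq_sqrt (Nat.cast_nonneg i), ← hM,
    Real.sq_sqrt (by positivity)]
  have e : (16 / 25 * ρ) ^ 2 * (i * (ℓ 0 * M / (ρ ^ 2 * B1 ℓ τ P)))
      = (256 / 625 * M) * (ℓ 0 * i / B1 ℓ τ P) := by field_simp; ring
  have e2 : 2 * ℓ 0 * i / B1 ℓ τ P = 2 * (ℓ 0 * i / B1 ℓ τ P) := by ring
  rw [e, e2]
  exact mul_le_mul_of_nonneg_right (by linarith) (by positivity)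

theorem normBound_nonneg (ρ τ P : ℝ) (i : ℕ) : 0 ≤ normBound ℓ ρ τ P i := by
  unfold normBound; positivity

theorem normBound_eq (ρ τ P : ℝ) (i : ℕ) :
    normBound ℓ ρ τ P i = √(i : ℝ) * normBound ℓ ρ τ P 1 := by
  unfold normBound; simp

theorem normBound_pos (h0 : 0 < ℓ 0) {ρ τ P : ℝ} (hρ : 0 < ρ) (hB : 0 < B1 ℓ τ P) {i : ℕ}
    (hi : 0 < i) : 0 < normBound ℓ ρ τ P i := by
  have : 0 < max 5 (2 * B1 ℓ τ P / gradLipConst ℓ) := lt_max_of_lt_left (by norm_num)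
  unfold normBound
  positivity

theorem normBound_mono {ρ τ P : ℝ} {i j : ℕ} (hij : i ≤ j) :
    normBound ℓ ρ τ P i ≤ normBound ℓ ρ τ P j := by
  unfold normBound
  gcongr

variable {q : X × Bool → ℝ} {τ P ρ : ℝ} {t T : ℕ} {lam : ℕ → Weights H}

/-- Step lengths along a run: they control the norms of the iterates, and their squares are summable
with a bound that makes the norms grow like the square root of the number of rounds. -/
theorem IsCurvedSample.exists_steps (hm : 0 < m) (h : LossBds ℓ) (htd : LossTd ℓ)
    (hb : IsBinary H) (h0 : 0 < ℓ 0) (hτ : 0 < τ) (hτ1 : τ ≤ 1) (hρ : 0 < ρ) (hρ1 : ρ < 1)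
    (hB : 0 < B1 ℓ τ P) (ht : 0 < t)
    (hS : IsCurvedSample H S q τ P (cConst ℓ τ P) (normBound ℓ ρ τ P t))
    (hrun : IsRun ℓ S ρ T lam) (htT : t ≤ T) :
    ∃ α : ℕ → ℝ, (∀ i < t, 0 ≤ α i ∧
        B1 ℓ τ P / (2 * gradLipConst ℓ) * (ρ * gradSup ℓ S (lam i)) * α i
          ≤ empRisk ℓ S (lam i) - empRisk ℓ S (lam (i + 1)) ∧
        ρ * gradSup ℓ S (lam i) / (2 * gradLipConst ℓ) ≤ α i) ∧
      ∀ i ≤ t, ‖lam i‖ ≤ ∑ j ∈ Finset.range i, α j ∧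
        ∑ j ∈ Finset.range i, α j ≤ 16 / 25 * normBound ℓ ρ τ P i := by
  set R := normBound ℓ ρ τ P t with hR
  have hRpos : 0 < R := normBound_pos h0 hρ hB ht
  have hstep : ∀ i, ∃ α : ℝ, i < T → ‖lam i‖ < R → empRisk ℓ S (lam i) ≤ ℓ 0 →
      0 ≤ α ∧ ‖lam (i + 1)‖ ≤ ‖lam i‖ + α ∧
      B1 ℓ τ P / 2 * α ^ 2 ≤ empRisk ℓ S (lam i) - empRisk ℓ S (lam (i + 1)) ∧
      B1 ℓ τ P / (2 * gradLipConst ℓ) * (ρ * gradSup ℓ S (lam i)) * α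
        ≤ empRisk ℓ S (lam i) - empRisk ℓ S (lam (i + 1)) ∧
      ρ * gradSup ℓ S (lam i) / (2 * gradLipConst ℓ) ≤ α := fun i => by
    by_cases hi : i < T ∧ ‖lam i‖ < R ∧ empRisk ℓ S (lam i) ≤ ℓ 0
    · obtain ⟨α, hα⟩ := hS.round_progress hm h htd hb h0 hτ hτ1 hi.2.1 hi.2.2 hρ (hrun.2 i hi.1)
      exact ⟨α, fun _ _ _ => hα⟩
    · exact ⟨0, fun h1 h2 h3 => absurd ⟨h1, h2, h3⟩ hi⟩
  choose α hα using hstep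
  have hmain : ∀ i ≤ t, ‖lam i‖ ≤ ∑ j ∈ Finset.range i, α j ∧ empRisk ℓ S (lam i) ≤ ℓ 0 ∧
      B1 ℓ τ P / 2 * ∑ j ∈ Finset.range i, α j ^ 2 ≤ ℓ 0 - empRisk ℓ S (lam i) ∧
      ∑ j ∈ Finset.range i, α j ≤ 16 / 25 * normBound ℓ ρ τ P i ∧ ‖lam i‖ < R := by
    intro i
    induction i with
    | zero =>
      intro _
      rw [hrun.1, empRisk_zero hm]
      simpa [hRpos] using normBound_nonneg ρ τ P 0
    | succ i ih =>
      intro hi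
      obtain ⟨h1, h2, h3, -, h5⟩ := ih (by omega)
      obtain ⟨a1, a2, a3, -, -⟩ := hα i (by omega) h5 h2
      have b1 : B1 ℓ τ P / 2 * ∑ j ∈ Finset.range (i + 1), α j ^ 2
          ≤ ℓ 0 - empRisk ℓ S (lam (i + 1)) := by
        rw [Finset.sum_range_succ, mul_add]; linarith
      have b0 : 0 ≤ empRisk ℓ S (lam (i + 1)) := empMean_nonneg fun _ => h.nonneg _
      have b2 : ‖lam (i + 1)‖ ≤ ∑ j ∈ Finset.range (i + 1), α j := by
        rw [Finset.sum_range_succ]; linarith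
      have b3 : ∑ j ∈ Finset.range (i + 1), α j ≤ 16 / 25 * ρ * normBound ℓ ρ τ P (i + 1) := by
        refine (Real.le_sqrt_of_sq_le ?_).trans (sqrt_mul_le_normBound h0.le hρ hB (i + 1))
        have hcs := sq_sum_le_card_mul_sum_sq (s := Finset.range (i + 1)) (f := α)
        rw [Finset.card_range] at hcs
        refine hcs.trans ?_
        have b4 : ∑ j ∈ Finset.range (i + 1), α j ^ 2 ≤ 2 * ℓ 0 / B1 ℓ τ P := by
          rw [le_div_iff₀ hB]; linarith
        calc _ ≤ ((i + 1 : ℕ) : ℝ) * (2 * ℓ 0 / B1 ℓ τ P) :=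
              mul_le_mul_of_nonneg_left b4 (Nat.cast_nonneg _)
          _ = _ := by ring
      have b5 : ∑ j ∈ Finset.range (i + 1), α j ≤ 16 / 25 * normBound ℓ ρ τ P (i + 1) := by
        have := normBound_nonneg (ℓ := ℓ) ρ τ P (i + 1)
        nlinarith
      have b6 : 0 ≤ B1 ℓ τ P / 2 * α i ^ 2 := by positivity
      refine ⟨b2, by linarith, b1, b5, ?_⟩
      have := normBound_mono (ℓ := ℓ) (ρ := ρ) (τ := τ) (P := P) hi
      linarith
  refine ⟨α, fun i hi => ?_, fun i hi => ⟨(hmain i hi).1, (hmain i hi).2.2.2.1⟩⟩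
  obtain ⟨-, h2, -, -, h5⟩ := hmain i hi.le
  obtain ⟨a1, -, -, a4, a5⟩ := hα i (by omega) h5 h2
  exact ⟨a1, a4, a5⟩

/-- The empirical risk of an iterate against a comparator: as long as the excess risk stays above
`0.9 t ^ (-1/4)`, every step is long enough for the norms to grow, and the excess contracts by a
power of the ratio of consecutive norms. -/
theorem IsCurvedSample.empRisk_run_le (hm : 0 < m) (h : LossBds ℓ) (htd : LossTd ℓ)
    (hb : IsBinary H) (h0 : 0 < ℓ 0) (hτ : 0 < τ) (hτ1 : τ ≤ 1) (hρ : 0 < ρ) (hρ1 : ρ < 1)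
    (hB : 0 < B1 ℓ τ P) (ht : 0 < t)
    (hS : IsCurvedSample H S q τ P (cConst ℓ τ P) (normBound ℓ ρ τ P t))
    (hrun : IsRun ℓ S ρ T lam) (htT : t ≤ T) (lb : Weights H)
    (hlb : ‖lb‖ ≤ normBound ℓ ρ τ P t) :
    ‖lam t‖ ≤ 16 / 25 * normBound ℓ ρ τ P t ∧
    empRisk ℓ S (lam t) ≤ empRisk ℓ S lb + 9 / 10 * (t : ℝ) ^ (-(1 / 4) : ℝ)
      + ℓ 0 *
        (‖lb‖ / (‖lb‖ + ρ * (t : ℝ) ^ (1 / 4 : ℝ) /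
          (4 * gradLipConst ℓ * normBound ℓ ρ τ P 1)))
        ^ (ρ ^ 3 * B1 ℓ τ P / (9 * gradLipConst ℓ)) := by
  obtain ⟨α, hα, hnorm⟩ := hS.exists_steps hm h htd hb h0 hτ hτ1 hρ hρ1 hB ht hrun htT
  refine ⟨(hnorm t le_rfl).1.trans (hnorm t le_rfl).2, ?_⟩
  set B := B1 ℓ τ P with hBdef
  set B2 := gradLipConst ℓ with hB2
  have hB20 : 0 < B2 := h.gradLipConst_pos
  set N := ‖lb‖ with hN
  have hN0 : 0 ≤ N := norm_nonneg _
  set R1 := normBound ℓ ρ τ P 1 with hR1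
  have hR1pos : 0 < R1 := normBound_pos h0 hρ hB one_pos
  set x := (t : ℝ) ^ (1 / 4 : ℝ) with hx
  have htpos : (0 : ℝ) < t := by exact_mod_cast ht
  have hx0 : 0 < x := Real.rpow_pos_of_pos htpos _
  have hxt : x ^ 4 = t := by
    rw [hx, ← Real.rpow_natCast, ← Real.rpow_mul htpos.le]; norm_num
  have hsq : √(t : ℝ) = x ^ 2 := by
    rw [← hxt, show x ^ 4 = (x ^ 2) ^ 2 by ring, Real.sqrt_sq (by positivity)]
  have hxinv : (t : ℝ) ^ (-(1 / 4) : ℝ) = x⁻¹ := Real.rpow_neg htpos.le _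
  rw [hxinv]
  set s : ℕ → ℝ := fun i => ∑ j ∈ Finset.range i, α j with hs
  set ε : ℕ → ℝ := fun i => empRisk ℓ S (lam i) - empRisk ℓ S lb with hε
  have hs0 : ∀ i ≤ t, 0 ≤ s i := fun i hi =>
    Finset.sum_nonneg fun j hj => (hα j ((Finset.mem_range.1 hj).trans_le hi)).1
  set p := B / (2 * B2) * ρ with hp
  have hp0 : 0 < p := by positivity
  set κ := ρ * x / (4 * B2 * R1) with hκ
  have hκ0 : 0 < κ := by positivity
  have hlast : 0 ≤ ℓ 0 * (N / (N + κ)) ^ (ρ ^ 3 * B / (9 * B2)) := by positivity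
  by_cases hcase : ε t ≤ 9 / 10 * x⁻¹
  · have : empRisk ℓ S (lam t) - empRisk ℓ S lb ≤ 9 / 10 * x⁻¹ := hcase
    linarith
  push Not at hcase
  have hanti : ∀ i, i ≤ t → ε t ≤ ε i := by
    intro i hi
    induction hi using Nat.decreasingInduction with
    | of_succ i hi ih =>
      have h1 := hα i (by omega)
      have h2 : 0 ≤ B / (2 * B2) * (ρ * gradSup ℓ S (lam i)) * α i := by
        have := h1.1
        have := gradSup_nonneg (ℓ := ℓ) (S := S) (lam i)
        positivity
      have : ε (i + 1) ≤ ε i := by simp only [hε]; linarith [h1.2.1]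
      exact ih.trans this
    | self => exact le_rfl
  have hθ : ∀ i ≤ t, 9 / 10 * x⁻¹ < ε i := fun i hi => hcase.trans_le (hanti i hi)
  have hθ0 : 0 < 9 / 10 * x⁻¹ := by positivity
  -- Convexity and Hölder's inequality bound the excess risk by the gradient.
  have hgrad : ∀ i ≤ t, ε i ≤ gradSup ℓ S (lam i) * (N + ‖lam i‖) := fun i hi => by
    have h1 := empRisk_add_empGrad_le (S := S) h hb (lam i) lb
    have h2 := (abs_le.1 (abs_empGrad_le_gradSup (S := S) h hb (lam i) (lb - lam i))).1
    have h3 : gradSup ℓ S (lam i) * ‖lb - lam i‖ ≤ gradSup ℓ S (lam i) * (N + ‖lam i‖) :=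
      mul_le_mul_of_nonneg_left (norm_sub_le _ _) (gradSup_nonneg _)
    simp only [hε]; linarith
  have hNpos : 0 < N := by
    rcases hN0.eq_or_lt with h1 | h1
    · have h2 := hgrad 0 (Nat.zero_le _)
      rw [hrun.1, norm_zero, ← h1, add_zero, mul_zero] at h2
      linarith [hθ 0 (Nat.zero_le _)]
    · exact h1
  have hcontr : ∀ i ≤ t, ε i ≤ ε 0 * (N / (N + s i)) ^ p := by
    intro i
    induction i with
    | zero => intro _; simp [hs, hNpos.ne']
    | succ i ih =>
      intro hi
      have h1 := hα i (by omega)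
      have h2 := hgrad i (by omega)
      have hsi := hs0 i (by omega)
      have hu : 0 < N + s i := by linarith
      have hεi := hθ0.trans (hθ i (by omega))
      have hsucc : s (i + 1) = s i + α i := Finset.sum_range_succ _ _
      have h3 : ε i / (N + s i) ≤ gradSup ℓ S (lam i) := by
        rw [div_le_iff₀ hu]
        exact h2.trans (mul_le_mul_of_nonneg_left
          (add_le_add_right (hnorm i (by omega)).1 N) (gradSup_nonneg _))
      have h4 : ε (i + 1) ≤ ε i * (1 - p * α i / (N + s i)) := by
        have h5 : p * (ε i / (N + s i)) * α i ≤ p * gradSup ℓ S (lam i) * α i :=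
          mul_le_mul_of_nonneg_right (mul_le_mul_of_nonneg_left h3 hp0.le) h1.1
        have h6 : p * gradSup ℓ S (lam i) * α i ≤ ε i - ε (i + 1) := by
          simp only [hε, hp]; linarith [h1.2.1]
        calc ε (i + 1) ≤ ε i - p * (ε i / (N + s i)) * α i := by linarith
          _ = _ := by ring
      have h7 := one_sub_mul_div_le_rpow hu h1.1 hp0.le
      calc ε (i + 1) ≤ ε i * ((N + s i) / (N + s i + α i)) ^ p :=
            h4.trans (mul_le_mul_of_nonneg_left h7 hεi.le)
        _ ≤ ε 0 * (N / (N + s i)) ^ p * ((N + s i) / (N + s i + α i)) ^ p :=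
            mul_le_mul_of_nonneg_right (ih (by omega))
              (Real.rpow_nonneg (div_nonneg hu.le (by linarith [h1.1])) _)
        _ = ε 0 * (N / (N + s (i + 1))) ^ p := by
            rw [mul_assoc, ← Real.mul_rpow (by positivity)
              (div_nonneg hu.le (by linarith [h1.1])), hsucc, ← add_assoc]
            congr 2
            have : N + s i + α i ≠ 0 := by linarith [h1.1]
            field_simp
  have hRt : normBound ℓ ρ τ P t = x ^ 2 * R1 := by rw [normBound_eq, hsq]
  -- The steps are bounded below because the gradient is, so their sum over `t = x ^ 4` rounds is of
  -- order `x`; the constant is `9 / 10 / (2 * 41 / 25) ≥ 1 / 4`, where `41 / 25 = 1 + 16 / 25`.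
  have hst : κ ≤ s t := by
    have h1 : ∀ j ∈ Finset.range t, ρ * (9 / 10 * x⁻¹) / (41 / 25 * (x ^ 2 * R1)) / (2 * B2) ≤ α j :=
      fun j hj => by
        have hj' := Finset.mem_range.1 hj
        refine le_trans ?_ (hα j hj').2.2
        have h2 := hgrad j hj'.le
        have h3 := hθ j hj'.le
        have h4 : N + ‖lam j‖ ≤ 41 / 25 * (x ^ 2 * R1) := by
          have h5 := hnorm j hj'.le
          have h6 := normBound_mono (ℓ := ℓ) (ρ := ρ) (τ := τ) (P := P) hj'.le
          rw [← hRt]; linarith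
        have h7 : 9 / 10 * x⁻¹ / (41 / 25 * (x ^ 2 * R1)) ≤ gradSup ℓ S (lam j) := by
          rw [div_le_iff₀ (by positivity)]
          exact h3.le.trans (h2.trans (mul_le_mul_of_nonneg_left h4 (gradSup_nonneg _)))
        rw [mul_div_assoc]
        gcongr
    have h2 := Finset.card_nsmul_le_sum _ _ _ h1
    rw [Finset.card_range, nsmul_eq_mul, ← hxt] at h2
    refine le_trans ?_ h2
    have e : x ^ 4 * (ρ * (9 / 10 * x⁻¹) / (41 / 25 * (x ^ 2 * R1)) / (2 * B2))
        = 45 / 41 * κ := by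
      rw [hκ]; field_simp; ring
    rw [e]; linarith
  have hε0 : ε 0 ≤ ℓ 0 := by
    have : 0 ≤ empRisk ℓ S lb := empMean_nonneg fun _ => h.nonneg _
    simp only [hε]
    rw [hrun.1, empRisk_zero hm]; linarith
  have hfin : ε t ≤ ℓ 0 * (N / (N + κ)) ^ (ρ ^ 3 * B / (9 * B2)) := by
    have hb1 : N / (N + s t) ≤ N / (N + κ) := by gcongr
    have hb2 : N / (N + κ) ≤ 1 := div_le_one_of_le₀ (by linarith) (by positivity)
    have hst0 := hs0 t le_rfl
    have hpe : ρ ^ 3 * B / (9 * B2) ≤ p := by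
      have h3 : ρ ^ 3 ≤ ρ := by
        have := pow_le_pow_of_le_one hρ.le hρ1.le (show 1 ≤ 3 by norm_num)
        simpa using this
      have e : p = ρ * B / (2 * B2) := by rw [hp]; ring
      rw [e]
      gcongr
      norm_num
    calc ε t ≤ ε 0 * (N / (N + s t)) ^ p := hcontr t le_rfl
      _ ≤ ℓ 0 * (N / (N + κ)) ^ p := by gcongr
      _ ≤ _ := mul_le_mul_of_nonneg_left
          (Real.rpow_le_rpow_of_exponent_ge (by positivity) hb2 hpe) h0.le
  have : empRisk ℓ S (lam t) - empRisk ℓ S lb ≤ _ := hfin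
  linarith

end Convergence

/-! ### Samples on which the empirical risk is curved -/

section CurvedSample
variable {X : Type u} {H : Set (X → ℝ)} {ℓ : ℝ → ℝ} {m : ℕ}

/-- The Rademacher averages of the predictions of single weak learners, weighted by a bounded
function. -/
theorem radAvg_opA_unitWeight_le (hb : IsBinary H) (hV : FiniteVC H) {q : X × Bool → ℝ} {P : ℝ}
    (hq : ∀ z, |q z| ≤ P) (hP : 0 ≤ P) (S : Fin m → X × Bool) {ι : Type*} [Finite ι] [Nonempty ι]
    (g : ι → H) :
    radAvg (fun k i => opA (unitWeight (g k)) (S i) * q (S i))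
      ≤ P * √(2 * m * (vcDim H * Real.log (m + 1))) := by
  obtain ⟨hfin, hcard⟩ := ncard_trace_le hb hV fun i => (S i).1
  rw [Fintype.card_fin] at hcard
  have h1 := radAvg_le_of_ncard (N := ((m : ℝ) + 1) ^ vcDim H)
    (fun k i => opA (unitWeight (g k)) (S i) * q (S i)) (B := P) (fun k i => by
      rw [abs_mul, hb.abs_opA_unitWeight, one_mul]; exact hq _) hP (by
      have hsub : (range fun k => fun i => opA (unitWeight (g k)) (S i) * q (S i)) ⊆
          (fun (v : Fin m → ℝ) i => -sgn (S i).2 * v i * q (S i)) ''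
            {v : Fin m → ℝ | ∃ h ∈ H, v = fun i => h (S i).1} := by
        rintro _ ⟨k, rfl⟩
        refine ⟨_, ⟨(g k).1, (g k).2, rfl⟩, ?_⟩
        funext i
        beta_reduce
        rw [opA_unitWeight]
      exact_mod_cast ((Set.ncard_le_ncard hsub (hfin.image _)).trans
        (Set.ncard_image_le hfin)).trans hcard)
  rwa [Real.log_pow] at h1

theorem empMean_tendsto {Z : Type*} {f : ℕ → Z → ℝ} {f' : Z → ℝ}
    (h : ∀ z, Tendsto (fun n => f n z) atTop (𝓝 (f' z))) (S : Fin m → Z) :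
    Tendsto (fun n => empMean (f n) S) atTop (𝓝 (empMean f' S)) :=
  (tendsto_finsetSum _ fun i _ => h (S i)).const_mul _

variable [MeasurableSpace X] {μ : Measure (X × Bool)}

/-- The everywhere defined and bounded version of a dual optimum. -/
theorem IsDualOptimum.exists_clamp {p : Lp ℝ ⊤ μ} (hp : IsDualOptimum ℓ μ H p) :
    ∃ q : X × Bool → ℝ, Measurable q ∧ (∀ z, 0 ≤ q z) ∧ (∀ z, q z ≤ ‖p‖) ∧ q =ᵐ[μ] p ∧
      ∀ lam : Weights H, ∫ z, opA lam z * q z ∂μ = 0 := by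
  have hle : ∀ᵐ z ∂μ, ‖p z‖ ≤ ‖p‖ := by
    filter_upwards [ae_le_eLpNormEssSup (f := p) (μ := μ)] with z hz
    rw [Lp.norm_def, eLpNorm_exponent_top]
    have hfin : eLpNormEssSup p μ ≠ ⊤ := by
      rw [← eLpNorm_exponent_top]; exact Lp.eLpNorm_ne_top p
    have := ENNReal.toReal_mono hfin hz
    simpa using this
  have hae : (fun z => max 0 (min (p z) ‖p‖)) =ᵐ[μ] p := by
    filter_upwards [hle, hp.1.mem_Icc] with z h1 h2
    rw [min_eq_left ((Real.le_norm_self _).trans h1), max_eq_right h2.1]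
  refine ⟨fun z => max 0 (min (p z) ‖p‖),
    measurable_const.max ((Lp.stronglyMeasurable p).measurable.min measurable_const),
    fun z => le_max_left _ _, fun z => max_le (norm_nonneg _) (min_le_right _ _), hae,
    fun lam => ?_⟩
  refine (integral_congr_ae ?_).trans (hp.1.adjoint_eq_zero lam)
  filter_upwards [hae] with z hz
  rw [hz]

variable [IsProbabilityMeasure μ]

/-- A level `τ` that is reached with probability at least `τ > 0` is at most the essential supremum, and
at most `1`. -/
theorem le_norm_of_le_measure {p : Lp ℝ ⊤ μ} (hp : IsDualOptimum ℓ μ H p) {τ : ℝ} (hτ : 0 < τ)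
    (h : τ ≤ μ.real {z | τ ≤ p z}) : τ ≤ ‖p‖ ∧ τ ≤ 1 := by
  obtain ⟨q, -, -, hqP, hq, -⟩ := hp.exists_clamp
  refine ⟨?_, h.trans measureReal_le_one⟩
  by_contra! hlt
  have h0 : μ {z | τ ≤ p z} = 0 := by
    have : ∀ᵐ z ∂μ, ¬ τ ≤ p z := by
      filter_upwards [hq] with z hz
      rw [← hz]; exact not_le.2 ((hqP z).trans_lt hlt)
    simpa [ae_iff] using this
  rw [Measure.real, h0] at h
  simp at h
  linarith

/-- By Hoeffding's inequality a fraction `τ / 2` of the sample carries weight at least `τ`. -/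
theorem measure_empMean_indicator_lt_le (hm : 0 < m) {q : X × Bool → ℝ} (hq : Measurable q)
    {τ δ : ℝ} (hτ : 0 < τ) (hδ : 0 < δ) (hμ : τ ≤ μ.real {z | τ ≤ q z})
    (hml : 2 / τ ^ 2 * Real.log (4 / δ) ≤ m) :
    (Measure.pi fun _ : Fin m => μ)
      {S | ¬ τ / 2 ≤ empMean (fun z => if τ ≤ q z then 1 else 0) S} ≤ ENNReal.ofReal (δ / 4) := by
  have hset : MeasurableSet {z | τ ≤ q z} := measurableSet_le measurable_const hq
  have hf : Measurable fun z => if τ ≤ q z then (1 : ℝ) else 0 :=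
    Measurable.ite hset measurable_const measurable_const
  have hint : ∫ z, (if τ ≤ q z then (1 : ℝ) else 0) ∂μ = μ.real {z | τ ≤ q z} := by
    rw [← integral_indicator_one hset]
    congr 1
  have h1 := measure_exists_deviation_le (μ := μ) hm
    (fun (_ : Unit) z => if τ ≤ q z then (1 : ℝ) else 0) (fun _ => hf) zero_lt_one
    (fun _ z => by split_ifs <;> simp) (r := 0) (u := τ / 2)
    (fun S n g => by
      refine (radAvg_le_of_ncard (B := 1) (N := 1) _ (fun _ i => ?_) zero_le_one ?_).trans ?_
      · split_ifs <;> simp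
      · rw [Set.range_const, Set.ncard_singleton, Nat.cast_one]
      · simp) (by positivity)
  refine (measure_mono ?_).trans (h1.trans (ENNReal.ofReal_le_ofReal ?_))
  · intro S hS
    refine ⟨(), ?_⟩
    rw [hint]
    have := not_le.1 hS
    linarith
  · have h4 : 0 < 4 / δ := by positivity
    calc Real.exp (-(2 * m * (τ / 2) ^ 2 / (1 - 0) ^ 2)) ≤ Real.exp (-Real.log (4 / δ)) := by
          rw [Real.exp_le_exp, neg_le_neg_iff]
          rw [div_mul_eq_mul_div, div_le_iff₀ (by positivity)] at hml
          linarith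
      _ = δ / 4 := by rw [Real.exp_neg, Real.exp_log h4, inv_div]

/-- A weight function that annihilates all predictions under the distribution nearly does so on the
sample. -/
theorem measure_corr_le (hm : 0 < m) (hb : IsBinary H) (hV : FiniteVC H)
    (hH : PointwiseMeasurable H) {q : X × Bool → ℝ} (hq : Measurable q) {P : ℝ} (hP : 0 < P)
    (hq0 : ∀ z, 0 ≤ q z) (hqP : ∀ z, q z ≤ P)
    (horth : ∀ lam : Weights H, ∫ z, opA lam z * q z ∂μ = 0) {δ : ℝ} (hδ : 0 < δ) (hδ1 : δ ≤ 1) :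
    (Measure.pi fun _ : Fin m => μ)
      {S | ¬ ∀ lam : Weights H, |empMean (fun z => opA lam z * q z) S| ≤
        2 * P / √(m : ℝ) * (2 * √(2 * vcDim H * Real.log (m + 1)) + √(2 * Real.log (4 / δ)))
          * ‖lam‖} ≤ ENNReal.ofReal (δ / 12) := by
  obtain ⟨hmeas, H₀, hH₀, hcount, happ⟩ := hH
  have hm' : (0 : ℝ) < m := by exact_mod_cast hm
  have := hcount.to_subtype
  set L := Real.log (4 / δ) with hL
  have hL0 : 0 ≤ L := Real.log_nonneg (by rw [le_div_iff₀ hδ]; linarith)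
  set C := 2 * P / √(m : ℝ) * (2 * √(2 * vcDim H * Real.log (m + 1)) + √(2 * L)) with hC
  have hC0 : 0 ≤ C := by positivity
  have hqa : ∀ z, |q z| ≤ P := fun z => by rw [abs_of_nonneg (hq0 z)]; exact hqP z
  set r := P * √(2 * m * (vcDim H * Real.log (m + 1))) / m with hr
  set u := 2 * P / √(m : ℝ) * √(2 * L) with hu
  have h1 := measure_exists_abs_deviation_le (μ := μ) hm
    (fun (h : H₀) z => opA (unitWeight ⟨h.1, hH₀ h.2⟩) z * q z)
    (fun h => (measurable_opA hb hmeas _).mul hq) (lo := -P) (hi := P) (by linarith)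
    (fun h z => abs_le.1 (by rw [abs_mul, hb.abs_opA_unitWeight, one_mul]; exact hqa z))
    (r := r) (u := u)
    (fun S n g => by
      refine (radAvg_opA_unitWeight_le hb hV hqa hP.le S fun k => ⟨(g k).1, hH₀ (g k).2⟩).trans_eq ?_
      rw [hr]; field_simp) (by positivity)
  have hru : 2 * r + u ≤ C := by
    have e : √(2 * m * (vcDim H * Real.log (m + 1))) / m
        = √(2 * vcDim H * Real.log (m + 1)) / √m := by
      rw [show 2 * (m : ℝ) * (vcDim H * Real.log (m + 1))
        = m * (2 * vcDim H * Real.log (m + 1)) by ring, Real.sqrt_mul hm'.le]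
      have h2 : √(m : ℝ) ≠ 0 := (Real.sqrt_pos.2 hm').ne'
      have h3 : (m : ℝ) = √(m : ℝ) * √(m : ℝ) := (Real.mul_self_sqrt hm'.le).symm
      rw [div_eq_div_iff hm'.ne' h2]
      calc _ = √(2 * vcDim H * Real.log (m + 1)) * (√(m : ℝ) * √(m : ℝ)) := by ring
        _ = _ := by rw [← h3]
    have e2 : r = P * (√(2 * vcDim H * Real.log (m + 1)) / √m) := by rw [hr, mul_div_assoc, e]
    have e3 : C = 2 * (2 * P * (√(2 * vcDim H * Real.log (m + 1)) / √m)) + u := by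
      rw [hC, hu]; ring
    have e4 : 0 ≤ P * (√(2 * vcDim H * Real.log (m + 1)) / √m) := by positivity
    rw [e2, e3]; linarith
  refine (measure_mono ?_).trans (h1.trans ?_)
  · intro S hS
    by_contra hcon
    refine hS fun lam => ?_
    simp only [mem_ofPred_eq, not_exists, not_le] at hcon
    have hH0 : ∀ h : H₀, |empMean (fun z => opA (unitWeight ⟨h.1, hH₀ h.2⟩) z * q z) S| ≤ C :=
      fun h => by
        have := hcon h
        rw [horth, zero_sub, abs_neg] at this
        exact this.le.trans hru
    have hunit : ∀ k : H, |empMean (fun z => q z * opA (unitWeight k) z) S| ≤ C := fun k => by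
      obtain ⟨g, hg, hgt⟩ := happ k.1 k.2
      have ht : Tendsto (fun n => empMean (fun z => opA (unitWeight ⟨g n, hH₀ (hg n)⟩) z * q z) S)
          atTop (𝓝 (empMean (fun z => q z * opA (unitWeight k) z) S)) := by
        refine empMean_tendsto (fun z => ?_) S
        simp only [opA_unitWeight]
        rw [mul_comm (q z)]
        exact ((hgt z.1).const_mul _).mul_const _
      exact le_of_tendsto ht.abs (Eventually.of_forall fun n => hH0 ⟨g n, hg n⟩)
    have e : empMean (fun z => opA lam z * q z) S = empMean (fun z => q z * opA lam z) S := by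
      simp only [mul_comm]
    rw [e, empMean_mul_opA_eq]
    refine abs_sum_mul_opA_le hb _ hC0 (fun k => ?_) lam
    rw [← empMean_mul_opA_eq]
    exact hunit k
  · have e : 2 * m * u ^ 2 / (P - -P) ^ 2 = (4 : ℕ) * L := by
      rw [hu, mul_pow, div_pow, Real.sq_sqrt hm'.le, Real.sq_sqrt (by positivity)]
      field_simp
      push_cast
      ring
    rw [e, ← mul_neg, Real.exp_nat_mul, Real.exp_neg, hL, Real.exp_log (by positivity), inv_div,
      show (2 : ENNReal) = ENNReal.ofReal 2 by simp, ← ENNReal.ofReal_mul (by norm_num)]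
    refine ENNReal.ofReal_le_ofReal ?_
    have h5 : δ ^ 4 ≤ δ := by
      have := pow_le_pow_of_le_one hδ.le hδ1 (show 1 ≤ 4 by norm_num)
      simpa using this
    rw [div_pow]
    linarith

/-- With large probability the empirical risk is curved on the sample. -/
theorem measure_not_isCurvedSample_le (hm : 0 < m) (h : LossBds ℓ) (h0 : 0 < ℓ 0)
    (hb : IsBinary H) (hV : FiniteVC H)
    (hH : PointwiseMeasurable H) {p : Lp ℝ ⊤ μ} (hp : IsDualOptimum ℓ μ H p) {τ ρ δ : ℝ} {t : ℕ}
    (hτ : 0 < τ) (hμ : τ ≤ μ.real {z | τ ≤ p z}) (hδ : 0 < δ) (hδ1 : δ ≤ 1)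
    (hlarge : SampleLarge ℓ ρ τ ‖p‖ δ (vcDim H) m t) :
    (Measure.pi fun _ : Fin m => μ)
      {S | ¬ ∃ q : X × Bool → ℝ,
        IsCurvedSample H S q τ ‖p‖ (cConst ℓ τ ‖p‖) (normBound ℓ ρ τ ‖p‖ t)}
      ≤ ENNReal.ofReal (δ / 3) := by
  obtain ⟨q, hqm, hq0, hqP, hqp, horth⟩ := hp.exists_clamp
  have hP : 0 < ‖p‖ := hτ.trans_le (le_norm_of_le_measure hp hτ hμ).1
  have hμq : τ ≤ μ.real {z | τ ≤ q z} := by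
    refine hμ.trans_eq (measureReal_congr ?_)
    filter_upwards [hqp] with z hz
    exact propext (by change τ ≤ p z ↔ τ ≤ q z; rw [hz])
  have h1 := measure_empMean_indicator_lt_le hm hqm hτ hδ hμq hlarge.1
  have h2 := measure_corr_le hm hb hV hH hqm hP hq0 hqP horth hδ hδ1
  have e : ENNReal.ofReal (δ / 3) = ENNReal.ofReal (δ / 4) + ENNReal.ofReal (δ / 12) := by
    rw [← ENNReal.ofReal_add (by positivity) (by positivity)]; congr 1; ring
  rw [e]
  refine (measure_mono ?_).trans ((measure_union_le _ _).trans (add_le_add h1 h2))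
  intro S hS
  by_contra hcon
  simp only [mem_union, mem_ofPred_eq, not_or, not_not] at hcon
  refine hS ⟨q, hq0, hqP, hcon.1, fun lam hlam => ?_⟩
  refine (hcon.2 lam).trans ?_
  have hc0 := cConst_pos (P := ‖p‖) h h0 hτ
  have hD : 0 ≤ 2 * ‖p‖ / √(m : ℝ) *
      (2 * √(2 * vcDim H * Real.log (m + 1)) + √(2 * Real.log (4 / δ))) := by positivity
  calc _ ≤ 2 * ‖p‖ / √(m : ℝ) *
        (2 * √(2 * vcDim H * Real.log (m + 1)) + √(2 * Real.log (4 / δ)))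
        * (normBound ℓ ρ τ ‖p‖ t + 2 * cConst ℓ τ ‖p‖) := mul_le_mul_of_nonneg_left hlam hD
    _ = 2 * (normBound ℓ ρ τ ‖p‖ t + 2 * cConst ℓ τ ‖p‖) * ‖p‖ / √(m : ℝ) *
        (2 * √(2 * vcDim H * Real.log (m + 1)) + √(2 * Real.log (4 / δ))) := by ring
    _ ≤ _ := hlarge.2

end CurvedSample

/-! ### Uniform deviations of the surrogate risk -/

section UniformDeviation
variable {X : Type u} {H : Set (X → ℝ)} {ℓ : ℝ → ℝ} {m : ℕ}

/-- The Rademacher averages of a ball of weightings are those of the signed weak learners, scaled by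
the radius. -/
theorem radAvg_opA_le (hb : IsBinary H) (hV : FiniteVC H) (hne : H.Nonempty)
    (S : Fin m → X × Bool) {ι : Type*} [Finite ι] [Nonempty ι] (lam : ι → Weights H) {R : ℝ}
    (hR : 0 ≤ R) (hlam : ∀ k, ‖lam k‖ ≤ R) :
    radAvg (fun k i => opA (lam k) (S i))
      ≤ R * √(2 * m * Real.log (2 * (m + 1) ^ vcDim H)) := by
  obtain ⟨hfin, hcard⟩ := ncard_trace_le hb hV fun i => (S i).1
  rw [Fintype.card_fin] at hcard
  set J := {v : Fin m → ℝ | ∃ h ∈ H, v = fun i => h (S i).1} with hJ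
  have : Finite J := hfin
  obtain ⟨h₀, hh₀⟩ := hne
  have : Nonempty J := ⟨⟨_, h₀, hh₀, rfl⟩⟩
  set b : J × Bool → Fin m → ℝ := fun k i => sgn k.2 * (-sgn (S i).2 * k.1.1 i) with hbdef
  have hbabs : ∀ k i, |b k i| ≤ 1 := fun k i => by
    obtain ⟨⟨v, h, hh, rfl⟩, y⟩ := k
    simp only [hbdef]
    rw [abs_mul, abs_mul, abs_neg, abs_sgn, abs_sgn, hb.abs_eq ⟨h, hh⟩]; norm_num
  have hbN : ((range b).ncard : ℝ) ≤ 2 * ((m : ℝ) + 1) ^ vcDim H := by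
    have h1 : (range b).ncard ≤ Nat.card (J × Bool) := by
      rw [← Set.image_univ, ← Set.ncard_univ]
      exact Set.ncard_image_le (Set.toFinite _)
    rw [Nat.card_prod, Nat.card_eq_fintype_card (α := Bool), Fintype.card_bool,
      Nat.card_coe_set_eq] at h1
    have h2 : (range b).ncard ≤ 2 * (m + 1) ^ vcDim H := by linarith
    exact_mod_cast h2
  have h1 := radAvg_le_of_ncard b hbabs zero_le_one hbN
  have h2 : radAvg (fun k i => opA (lam k) (S i)) ≤ R * radAvg b := by
    unfold radAvg
    rw [mul_left_comm]
    refine mul_le_mul_of_nonneg_left ?_ (by positivity)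
    rw [Finset.mul_sum]
    refine Finset.sum_le_sum fun σ _ => ciSup_le fun k => ?_
    set M := ⨆ j, ∑ i, sgn (σ i) * b j i with hM
    have hunit : ∀ h : H, |∑ i, sgn (σ i) * opA (unitWeight h) (S i)| ≤ M := fun h => by
      have e : ∀ y : Bool, sgn y * ∑ i, sgn (σ i) * opA (unitWeight h) (S i) ≤ M := fun y => by
        refine le_trans (le_of_eq ?_) (le_ciSup_finite (fun j => ∑ i, sgn (σ i) * b j i)
          (⟨_, h.1, h.2, rfl⟩, y))
        rw [Finset.mul_sum]
        refine Finset.sum_congr rfl fun i _ => ?_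
        simp only [hbdef, opA_unitWeight]; ring
      refine abs_le.2 ⟨?_, ?_⟩
      · have := e false; simp only [sgn, Bool.false_eq_true, if_false] at this ⊢; linarith
      · have := e true; simp only [sgn, if_true] at this ⊢; linarith
    have hM0 : 0 ≤ M := (abs_nonneg _).trans (hunit ⟨h₀, hh₀⟩)
    calc _ ≤ |∑ i, sgn (σ i) * opA (lam k) (S i)| := le_abs_self _
      _ ≤ M * ‖lam k‖ := abs_sum_mul_opA_le hb _ hM0 hunit _
      _ ≤ M * R := mul_le_mul_of_nonneg_left (hlam k) hM0
      _ = R * M := mul_comm _ _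
  refine h2.trans (mul_le_mul_of_nonneg_left ?_ hR)
  rwa [one_mul] at h1

theorem continuous_empRisk (h : LossBds ℓ) (hb : IsBinary H) (S : Fin m → X × Bool) :
    Continuous fun lam : Weights H => empRisk ℓ S lam :=
  continuous_const.mul (continuous_finsetSum _ fun _ _ => h.continuous.comp (continuous_opA hb _))

/-- A class of VC dimension zero has at most one member. -/
theorem eq_of_vcDim_eq_zero (hb : IsBinary H) (hV : FiniteVC H) (h0 : vcDim H = 0) (h k : H) :
    h = k := by
  by_contra hne
  obtain ⟨x, hx⟩ : ∃ x, h.1 x ≠ k.1 x := by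
    by_contra! hx; exact hne (Subtype.ext (funext hx))
  have h1 : 1 ≤ vcDim H := by
    refine le_csSup hV ⟨{x}, Finset.card_singleton x, fun b hbx => ?_⟩
    have hex : ∀ y : Prop, ∃ f ∈ H, f x = 1 ↔ y := fun y => by
      rcases hb _ h.2 x with e1 | e1 <;> rcases hb _ k.2 x with e2 | e2
      · exact absurd (e1.trans e2.symm) hx
      · by_cases hy : y
        · exact ⟨h.1, by simp [e1, hy]⟩
        · exact ⟨k.1, by norm_num [e2, hy]⟩
      · by_cases hy : y
        · exact ⟨k.1, by simp [e2, hy]⟩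
        · exact ⟨h.1, by norm_num [e1, hy]⟩
      · exact absurd (e1.trans e2.symm) hx
    obtain ⟨f, hf, hfb⟩ := hex (x ∈ b)
    refine ⟨f, hf, fun y hy => ?_⟩
    rw [Finset.mem_singleton.1 hy, hfb]
  omega

variable [MeasurableSpace X] {μ : Measure (X × Bool)} [IsProbabilityMeasure μ]

/-- Uniform bounds on the deviation of the surrogate risk over a ball of weightings need to be checked
only on a countable set of weightings. -/
theorem exists_countable_weights (h : LossBds ℓ) (hb : IsBinary H) (hH : PointwiseMeasurable H)
    (μ : Measure (X × Bool)) [IsProbabilityMeasure μ] (R : ℝ) :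
    ∃ W : Set (Weights H), W.Countable ∧ (∀ lam ∈ W, ‖lam‖ ≤ R) ∧
      ∀ (m : ℕ) (S : Fin m → X × Bool) (θ C : ℝ),
        (∀ lam ∈ W, θ * (risk ℓ μ lam - empRisk ℓ S lam) ≤ C) →
        ∀ lam : Weights H, ‖lam‖ ≤ R → θ * (risk ℓ μ lam - empRisk ℓ S lam) ≤ C := by
  obtain ⟨hmeas, H₀, hH₀, hcount, happ⟩ := hH
  set U : Set (Weights H) := unitWeight '' {k : H | k.1 ∈ H₀} with hU
  have hUc : U.Countable := (hcount.preimage Subtype.val_injective).image _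
  set Y : Set (Weights H) := {lam | ‖lam‖ ≤ R} ∩ Submodule.span ℝ U with hY
  have hYs : TopologicalSpace.IsSeparable Y := hUc.isSeparable.span.mono inter_subset_right
  obtain ⟨W, hWY, hWc, hWd⟩ := hYs.exists_countable_dense_subset
  refine ⟨W, hWc, fun lam hlam => (hWY hlam).1, fun m S θ C hC lam hlam => ?_⟩
  have hcont : Continuous fun lam : Weights H => θ * (risk ℓ μ lam - empRisk ℓ S lam) :=
    continuous_const.mul ((continuous_risk h hb hmeas).sub (continuous_empRisk h hb S))
  have hYC : ∀ lam ∈ Y, θ * (risk ℓ μ lam - empRisk ℓ S lam) ≤ C := fun lam hl =>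
    closure_minimal (t := {lam : Weights H | θ * (risk ℓ μ lam - empRisk ℓ S lam) ≤ C}) hC
      (isClosed_le hcont continuous_const) (hWd hl)
  obtain ⟨s, hs⟩ := Weights.exists_seq_trunc lam
  refine le_of_tendsto ((hcont.tendsto lam).comp hs) (Eventually.of_forall fun n => ?_)
  simp only [Function.comp_apply]
  -- A finite combination of weak learners is a pointwise limit of combinations over the countable
  -- subclass with the same weights.
  choose g hg hgt using fun k : H => happ k.1 k.2
  set a : ℕ → Weights H := fun j => ∑ k ∈ s n, lam k • unitWeight ⟨g k j, hH₀ (hg k j)⟩ with ha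
  have haY : ∀ j, a j ∈ Y := fun j => by
    refine ⟨?_, Submodule.sum_mem _ fun k _ => Submodule.smul_mem _ _
      (Submodule.subset_span ⟨_, hg k j, rfl⟩)⟩
    refine (norm_sum_le _ _).trans (le_trans ?_ ((Weights.sum_abs_le lam (s n)).trans hlam))
    simp only [norm_smul, norm_unitWeight, mul_one, Real.norm_eq_abs]
    exact le_rfl
  have hpt : ∀ z, Tendsto (fun j => ℓ (opA (a j) z)) atTop
      (𝓝 (ℓ (opA (Weights.trunc lam (s n)) z))) := fun z => by
    refine (h.continuous.tendsto _).comp ?_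
    have e : ∀ j, opA (a j) z = -sgn z.2 * ∑ k ∈ s n, lam k * g k j z.1 := fun j => by
      rw [opA_eq, ha]; simp only [opH_sum hb, opH_smul, opH_unitWeight]
    simp only [e, opA_eq, opH_trunc hb]
    exact (tendsto_finsetSum _ fun k _ => (hgt k z.1).const_mul _).const_mul _
  have h1 : Tendsto (fun j => risk ℓ μ (a j)) atTop (𝓝 (risk ℓ μ (Weights.trunc lam (s n)))) := by
    refine tendsto_integral_of_dominated_convergence (fun _ => ℓ R)
      (fun j => (h.continuous.measurable.comp (measurable_opA hb hmeas _)).aestronglyMeasurable)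
      (integrable_const _) (fun j => ae_of_all _ fun z => ?_) (ae_of_all _ hpt)
    exact h.abs_comp_le ((abs_opA_le hb _ _).trans (haY j).1)
  have h2 : Tendsto (fun j => empRisk ℓ S (a j)) atTop
      (𝓝 (empRisk ℓ S (Weights.trunc lam (s n)))) :=
    empMean_tendsto (f := fun j z => ℓ (opA (a j) z)) hpt S
  exact le_of_tendsto ((h1.sub h2).const_mul θ) (Eventually.of_forall fun j => hYC _ (haY j))

/-- One-sided uniform deviation of the surrogate risk over a ball of weightings; the sign `θ` selects
the side. -/
theorem measure_exists_risk_deviation_le (hm : 0 < m) (h : LossBds ℓ) (h0 : 0 < ℓ 0)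
    (hb : IsBinary H) (hV : FiniteVC H) (hne : H.Nonempty) (hH : PointwiseMeasurable H) {R : ℝ}
    (hR : 0 ≤ R) {θ : ℝ} (hθ : |θ| = 1) {δ : ℝ} (hδ : 0 < δ) (hδ1 : δ ≤ 1) :
    (Measure.pi fun _ : Fin m => μ)
      {S | ¬ ∀ lam : Weights H, ‖lam‖ ≤ R → θ * (risk ℓ μ lam - empRisk ℓ S lam)
        ≤ 2 * lipConst ℓ * R * √(2 * Real.log (2 * (m + 1) ^ vcDim H) / m)
          + ℓ R / 2 * √(2 / m * Real.log (6 / δ))} ≤ ENNReal.ofReal (δ / 6) := by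
  have hm' : (0 : ℝ) < m := by exact_mod_cast hm
  obtain ⟨W, hWc, hWR, hW⟩ := exists_countable_weights h hb hH μ R
  have := hWc.to_subtype
  have hL0 : 0 ≤ Real.log (6 / δ) := Real.log_nonneg (by rw [le_div_iff₀ hδ]; linarith)
  have hℓR : 0 < ℓ R := h0.trans_le (h.monotone hR)
  set a := θ * ℓ R / 2 - ℓ R / 2 with ha
  set r := lipConst ℓ * (R * √(2 * m * Real.log (2 * (m + 1) ^ vcDim H))) / m with hr
  set u := ℓ R / 2 * √(2 / m * Real.log (6 / δ)) with hu
  have hval : ∀ (w : W) z, ℓ (opA w.1 z) ∈ Icc 0 (ℓ R) := fun w z =>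
    ⟨h.nonneg _, (le_abs_self _).trans (h.abs_comp_le ((abs_opA_le hb _ _).trans (hWR _ w.2)))⟩
  have hmeasW : ∀ w : W, Measurable fun z => ℓ (opA w.1 z) := fun w =>
    h.continuous.measurable.comp (measurable_opA hb hH.1 _)
  have h1 := measure_exists_deviation_le (μ := μ) hm (fun (w : W) z => θ * ℓ (opA w.1 z))
    (fun w => (hmeasW w).const_mul θ) (lo := a) (hi := a + ℓ R) (by linarith)
    (fun w z => by
      obtain ⟨h1, h2⟩ := hval w z
      rcases eq_or_eq_neg_of_abs_eq hθ with e | e <;> rw [ha, e] <;> constructor <;> linarith)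
    (r := r) (u := u)
    (fun S n g => by
      refine (radAvg_contraction (fun k i => opA (g k).1 (S i)) _ h.lipConst_pos.le
        fun j k i => ?_).trans ?_
      · rw [← mul_sub, abs_mul, hθ, one_mul]; exact h.abs_sub_le _ _
      · rw [hr, mul_div_cancel₀ _ hm'.ne']
        exact mul_le_mul_of_nonneg_left (radAvg_opA_le hb hV hne S (fun k => (g k).1) hR
          fun k => hWR _ (g k).2) h.lipConst_pos.le) (by positivity)
  have hr2 : 2 * r = 2 * lipConst ℓ * R * √(2 * Real.log (2 * (m + 1) ^ vcDim H) / m) := by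
    have e : √(2 * m * Real.log (2 * (m + 1) ^ vcDim H)) / m
        = √(2 * Real.log (2 * (m + 1) ^ vcDim H) / m) := by
      rw [Real.sqrt_div' _ hm'.le, mul_right_comm, Real.sqrt_mul' _ hm'.le, mul_div_assoc,
        Real.sqrt_div_self', mul_one_div]
    rw [← e, hr]; ring
  refine (measure_mono ?_).trans (h1.trans ?_)
  · intro S hS
    by_contra hcon
    simp only [mem_ofPred_eq, not_exists, not_le] at hcon
    refine hS (hW m S θ _ fun w hw => ?_)
    have h3 := (hcon ⟨w, hw⟩).le
    rw [integral_const_mul, empMean_const_mul, ← mul_sub, hr2] at h3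
    exact h3
  · refine ENNReal.ofReal_le_ofReal (le_of_eq ?_)
    have e : 2 * m * u ^ 2 / (a + ℓ R - a) ^ 2 = Real.log (6 / δ) := by
      rw [hu, mul_pow, Real.sq_sqrt (by positivity), add_sub_cancel_left]
      field_simp
    rw [e, Real.exp_neg, Real.exp_log (by positivity), inv_div]

/-- In a class with a single member the surrogate risk is an affine function of the mean margin of
that member, so that no union bound is needed. -/
theorem measure_risk_deviation_le_of_vcDim_eq_zero (hm : 0 < m) (h : LossBds ℓ) (hb : IsBinary H)
    (hV : FiniteVC H) (hmeas : ∀ h ∈ H, Measurable h) (hV0 : vcDim H = 0) (k : H) {δ : ℝ}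
    (hδ : 0 < δ) (hδ1 : δ ≤ 1) :
    (Measure.pi fun _ : Fin m => μ)
      {S | ¬ ∀ R, ∀ lam : Weights H, ‖lam‖ ≤ R → |risk ℓ μ lam - empRisk ℓ S lam|
        ≤ ℓ R / 2 * √(2 / m * Real.log (6 / δ))} ≤ ENNReal.ofReal (δ / 3) := by
  have hm' : (0 : ℝ) < m := by exact_mod_cast hm
  have hL0 : 0 ≤ Real.log (6 / δ) := Real.log_nonneg (by rw [le_div_iff₀ hδ]; linarith)
  set v := √(2 / m * Real.log (6 / δ)) with hv
  set s : X × Bool → ℝ := opA (unitWeight k) with hs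
  have hs1 : ∀ z, |s z| ≤ 1 := fun z => (hb.abs_opA_unitWeight k z).le
  have hsm : Measurable s := measurable_opA hb hmeas _
  have h1 := measure_exists_abs_deviation_le (μ := μ) hm (fun (_ : Unit) => s) (fun _ => hsm)
    (show (-1 : ℝ) < 1 by norm_num) (fun _ z => abs_le.1 (hs1 z)) (r := 0) (u := v)
    (fun S n g => by
      refine (radAvg_le_of_ncard (B := 1) (N := 1) _ (fun _ i => hs1 _) zero_le_one ?_).trans ?_
      · rw [Set.range_const, Set.ncard_singleton, Nat.cast_one]
      · simp) (Real.sqrt_nonneg _)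
  refine (measure_mono ?_).trans (h1.trans ?_)
  · intro S hS
    by_contra hcon
    simp only [mem_ofPred_eq, not_exists, not_le] at hcon
    have hdev : |∫ z, s z ∂μ - empMean s S| ≤ v := by have := hcon (); linarith
    refine hS fun R lam hlam => ?_
    have hlam' : lam = lam k • unitWeight k :=
      (Weights.hasSum_unitWeight lam).unique (hasSum_single k fun j hj =>
        absurd (eq_of_vcDim_eq_zero hb hV hV0 j k) hj)
    set w := lam k with hw
    have hwR : |w| ≤ R := by
      have := Weights.sum_abs_le lam {k}
      rw [Finset.sum_singleton] at this
      exact this.trans hlam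
    have hpt : ∀ z, ℓ (opA lam z) = (ℓ w + ℓ (-w)) / 2 + (ℓ w - ℓ (-w)) / 2 * s z := fun z => by
      have e : opA lam z = w * s z := by rw [hlam', opA_eq, opH_smul, hs, opA_eq]; ring
      rw [e]
      rcases sq_eq_sq_iff_eq_or_eq_neg.1 ((hb.opA_unitWeight_sq k z).trans (one_pow 2).symm)
        with e1 | e1 <;> rw [hs, e1]
      · rw [mul_one]; ring
      · rw [mul_neg_one]; ring
    have hr : risk ℓ μ lam = (ℓ w + ℓ (-w)) / 2 + (ℓ w - ℓ (-w)) / 2 * ∫ z, s z ∂μ := by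
      unfold risk
      simp_rw [hpt]
      rw [integral_add (integrable_const _) ((integrable_of_bdd hsm hs1).const_mul _),
        integral_const_mul, integral_const, probReal_univ, one_smul]
    have he : empRisk ℓ S lam = (ℓ w + ℓ (-w)) / 2 + (ℓ w - ℓ (-w)) / 2 * empMean s S := by
      rw [empRisk_eq]
      simp_rw [hpt]
      rw [empMean_add, empMean_const_mul]
      congr 1
      simp [empMean, hm'.ne']
    have hd : |(ℓ w - ℓ (-w)) / 2| ≤ ℓ R / 2 := by
      have h2 := h.monotone ((le_abs_self w).trans hwR)
      have h3 := h.monotone ((neg_le_abs w).trans hwR)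
      have h4 := h.nonneg w
      have h5 := h.nonneg (-w)
      rw [abs_le]; constructor <;> linarith
    rw [hr, he, show ∀ a b x y : ℝ, a + b * x - (a + b * y) = b * (x - y) by intros; ring, abs_mul]
    exact mul_le_mul hd hdev (abs_nonneg _) (by have := h.nonneg R; positivity)
  · have e : 2 * m * v ^ 2 / (1 - -1) ^ 2 = Real.log (6 / δ) := by
      rw [hv, Real.sq_sqrt (by positivity)]
      field_simp
      ring
    rw [e, Real.exp_neg, Real.exp_log (by positivity), inv_div,
      show (2 : ENNReal) = ENNReal.ofReal 2 by simp, ← ENNReal.ofReal_mul (by norm_num)]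
    exact ENNReal.ofReal_le_ofReal (le_of_eq (by ring))

/-- Uniform deviations of the surrogate risk above the empirical risk over one ball, and below it over
another. -/
theorem measure_risk_deviation_le (hm : 4 ≤ m) (h : LossBds ℓ) (h0 : 0 < ℓ 0)
    (hb : IsBinary H) (hV : FiniteVC H) (hne : H.Nonempty) (hH : PointwiseMeasurable H) {R R' : ℝ}
    (hR : 0 ≤ R) (hR' : 0 ≤ R') {δ : ℝ} (hδ : 0 < δ) (hδ1 : δ ≤ 1) :
    (Measure.pi fun _ : Fin m => μ)
      {S | ¬ ((∀ lam : Weights H, ‖lam‖ ≤ R → risk ℓ μ lam ≤ empRisk ℓ S lam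
          + 100 / 41 * lipConst ℓ * R * √(2 * vcDim H * Real.log (m + 1) / m)
          + ℓ R / 2 * √(2 / m * Real.log (6 / δ))) ∧
        (∀ lam : Weights H, ‖lam‖ ≤ R' → empRisk ℓ S lam ≤ risk ℓ μ lam
          + 100 / 41 * lipConst ℓ * R' * √(2 * vcDim H * Real.log (m + 1) / m)
          + ℓ R' / 2 * √(2 / m * Real.log (6 / δ))))} ≤ ENNReal.ofReal (δ / 3) := by
  have hm0 : 0 < m := by omega
  have hm' : (0 : ℝ) < m := by exact_mod_cast hm0
  obtain ⟨k, hk⟩ := hne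
  rcases Nat.eq_zero_or_pos (vcDim H) with hV0 | hVpos
  · refine (measure_mono ?_).trans
      (measure_risk_deviation_le_of_vcDim_eq_zero hm0 h hb hV hH.1 hV0 ⟨k, hk⟩ hδ hδ1)
    intro S hS
    by_contra hcon
    simp only [mem_ofPred_eq, not_not] at hcon
    refine hS ⟨fun lam hlam => ?_, fun lam hlam => ?_⟩
    · have := (abs_le.1 (hcon R lam hlam)).2
      rw [hV0]; simp only [Nat.cast_zero, mul_zero, zero_mul, zero_div, Real.sqrt_zero]; linarith
    · have := (abs_le.1 (hcon R' lam hlam)).1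
      rw [hV0]; simp only [Nat.cast_zero, mul_zero, zero_mul, zero_div, Real.sqrt_zero]; linarith
  · have e : ENNReal.ofReal (δ / 3) = ENNReal.ofReal (δ / 6) + ENNReal.ofReal (δ / 6) := by
      rw [← ENNReal.ofReal_add (by positivity) (by positivity)]; congr 1; ring
    have hsq : √(2 * Real.log (2 * (m + 1) ^ vcDim H) / m)
        ≤ 50 / 41 * √(2 * vcDim H * Real.log (m + 1) / m) := by
      have hV1 : (1 : ℝ) ≤ vcDim H := by exact_mod_cast hVpos
      have h4 : 9 * Real.log 2 ≤ 4 * Real.log (m + 1) := by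
        have h6 : (5 : ℝ) ≤ m + 1 := by
          have : (4 : ℝ) ≤ m := by exact_mod_cast hm
          linarith
        have h7 : Real.log ((2 : ℝ) ^ 9) ≤ Real.log (((m : ℝ) + 1) ^ 4) :=
          Real.log_le_log (by positivity)
            ((show (2 : ℝ) ^ 9 ≤ 5 ^ 4 by norm_num).trans (pow_le_pow_left₀ (by norm_num) h6 4))
        rw [Real.log_pow, Real.log_pow] at h7
        exact_mod_cast h7
      have h5 : Real.log (m + 1) ≤ vcDim H * Real.log (m + 1) :=
        le_mul_of_one_le_left (Real.log_nonneg (by linarith)) hV1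
      refine Real.sqrt_le_iff.2 ⟨by positivity, ?_⟩
      rw [mul_pow, Real.sq_sqrt (div_nonneg (by
        have : 0 ≤ Real.log ((m : ℝ) + 1) := Real.log_nonneg (by linarith)
        positivity) hm'.le), Real.log_mul two_ne_zero (by positivity), Real.log_pow, ← mul_div_assoc]
      refine div_le_div_of_nonneg_right ?_ hm'.le
      have := Real.log_pos one_lt_two
      nlinarith
    rw [e]
    have h1 := measure_exists_risk_deviation_le (μ := μ) hm0 h h0 hb hV ⟨k, hk⟩ hH hR
      (θ := 1) (by simp) hδ hδ1
    have h2 := measure_exists_risk_deviation_le (μ := μ) hm0 h h0 hb hV ⟨k, hk⟩ hH hR'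
      (θ := -1) (by simp) hδ hδ1
    refine (measure_mono ?_).trans ((measure_union_le _ _).trans (add_le_add h1 h2))
    intro S hS
    by_contra hcon
    simp only [mem_union, mem_ofPred_eq, not_or, not_not] at hcon
    have hsq' : ∀ R, 0 ≤ R → 2 * lipConst ℓ * R * √(2 * Real.log (2 * (m + 1) ^ vcDim H) / m)
        ≤ 100 / 41 * lipConst ℓ * R * √(2 * vcDim H * Real.log (m + 1) / m) := fun R hR => by
      have := mul_le_mul_of_nonneg_left hsq
        (show 0 ≤ 2 * lipConst ℓ * R by have := h.lipConst_pos; positivity)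
      linarith
    refine hS ⟨fun lam hlam => ?_, fun lam hlam => ?_⟩
    · have := hcon.1 lam hlam
      have := hsq' R hR
      linarith
    · have := hcon.2 lam hlam
      have := hsq' R' hR'
      linarith

end UniformDeviation

/-! ### Relative deviations of the classification risk -/

section ClassificationDeviation
variable {X : Type u} {H : Set (X → ℝ)} {m : ℕ}

theorem classErr_congr {f g : X → ℝ} {z : X × Bool} (h : 0 ≤ f z.1 ↔ 0 ≤ g z.1) :
    classErr f z = classErr g z := by
  simp only [classErr, ← not_le, h]

/-- The trace of a thresholded function on two samples determines its errors on both. -/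
theorem ncard_classErr_le (hb : IsBinary H) (hV : FiniteVC H) {d : ℕ} {ι : Type*} (f : ι → X → ℝ)
    (hf : ∀ k, ∃ (w : Fin (d + 1) → ℝ) (h : Fin (d + 1) → H), f k = fun x => ∑ j, w j * (h j).1 x)
    (x : (Fin m → X × Bool) × (Fin m → X × Bool)) :
    (Set.range fun k => ((fun i => classErr (f k) (x.1 i)),
      fun i => classErr (f k) (x.2 i))).ncard
      ≤ ((2 * m + 1) ^ vcDim H) ^ (d + 1) * (3 * (2 * m + 1) ^ d) := by
  classical
  have hcard := card_combination_trace_le hb hV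
    (Sum.elim (fun i : Fin m => (x.1 i).1) fun i : Fin m => (x.2 i).1) d
  rw [Fintype.card_sum, Fintype.card_fin, ← two_mul] at hcard
  set Φ := Finset.univ.filter fun A : Finset (Fin m ⊕ Fin m) =>
    ∃ (w : Fin (d + 1) → ℝ) (h : Fin (d + 1) → H), A = Finset.univ.filter fun i =>
      0 ≤ ∑ j, w j * (h j).1 (Sum.elim (fun i : Fin m => (x.1 i).1) (fun i : Fin m => (x.2 i).1) i)
  refine le_trans ?_ hcard
  rw [← Set.ncard_coe_finset]
  have hsub : (Set.range fun k => ((fun i => classErr (f k) (x.1 i)),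
      fun i => classErr (f k) (x.2 i))) ⊆
      (fun A : Finset (Fin m ⊕ Fin m) =>
        ((fun i => if ((x.1 i).2 = true ∧ Sum.inl i ∉ A) ∨ ((x.1 i).2 = false ∧ Sum.inl i ∈ A)
            then (1 : ℝ) else 0),
          fun i => if ((x.2 i).2 = true ∧ Sum.inr i ∉ A) ∨ ((x.2 i).2 = false ∧ Sum.inr i ∈ A)
            then (1 : ℝ) else 0)) '' (Φ : Set (Finset (Fin m ⊕ Fin m))) := by
    rintro _ ⟨k, rfl⟩
    obtain ⟨w, h, hk⟩ := hf k
    refine ⟨_, Finset.mem_coe.2 (Finset.mem_filter.2 ⟨Finset.mem_univ _, w, h, rfl⟩), ?_⟩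
    simp only [Finset.mem_filter, Finset.mem_univ, true_and, Sum.elim_inl, Sum.elim_inr, not_le,
      classErr, hk]
  exact (Set.ncard_le_ncard hsub (Set.toFinite _)).trans (Set.ncard_image_le (Set.toFinite _))

variable [MeasurableSpace X] {μ : Measure (X × Bool)} [IsProbabilityMeasure μ]

/-- Relative deviations of the classification risk, uniformly over all combinations of `d + 1`
members of the class. Since only the signs of a combination of binary functions matter, the weights
may be taken from a finite set, and the functions from the countable subclass. -/
theorem measure_classRisk_deviation_le (hm : 0 < m) (hb : IsBinary H) (hV : FiniteVC H)
    (hH : PointwiseMeasurable H) (d : ℕ) {Q : ℝ} (hQ : 0 < Q) :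
    (Measure.pi fun _ : Fin m => μ)
      {S | ¬ ∀ (w : Fin (d + 1) → ℝ) (h : Fin (d + 1) → H) (f : X → ℝ),
        (f = fun x => ∑ j, w j * (h j).1 x) →
        classRisk μ f ≤ empClassRisk S f + 2 * √(Q * empClassRisk S f) + 8 * Q ∧
        empClassRisk S f ≤ classRisk μ f + 2 * √(Q * empClassRisk S f)}
      ≤ ENNReal.ofReal (2 * ((m + 1) * ((((2 * m + 1) ^ vcDim H) ^ (d + 1)
          * (3 * (2 * m + 1) ^ d) : ℕ) * Real.exp (-(m * Q))))) := by
  obtain ⟨hmeas, H₀, hH₀, hcount, happ⟩ := hH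
  have := hcount.to_subtype
  set pat : (Fin (d + 1) → ℝ) → Set (Fin (d + 1) → Bool) := fun w =>
    {ε | 0 ≤ ∑ j, w j * sgn (ε j)} with hpat
  set F : (Fin (d + 1) → H₀) × Set.range pat → X → ℝ := fun k x =>
    ∑ j, k.2.2.choose j * (k.1 j).1 x with hF
  have hFm : ∀ k, Measurable (F k) := fun k =>
    Finset.measurable_sum _ fun j _ => (hmeas _ (hH₀ (k.1 j).2)).const_mul _
  have h1 := measure_exists_relative_deviation_le (μ := μ) hm (fun k => classErr (F k))
    (fun k => measurable_classErr (hFm k)) (fun k z => classErr_eq_zero_or_one _ z)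
    (fun x n g => Nat.cast_le.2 (ncard_classErr_le hb hV (fun k => F (g k))
      (fun k => ⟨(g k).2.2.choose, fun j => ⟨((g k).1 j).1, hH₀ ((g k).1 j).2⟩, rfl⟩) x))
    (Nat.cast_nonneg _) hQ
  refine (measure_mono ?_).trans h1
  intro S hS
  by_contra hcon
  simp only [mem_ofPred_eq, not_exists, not_or, not_lt, gt_iff_lt] at hcon
  refine hS fun w h f hf => ?_
  choose g hg hgt using fun j => happ (h j).1 (h j).2
  set fn : ℕ → X → ℝ := fun n x => ∑ j, w j * g j n x with hfn
  have hfnS : ∀ n, classRisk μ (fn n)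
        ≤ empClassRisk S (fn n) + 2 * √(Q * empClassRisk S (fn n)) + 8 * Q ∧
      empClassRisk S (fn n) ≤ classRisk μ (fn n) + 2 * √(Q * empClassRisk S (fn n)) := fun n => by
    have h2 := hcon (fun j => ⟨g j n, hg j n⟩, ⟨pat w, w, rfl⟩)
    have e : classErr (F (fun j => ⟨g j n, hg j n⟩, ⟨pat w, w, rfl⟩)) = classErr (fn n) := by
      funext z
      refine classErr_congr ?_
      have h3 : pat (Exists.choose (⟨w, rfl⟩ : ∃ y, pat y = pat w)) = pat w :=
        Exists.choose_spec (⟨w, rfl⟩ : ∃ y, pat y = pat w)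
      have h4 := Set.ext_iff.1 h3 fun j => decide (g j n z.1 = 1)
      have h5 : ∀ j, sgn (decide (g j n z.1 = 1)) = g j n z.1 := fun j => by
        rcases hb _ (hH₀ (hg j n)) z.1 with e | e <;> norm_num [e, sgn]
      simpa only [hpat, mem_ofPred_eq, h5] using h4
    rw [e] at h2
    exact h2
  have hlim : ∀ z, Tendsto (fun n => classErr (fn n) z) atTop (𝓝 (classErr f z)) := fun z => by
    refine tendsto_const_nhds.congr' ?_
    have h6 : ∀ j, ∀ᶠ n in atTop, g j n z.1 = (h j).1 z.1 := fun j => by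
      filter_upwards [(Metric.tendsto_nhds.1 (hgt j z.1)) 1 one_pos] with n hn
      rw [Real.dist_eq] at hn
      rcases hb _ (hH₀ (hg j n)) z.1 with e1 | e1 <;> rcases hb _ (h j).2 z.1 with e2 | e2 <;>
        rw [e1, e2] at hn ⊢ <;> norm_num at hn
    filter_upwards [eventually_all.2 h6] with n hn
    refine classErr_congr ?_
    rw [hf]
    simp only [hfn, hn]
  have hfnm : ∀ n, Measurable (fn n) := fun n =>
    Finset.measurable_sum _ fun j _ => (hmeas _ (hH₀ (hg j n))).const_mul _
  have hR : Tendsto (fun n => classRisk μ (fn n)) atTop (𝓝 (classRisk μ f)) :=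
    tendsto_integral_of_dominated_convergence (fun _ => 1)
      (fun n => (measurable_classErr (hfnm n)).aestronglyMeasurable) (integrable_const _)
      (fun n => ae_of_all _ fun z => abs_classErr_le _ _) (ae_of_all _ hlim)
  have hE : Tendsto (fun n => empClassRisk S (fn n)) atTop (𝓝 (empClassRisk S f)) :=
    empMean_tendsto hlim S
  have hs : Tendsto (fun n => 2 * √(Q * empClassRisk S (fn n))) atTop
      (𝓝 (2 * √(Q * empClassRisk S f))) := ((hE.const_mul Q).sqrt).const_mul 2
  exact ⟨le_of_tendsto_of_tendsto' hR ((hE.add hs).add_const _) fun n => (hfnS n).1,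
    le_of_tendsto_of_tendsto' hE (hR.add hs) fun n => (hfnS n).2⟩

theorem vcTerm_pos {a δ : ℝ} (V : ℕ) {T : ℕ} (hm : 0 < m) (hT : 0 < T) (hδ : 0 < δ)
    (hδ1 : δ ≤ 1) : 0 < vcTerm a δ V m T := by
  have hm' : (1 : ℝ) ≤ m := by exact_mod_cast hm
  have hT' : (0 : ℝ) < T := by exact_mod_cast hT
  have h1 : 0 < Real.log (24 / δ) := Real.log_pos (by rw [lt_div_iff₀ hδ]; linarith)
  have h2 : 0 ≤ Real.log (2 * Real.exp 1 * m) := Real.log_nonneg (by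
    have := Real.add_one_le_exp 1
    nlinarith)
  have h3 : 0 < max (T : ℝ) ((m : ℝ) ^ a) := lt_max_of_lt_left hT'
  unfold vcTerm
  positivity

/-- The quantity `Q` compensates the growth function on `2m` points of the thresholded
combinations and the union over the `m + 1` empirical means. -/
theorem growth_mul_exp_vcTerm_le {a δ : ℝ} (V d : ℕ) (hm : 0 < m) (hδ : 0 < δ) (hδ1 : δ ≤ 1) :
    2 * ((m + 1) * ((((2 * m + 1) ^ V) ^ (d + 1) * (3 * (2 * m + 1) ^ d) : ℕ)
      * Real.exp (-(m * vcTerm a δ V m (d + 1))))) ≤ δ / 3 := by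
  have hm' : (1 : ℝ) ≤ m := by exact_mod_cast hm
  have he : (2 : ℝ) ≤ Real.exp 1 := by have := Real.add_one_le_exp 1; linarith
  set E := 2 * Real.exp 1 * m with hE
  have hE2 : 2 * (m : ℝ) + 1 ≤ E := by rw [hE]; nlinarith
  have hE0 : 0 < E := by linarith
  have hlogE : 0 ≤ Real.log E := Real.log_nonneg (by linarith)
  have h24 : (1 : ℝ) ≤ 24 / δ := by rw [le_div_iff₀ hδ]; linarith
  have hQ : ((V + 1) * (d + 1) : ℕ) * Real.log E + Real.log (24 / δ)
      ≤ m * vcTerm a δ V m (d + 1) := by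
    have h1 : m * vcTerm a δ V m (d + 1) = ((V + 1) * Real.log E + Real.log (24 / δ))
        * max ((d + 1 : ℕ) : ℝ) ((m : ℝ) ^ a) := by
      unfold vcTerm; rw [← hE]; field_simp
    have h2 : ((d + 1 : ℕ) : ℝ) ≤ max ((d + 1 : ℕ) : ℝ) ((m : ℝ) ^ a) := le_max_left _ _
    have h3 := Real.log_nonneg h24
    have h4 : (1 : ℝ) ≤ ((d + 1 : ℕ) : ℝ) := by push_cast; linarith [Nat.cast_nonneg (α := ℝ) d]
    rw [h1]
    calc _ = (V + 1) * Real.log E * ((d + 1 : ℕ) : ℝ) + Real.log (24 / δ) := by push_cast; ring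
      _ ≤ (V + 1) * Real.log E * ((d + 1 : ℕ) : ℝ) + Real.log (24 / δ) * ((d + 1 : ℕ) : ℝ) := by
          gcongr; exact le_mul_of_one_le_right h3 h4
      _ = ((V + 1) * Real.log E + Real.log (24 / δ)) * ((d + 1 : ℕ) : ℝ) := by ring
      _ ≤ _ := by gcongr
  have hexp : Real.exp (-(m * vcTerm a δ V m (d + 1))) ≤ (E ^ ((V + 1) * (d + 1)))⁻¹ * (δ / 24) := by
    calc _ ≤ Real.exp (-(((V + 1) * (d + 1) : ℕ) * Real.log E + Real.log (24 / δ))) :=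
          Real.exp_le_exp.2 (neg_le_neg hQ)
      _ = _ := by
          rw [neg_add, Real.exp_add, Real.exp_neg, Real.exp_nat_mul, Real.exp_log hE0,
            Real.exp_neg, Real.exp_log (by positivity), inv_div]
  have hN : ((m : ℝ) + 1) * (((2 * m + 1) ^ V) ^ (d + 1) * (3 * (2 * m + 1) ^ d) : ℕ)
      ≤ 3 * E ^ ((V + 1) * (d + 1)) := by
    push_cast
    calc ((m : ℝ) + 1) * (((2 * m + 1) ^ V) ^ (d + 1) * (3 * (2 * m + 1) ^ d))
        ≤ (2 * m + 1) * (((2 * m + 1) ^ V) ^ (d + 1) * (3 * (2 * m + 1) ^ d)) := by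
          gcongr; linarith
      _ = 3 * (2 * (m : ℝ) + 1) ^ ((V + 1) * (d + 1)) := by ring
      _ ≤ _ := by gcongr
  calc _ = 2 * (((m : ℝ) + 1) * (((2 * m + 1) ^ V) ^ (d + 1) * (3 * (2 * m + 1) ^ d) : ℕ))
        * Real.exp (-(m * vcTerm a δ V m (d + 1))) := by ring
    _ ≤ 2 * (3 * E ^ ((V + 1) * (d + 1))) * ((E ^ ((V + 1) * (d + 1)))⁻¹ * (δ / 24)) := by gcongr
    _ = δ / 4 := by field_simp; ring
    _ ≤ δ / 3 := by linarith

end ClassificationDeviation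

section Iterates
variable {X : Type u} {H : Set (X → ℝ)} {ℓ : ℝ → ℝ} {m : ℕ} {S : Fin m → X × Bool}

/-- Iterates of `T` rounds are combinations of `T` weak learners. -/
theorem IsRun.exists_opH_eq (hb : IsBinary H) {ρ : ℝ} {T : ℕ} {lam : ℕ → Weights H}
    (hrun : IsRun ℓ S ρ T lam) :
    ∃ h : Fin T → H, ∀ i ≤ T, ∃ w : Fin T → ℝ, opH (lam i) = fun x => ∑ j, w j * (h j).1 x := by
  have hstep : ∀ j : Fin T, ∃ (h : H) (β : ℝ), lam (j + 1) = lam j + β • unitWeight h := fun j => by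
    obtain ⟨h, v, α, -, hv, -, -, -, e⟩ := hrun.2 j j.2
    rcases hv with rfl | rfl
    · exact ⟨h, α, e⟩
    · exact ⟨h, -α, by rw [e, smul_neg, neg_smul]⟩
  choose h β hβ using hstep
  refine ⟨h, fun i => ?_⟩
  induction i with
  | zero => exact fun _ => ⟨0, by funext x; simp [hrun.1, opH_zero]⟩
  | succ i ih =>
    intro hi
    obtain ⟨w, hw⟩ := ih (by omega)
    refine ⟨w + Pi.single ⟨i, hi⟩ (β ⟨i, hi⟩), funext fun x => ?_⟩
    have e := hβ ⟨i, hi⟩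
    simp only at e
    rw [e, opH_add hb, opH_smul, opH_unitWeight, hw]
    simp [add_mul, Finset.sum_add_distrib, Pi.single_apply]

end Iterates

/-! ### The constants and the sample size -/

section Constants
variable {ℓ : ℝ → ℝ} {τ P ρ : ℝ}

theorem B1_pos (htd : LossTd ℓ) (hτ : 0 < τ) (hc : 0 < cConst ℓ τ P)
    (hpos : ∀ z ∈ Icc (-cConst ℓ τ P) (cConst ℓ τ P), 0 < deriv (deriv ℓ) z) :
    0 < B1 ℓ τ P := by
  have hne : (Icc (-cConst ℓ τ P) (cConst ℓ τ P)).Nonempty := nonempty_Icc.2 (by linarith)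
  obtain ⟨z, hz, hmin⟩ := isCompact_Icc.exists_isMinOn hne
    htd.continuous_deriv_deriv.continuousOn
  have : deriv (deriv ℓ) z ≤ sInf (deriv (deriv ℓ) '' Icc (-cConst ℓ τ P) (cConst ℓ τ P)) :=
    le_csInf (hne.image _) (by rintro _ ⟨w, hw, rfl⟩; exact hmin hw)
  exact mul_pos (by positivity) ((hpos z hz).trans_le this)

/-- Integrating the curvature twice from `-c` to `0` bounds it by the value of the loss. -/
theorem four_mul_cConst_le_normBound_one (h : LossBds ℓ) (htd : LossTd ℓ) (h0 : 0 < ℓ 0)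
    (hτ : 0 < τ) (hτ1 : τ ≤ 1) (hρ : 0 < ρ) (hρ1 : ρ < 1) (hB : 0 < B1 ℓ τ P) :
    4 * cConst ℓ τ P ≤ normBound ℓ ρ τ P 1 := by
  set c := cConst ℓ τ P with hc
  have hc0 : 0 < c := cConst_pos h h0 hτ
  set I := sInf (deriv (deriv ℓ) '' Icc (-c) c) with hI
  have hBI : B1 ℓ τ P = τ / 8 * I := rfl
  have hI0 : 0 < I := by
    rw [hBI] at hB; exact pos_of_mul_pos_right hB (by positivity)
  have hcurv : I / 2 * c ^ 2 ≤ ℓ 0 := by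
    have hφ : ∀ s, HasDerivAt (fun s => ℓ (s - c)) (deriv ℓ (s - c)) s := fun s =>
      ((h.hasDerivAt (s - c)).comp s ((hasDerivAt_id s).sub_const c)).congr_deriv (by simp)
    have h1 := (strong_tangent_le hφ (α := c) (B := I / 2) hc0.le fun x hx y hy hxy => by
      have h2 := Convex.mul_sub_le_image_sub_of_le_deriv (convex_Icc (-c) c) (f := deriv ℓ) (C := I)
        (fun s _ => (htd.hasDerivAt_deriv s).continuousAt.continuousWithinAt)
        (fun s _ => (htd.hasDerivAt_deriv s).differentiableAt.differentiableWithinAt)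
        (fun s hs => csInf_le (bddBelow_deriv2_image h c) ⟨s, interior_subset hs, rfl⟩)
        (x - c) ⟨by linarith [hx.1], by linarith [hx.2]⟩ (y - c)
        ⟨by linarith [hy.1], by linarith [hy.2]⟩ (by linarith)
      linarith).1
    simp only [zero_sub, sub_self] at h1
    have h3 := h.nonneg (-c)
    have h4 := mul_nonneg (h.deriv_nonneg (-c)) hc0.le
    linarith
  set M := max 5 (2 * B1 ℓ τ P / gradLipConst ℓ) with hM
  have hM5 : 5 ≤ M := le_max_left _ _
  unfold normBound
  rw [Nat.cast_one, Real.sqrt_one, one_mul, ← hM]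
  refine Real.le_sqrt_of_sq_le ?_
  rw [le_div_iff₀ (by positivity)]
  have h5 : ρ ^ 2 ≤ 1 := pow_le_one₀ hρ.le hρ1.le
  have h6 : B1 ℓ τ P ≤ I / 8 := by rw [hBI]; nlinarith
  calc (4 * c) ^ 2 * (ρ ^ 2 * B1 ℓ τ P) ≤ (4 * c) ^ 2 * (1 * (I / 8)) := by gcongr
    _ = 4 * (I / 2 * c ^ 2) := by ring
    _ ≤ ℓ 0 * 5 := by linarith
    _ ≤ ℓ 0 * M := by gcongr

theorem log_six_div_le {δ : ℝ} (hδ : 0 < δ) (hδ1 : δ ≤ 1) :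
    1 ≤ Real.log (4 / δ) ∧ 0 ≤ Real.log (6 / δ) ∧
      Real.log (6 / δ) ≤ (3 / 2) * Real.log (4 / δ) := by
  have h2 := Real.log_two_gt_d9
  have h4 : 2 * Real.log 2 ≤ Real.log (4 / δ) := by
    have e : 2 * Real.log 2 = Real.log ((2 : ℝ) ^ 2) := by rw [Real.log_pow]; norm_num
    rw [e]
    exact Real.log_le_log (by norm_num) (by rw [le_div_iff₀ hδ]; linarith)
  have h6 : Real.log (6 / δ) = Real.log (3 / 2) + Real.log (4 / δ) := by
    rw [← Real.log_mul (by norm_num) (by positivity)]; congr 1; ring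
  have h7 := Real.log_le_sub_one_of_pos (show (0 : ℝ) < 3 / 2 by norm_num)
  have h8 : 0 ≤ Real.log (3 / 2 : ℝ) := Real.log_nonneg (by norm_num)
  refine ⟨by linarith, by linarith, by linarith⟩

/-- Consequences of the lower bounds on the sample size: the sample is not tiny, and the confidence
term `√(2 ln(6/δ) / m)`, multiplied by a bound on the loss, is dominated by the terms of the final
estimate. The latter holds trivially unless `2 β₂ R_t < 1`, in which case the loss is bounded by `1`
and `R_t ≥ 4 c √t` makes the confidence term small. -/
theorem SampleLarge.confidence_le (h : LossBds ℓ) (htd : LossTd ℓ) (h0 : 0 < ℓ 0) (hτ : 0 < τ)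
    (hτ1 : τ ≤ 1) (hτP : τ ≤ P) (hρ : 0 < ρ) (hρ1 : ρ < 1) (hB : 0 < B1 ℓ τ P) {δ : ℝ} (hδ : 0 < δ)
    (hδ1 : δ ≤ 1) {V m t : ℕ} (ht : 0 < t) (hm : 0 < m) (hS : SampleLarge ℓ ρ τ P δ V m t) :
    4 ≤ m ∧ ℓ (normBound ℓ ρ τ P t) * √(2 / m * Real.log (6 / δ))
      ≤ 1 / 10 * (t : ℝ) ^ (-(1 / 4) : ℝ) + 2 * lipConst ℓ * normBound ℓ ρ τ P t *
        (ℓ (normBound ℓ ρ τ P t) * √(2 / m * Real.log (6 / δ))) := by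
  obtain ⟨hl4, hl6, hl46⟩ := log_six_div_le hδ hδ1
  have hm' : (0 : ℝ) < m := by exact_mod_cast hm
  have ht' : (1 : ℝ) ≤ t := by exact_mod_cast ht
  have hb2 := h.lipConst_pos
  set c := cConst ℓ τ P with hc
  have hc0 : 0 < c := cConst_pos h h0 hτ
  set R := normBound ℓ ρ τ P t with hR
  have hRt : 4 * c * √(t : ℝ) ≤ R := by
    rw [hR, normBound_eq, mul_comm]
    exact mul_le_mul_of_nonneg_left
      (four_mul_cConst_le_normBound_one h htd h0 hτ hτ1 hρ hρ1 hB) (Real.sqrt_nonneg _)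
  have hst : 1 ≤ √(t : ℝ) := Real.one_le_sqrt.2 ht'
  have hR0 : 0 ≤ R := normBound_nonneg _ _ _ _
  have hR4 : 4 * c ≤ R := le_trans (le_mul_of_one_le_right (by positivity) hst) hRt
  have hP : 0 < P := hτ.trans_le hτP
  set s := √(2 * Real.log (4 / δ)) / √(m : ℝ) with hs
  have hs0 : 0 ≤ s := by positivity
  have hsmall : s * √(t : ℝ) ≤ 1 / 64 := by
    have h1 : 2 * R * P * s ≤ c * τ ^ 2 / 8 := by
      refine le_trans ?_ hS.2
      rw [← hc, ← hR]
      calc 2 * R * P * s = 2 * R * P / √(m : ℝ) * (0 + √(2 * Real.log (4 / δ))) := by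
            rw [hs]; ring
        _ ≤ _ := by
            have : 0 ≤ 2 * √(2 * V * Real.log ((m : ℝ) + 1)) := by positivity
            gcongr
            linarith
    have h2 : 8 * c * τ * (s * √(t : ℝ)) ≤ 8 * c * τ * (1 / 64) := by
      calc 8 * c * τ * (s * √(t : ℝ)) = 2 * (4 * c * √(t : ℝ)) * τ * s := by ring
        _ ≤ 2 * R * P * s := by gcongr
        _ ≤ c * τ ^ 2 / 8 := h1
        _ ≤ _ := by nlinarith [mul_pos hc0 hτ]
    exact le_of_mul_le_mul_left h2 (by positivity)
  have hs64 : s ≤ 1 / 64 := (le_mul_of_one_le_right hs0 hst).trans hsmall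
  have hs2 : s ^ 2 = 2 * Real.log (4 / δ) / m := by
    rw [hs, div_pow, Real.sq_sqrt (by linarith), Real.sq_sqrt hm'.le]
  constructor
  · have h1 : s ^ 2 ≤ 1 / 2 := by nlinarith
    rw [hs2, div_le_iff₀ hm'] at h1
    have : (4 : ℝ) ≤ m := by linarith
    exact_mod_cast this
  set w := √(2 / m * Real.log (6 / δ)) with hw
  have hw0 : 0 ≤ w := Real.sqrt_nonneg _
  have hws : w ≤ 3 / 2 * s := by
    refine Real.sqrt_le_iff.2 ⟨by positivity, ?_⟩
    rw [mul_pow, hs2, div_mul_eq_mul_div, ← mul_div_assoc]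
    exact div_le_div_of_nonneg_right (by nlinarith) hm'.le
  have hK0 : 0 ≤ ℓ R := h.nonneg R
  have hRpos : 0 < R := by linarith
  set x := (t : ℝ) ^ (1 / 4 : ℝ) with hx
  have hx1 : 1 ≤ x := Real.one_le_rpow ht' (by norm_num)
  have hxinv : (t : ℝ) ^ (-(1 / 4) : ℝ) = x⁻¹ := Real.rpow_neg (by linarith) _
  have hsq : √(t : ℝ) = x ^ 2 := by
    rw [hx, Real.sqrt_eq_rpow, ← Real.rpow_natCast, ← Real.rpow_mul (by linarith)]; norm_num
  rw [hxinv]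
  have hxi0 : 0 ≤ x⁻¹ := by positivity
  rcases le_or_gt 1 (2 * lipConst ℓ * R) with hY | hY
  · have := le_mul_of_one_le_left (mul_nonneg hK0 hw0) hY
    linarith
  · have h1 : ℓ R ≤ 1 := by
      have h2 := h.le_zero_add hR0
      have h3 : ℓ 0 ≤ lipConst ℓ * R := by
        have h4 := (le_cConst (P := P) h hτ).2
        rw [← hc] at h4
        have hd := h.deriv_zero_pos
        have h5 : ℓ 0 / deriv ℓ 0 ≤ c * τ / 16 := by
          have : τ * (ℓ 0 / deriv ℓ 0) ≤ τ * (c * τ / 16) := by linarith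
          exact le_of_mul_le_mul_left this hτ
        rw [div_le_iff₀ hd] at h5
        calc ℓ 0 ≤ c * τ / 16 * deriv ℓ 0 := h5
          _ ≤ R * lipConst ℓ := by
              have : c * τ / 16 ≤ R := by nlinarith
              exact mul_le_mul this (h.deriv_le 0) hd.le hR0
          _ = _ := mul_comm _ _
      linarith
    have h2 : w ≤ 1 / 10 * x⁻¹ := by
      rw [← div_eq_mul_inv, le_div_iff₀ (by linarith)]
      have h3 : x ≤ √(t : ℝ) := by rw [hsq]; nlinarith
      calc w * x ≤ 3 / 2 * s * √(t : ℝ) := by gcongr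
        _ ≤ 1 / 10 := by linarith
    have h3 : ℓ R * w ≤ 1 * w := mul_le_mul_of_nonneg_right h1 hw0
    have h4 : 0 ≤ 2 * lipConst ℓ * R * (ℓ R * w) := by positivity
    linarith

/-- The lower bounds on the sample size hold eventually, uniformly over the admissible numbers of
rounds. -/
theorem eventually_sampleLarge (ℓ : ℝ → ℝ) (ρ τ P : ℝ) (hτ : 0 < τ) (hP : 0 ≤ P)
    (hc : 0 < cConst ℓ τ P) {a δ : ℝ} (ha0 : 0 < a) (ha : a < 1) (V : ℕ) :
    ∀ᶠ m : ℕ in atTop, ∀ t : ℕ, (t : ℝ) ≤ (m : ℝ) ^ a → SampleLarge ℓ ρ τ P δ V m t := by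
  set c := cConst ℓ τ P with hcdef
  set R1 := normBound ℓ ρ τ P 1 with hR1
  have hR10 : 0 ≤ R1 := normBound_nonneg _ _ _ _
  set b := (1 - a) / 2 with hb
  have hb0 : 0 < b := by rw [hb]; linarith
  set L := √(2 * Real.log (4 / δ)) with hL
  have hL0 : 0 ≤ L := Real.sqrt_nonneg _
  set C := 2 * (R1 + 2 * c) * P * (2 * √(2 * V * (2 ^ b / b)) + L) with hC
  have hlim : Tendsto (fun m : ℕ => C * (m : ℝ) ^ (-(b / 2))) atTop (𝓝 0) := by
    have := ((tendsto_rpow_neg_atTop (show 0 < b / 2 by positivity)).comp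
      (tendsto_natCast_atTop_atTop (R := ℝ))).const_mul C
    simpa [Function.comp_def] using this
  filter_upwards [tendsto_natCast_atTop_atTop.eventually_ge_atTop (2 / τ ^ 2 * Real.log (4 / δ)),
    hlim.eventually_lt_const (show 0 < c * τ ^ 2 / 8 by positivity), eventually_ge_atTop 1]
    with m hm1 hm2 hm3 t ht
  refine ⟨hm1, le_trans ?_ hm2.le⟩
  have hm' : (1 : ℝ) ≤ m := by exact_mod_cast hm3
  have hm0 : (0 : ℝ) < m := by linarith
  rw [← hcdef, ← hL]
  set x := (m : ℝ) ^ (b / 2) with hx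
  have hx1 : 1 ≤ x := Real.one_le_rpow hm' (by positivity)
  have hx0 : 0 < x := by linarith
  have hxb : (m : ℝ) ^ b = x ^ 2 := by
    rw [hx, ← Real.rpow_natCast, ← Real.rpow_mul hm0.le]; congr 1; push_cast; ring
  set y := (m : ℝ) ^ (a / 2) with hy
  have hy1 : 1 ≤ y := Real.one_le_rpow hm' (by positivity)
  have hsm : √(m : ℝ) = y * x ^ 2 := by
    rw [← hxb, hy, ← Real.rpow_add hm0, Real.sqrt_eq_rpow]; congr 1; rw [hb]; ring
  have hRt : normBound ℓ ρ τ P t + 2 * c ≤ y * (R1 + 2 * c) := by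
    have h1 : √(t : ℝ) ≤ y := by
      refine Real.sqrt_le_iff.2 ⟨by positivity, ht.trans_eq ?_⟩
      rw [hy, ← Real.rpow_natCast, ← Real.rpow_mul hm0.le]; congr 1; push_cast; ring
    rw [normBound_eq, ← hR1, mul_add]
    exact add_le_add (mul_le_mul_of_nonneg_right h1 hR10)
      (le_mul_of_one_le_left (by positivity) hy1)
  have hlog : √(2 * V * Real.log (m + 1)) ≤ √(2 * V * (2 ^ b / b)) * x := by
    refine Real.sqrt_le_iff.2 ⟨by positivity, ?_⟩
    rw [mul_pow, Real.sq_sqrt (by positivity), ← hxb, mul_assoc (2 * (V : ℝ))]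
    refine mul_le_mul_of_nonneg_left ?_ (by positivity)
    calc Real.log (m + 1) ≤ ((m : ℝ) + 1) ^ b / b := Real.log_le_rpow_div (by positivity) hb0
      _ ≤ (2 * m : ℝ) ^ b / b := by gcongr; linarith
      _ = _ := by rw [Real.mul_rpow two_pos.le hm0.le]; ring
  rw [Real.rpow_neg hm0.le, ← hx, hsm]
  calc _ ≤ 2 * (y * (R1 + 2 * c)) * P / (y * x ^ 2)
        * (2 * (√(2 * V * (2 ^ b / b)) * x) + L * x) := by
        have := le_mul_of_one_le_right hL0 hx1
        gcongr
    _ = C * x⁻¹ := by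
        have : y ≠ 0 := by positivity
        rw [hC]; field_simp

end Constants

/-! ### Probability of the three good events -/

section Main
variable {X : Type u} [MeasurableSpace X] {μ : Measure (X × Bool)} {H : Set (X → ℝ)} {ℓ : ℝ → ℝ}
  {m : ℕ}

/-- The bound on the surrogate risk, from the empirical convergence rate and the uniform
deviations. -/
theorem surrogateBound_of_deviation {S : Fin m → X × Bool} {q : X × Bool → ℝ} {τ P ρ δ : ℝ}
    {t T : ℕ} {lam : ℕ → Weights H} (hm : 0 < m) (h : LossBds ℓ) (htd : LossTd ℓ)
    (hb : IsBinary H) (h0 : 0 < ℓ 0) (hτ : 0 < τ) (hτ1 : τ ≤ 1) (hρ : 0 < ρ) (hρ1 : ρ < 1)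
    (hB : 0 < B1 ℓ τ P) (ht : 0 < t)
    (hS : IsCurvedSample H S q τ P (cConst ℓ τ P) (normBound ℓ ρ τ P t))
    (hrun : IsRun ℓ S ρ T lam) (htT : t ≤ T)
    (hconf : ℓ (normBound ℓ ρ τ P t) * √(2 / m * Real.log (6 / δ))
      ≤ 1 / 10 * (t : ℝ) ^ (-(1 / 4) : ℝ) + 2 * lipConst ℓ * normBound ℓ ρ τ P t *
        (ℓ (normBound ℓ ρ τ P t) * √(2 / m * Real.log (6 / δ))))
    (hdev : ∀ lam : Weights H, ‖lam‖ ≤ 16 / 25 * normBound ℓ ρ τ P t →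
      risk ℓ μ lam ≤ empRisk ℓ S lam
        + 100 / 41 * lipConst ℓ * (16 / 25 * normBound ℓ ρ τ P t)
          * √(2 * vcDim H * Real.log (m + 1) / m)
        + ℓ (16 / 25 * normBound ℓ ρ τ P t) / 2 * √(2 / m * Real.log (6 / δ)))
    (hdev' : ∀ lam : Weights H, ‖lam‖ ≤ normBound ℓ ρ τ P (t - 1) →
      empRisk ℓ S lam ≤ risk ℓ μ lam
        + 100 / 41 * lipConst ℓ * normBound ℓ ρ τ P (t - 1)
          * √(2 * vcDim H * Real.log (m + 1) / m)
        + ℓ (normBound ℓ ρ τ P (t - 1)) / 2 * √(2 / m * Real.log (6 / δ)))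
    (lb : Weights H) (hlb : ‖lb‖ ≤ normBound ℓ ρ τ P (t - 1)) :
    SurrogateBound ℓ μ ρ τ P δ m t (lam t) lb := by
  have hm' : (0 : ℝ) < m := by exact_mod_cast hm
  have hmono := normBound_mono (ℓ := ℓ) (ρ := ρ) (τ := τ) (P := P) (Nat.sub_le t 1)
  obtain ⟨hnorm, hconv⟩ := hS.empRisk_run_le hm h htd hb h0 hτ hτ1 hρ hρ1 hB ht hrun htT lb
    (hlb.trans hmono)
  have h1 := hdev _ hnorm
  have h2 := hdev' _ hlb
  unfold SurrogateBound
  set R := normBound ℓ ρ τ P t with hR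
  have hR0 : 0 ≤ R := normBound_nonneg _ _ _ _
  have hb2 := h.lipConst_pos
  set w := √(2 / m * Real.log (6 / δ)) with hw
  set γ := √(2 * vcDim H * Real.log (m + 1) / m) with hγ
  have hw0 : 0 ≤ w := Real.sqrt_nonneg _
  have hγ0 : 0 ≤ γ := Real.sqrt_nonneg _
  have e1 : 2 * lipConst ℓ * R / √(m : ℝ) * (2 * √(2 * vcDim H * Real.log (m + 1))
      + ℓ R * √(2 * Real.log (6 / δ))) = 4 * lipConst ℓ * R * γ + 2 * lipConst ℓ * R * (ℓ R * w) := by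
    rw [hγ, hw, Real.sqrt_div' _ hm'.le, div_mul_eq_mul_div 2 (m : ℝ), Real.sqrt_div' _ hm'.le]
    ring
  rw [e1]
  have h3 : ℓ (16 / 25 * R) ≤ ℓ R := h.monotone (by linarith)
  have h4 : ℓ (normBound ℓ ρ τ P (t - 1)) ≤ ℓ R := h.monotone hmono
  have h5 := mul_le_mul_of_nonneg_right h3 hw0
  have h6 := mul_le_mul_of_nonneg_right h4 hw0
  have h7 : lipConst ℓ * normBound ℓ ρ τ P (t - 1) * γ ≤ lipConst ℓ * R * γ := by gcongr
  have h8 : 0 ≤ normBound ℓ ρ τ P (t - 1) * w := mul_nonneg (normBound_nonneg _ _ _ _) hw0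
  linarith

variable [IsProbabilityMeasure μ]

/-- Probability of failure of the surrogate bound or of the bound on the classification risk. -/
theorem measure_not_bounds_le (h : LossBds ℓ) (htd : LossTd ℓ) (hb : IsBinary H) (hV : FiniteVC H)
    (hH : PointwiseMeasurable H) (h0 : 0 < ℓ 0) {p : Lp ℝ ⊤ μ} (hp : IsDualOptimum ℓ μ H p)
    {τ ρ a δ : ℝ} (hτ : 0 < τ) (hμ : τ ≤ μ.real {z | τ ≤ p z}) (hB : 0 < B1 ℓ τ ‖p‖)
    (hρ : 0 < ρ) (hρ1 : ρ < 1) (hδ : 0 < δ) (hδ1 : δ ≤ 1) {t T : ℕ} (hm : 0 < m) (ht : 0 < t)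
    (htT : t ≤ T) (hlarge : SampleLarge ℓ ρ τ ‖p‖ δ (vcDim H) m t) :
    (Measure.pi fun _ : Fin m => μ)
      {S | ¬ ∀ lam : ℕ → Weights H, IsRun ℓ S ρ T lam →
        (∀ lb : Weights H, ‖lb‖ ≤ normBound ℓ ρ τ ‖p‖ (t - 1) →
          SurrogateBound ℓ μ ρ τ ‖p‖ δ m t (lam t) lb) ∧
        (∀ out : Weights H, IsOutput S T lam out →
          classRisk μ (opH out) ≤ classRisk μ (opH (lam t))
            + 4 * √(empClassRisk S (opH (lam t)) * vcTerm a δ (vcDim H) m T)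
            + 8 * vcTerm a δ (vcDim H) m T)} ≤ ENNReal.ofReal δ := by
  obtain ⟨hτP, hτ1⟩ := le_norm_of_le_measure hp hτ hμ
  obtain ⟨d, rfl⟩ : ∃ d, T = d + 1 := ⟨T - 1, by omega⟩
  rcases H.eq_empty_or_nonempty with hem | hne
  · have : {S : Fin m → X × Bool | ¬ ∀ lam : ℕ → Weights H, IsRun ℓ S ρ (d + 1) lam →
        (∀ lb : Weights H, ‖lb‖ ≤ normBound ℓ ρ τ ‖p‖ (t - 1) →
          SurrogateBound ℓ μ ρ τ ‖p‖ δ m t (lam t) lb) ∧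
        (∀ out : Weights H, IsOutput S (d + 1) lam out →
          classRisk μ (opH out) ≤ classRisk μ (opH (lam t))
            + 4 * √(empClassRisk S (opH (lam t)) * vcTerm a δ (vcDim H) m (d + 1))
            + 8 * vcTerm a δ (vcDim H) m (d + 1))} = ∅ := by
      refine eq_empty_of_forall_notMem fun S hS => hS fun lam hrun => ?_
      obtain ⟨k, -⟩ := hrun.2 0 (by omega)
      exact absurd k.2 (by simp [hem])
    rw [this]; simp
  obtain ⟨hm4, hconf⟩ := hlarge.confidence_le h htd h0 hτ hτ1 hτP hρ hρ1 hB hδ hδ1 ht hm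
  set Q := vcTerm a δ (vcDim H) m (d + 1) with hQdef
  have hQ : 0 < Q := vcTerm_pos _ hm (Nat.succ_pos d) hδ hδ1
  have h1 := measure_not_isCurvedSample_le hm h h0 hb hV hH hp hτ hμ hδ hδ1 hlarge
  have hR0 := normBound_nonneg (ℓ := ℓ) ρ τ ‖p‖ t
  have h2 := measure_risk_deviation_le (μ := μ) hm4 h h0 hb hV hne hH
    (R := 16 / 25 * normBound ℓ ρ τ ‖p‖ t) (R' := normBound ℓ ρ τ ‖p‖ (t - 1)) (by positivity)
    (normBound_nonneg _ _ _ _) hδ hδ1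
  have h3 := (measure_classRisk_deviation_le (μ := μ) hm hb hV hH d hQ).trans
    (ENNReal.ofReal_le_ofReal (growth_mul_exp_vcTerm_le _ d hm hδ hδ1))
  have e : ENNReal.ofReal δ = ENNReal.ofReal (δ / 3) + ENNReal.ofReal (δ / 3)
      + ENNReal.ofReal (δ / 3) := by
    rw [← ENNReal.ofReal_add (by positivity) (by positivity),
      ← ENNReal.ofReal_add (by positivity) (by positivity)]
    congr 1; ring
  rw [e]
  refine (measure_mono ?_).trans ((measure_union_le _ _).trans
    (add_le_add ((measure_union_le _ _).trans (add_le_add h1 h2)) h3))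
  intro S hS
  by_contra hcon
  simp only [mem_union, mem_ofPred_eq, not_or, not_not] at hcon
  obtain ⟨⟨⟨q, hq⟩, hdev, hdev'⟩, hcls⟩ := hcon
  refine hS fun lam hrun => ⟨fun lb hlb => surrogateBound_of_deviation hm h htd hb h0 hτ hτ1 hρ hρ1
    hB ht hq hrun htT hconf hdev hdev' lb hlb, fun out hout => ?_⟩
  obtain ⟨k, hk⟩ := hrun.exists_opH_eq hb
  obtain ⟨⟨j, hj, rfl⟩, hmin⟩ := hout
  obtain ⟨wj, hwj⟩ := hk j (Finset.mem_Icc.1 hj).2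
  obtain ⟨wt, hwt⟩ := hk t htT
  have h4 := (hcls wj k _ hwj).1
  have h5 := (hcls wt k _ hwt).2
  have h6 := hmin t (Finset.mem_Icc.2 ⟨ht, htT⟩)
  have h7 : √(Q * empClassRisk S (opH (lam j))) ≤ √(Q * empClassRisk S (opH (lam t))) :=
    Real.sqrt_le_sqrt (mul_le_mul_of_nonneg_left h6 hQ.le)
  rw [mul_comm (empClassRisk S (opH (lam t)))]
  linarith

end Main

end Boost

theorem mainTheorem3 (ℓ : ℝ → ℝ) (hbds : LossBds ℓ) (htd : LossTd ℓ) :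
    ∃ ψ : ℝ → ℝ, IsCalibration ψ ∧ (ℓ = logisticLoss → ∀ z, ψ z = z ^ 2 / 2) ∧
      ∀ (X : Type u) [MeasurableSpace X] (μ : Measure (X × Bool)) [IsProbabilityMeasure μ]
        (H : Set (X → ℝ)), IsBinary H → FiniteVC H → PointwiseMeasurable H →
        0 < optRisk ℓ μ H →
        (∃ p : Lp ℝ ⊤ μ, IsDualOptimum ℓ μ H p) ∧
        ∀ p : Lp ℝ ⊤ μ, IsDualOptimum ℓ μ H p →
          (0 < dualLevel ℓ μ H ∧ dualLevel ℓ μ H ≤ μ.real {z | dualLevel ℓ μ H ≤ p z}) ∧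
          ∀ τ : ℝ, 0 < τ → τ ≤ μ.real {z | τ ≤ p z} →
            (∀ z ∈ Icc (-cConst ℓ τ ‖p‖) (cConst ℓ τ ‖p‖), 0 < deriv (deriv ℓ) z) →
          ∀ ρ a δ : ℝ, ρ ∈ Ioo 0 1 → a ∈ Ioo 0 1 → δ ∈ Ioc 0 1 →
            (0 < cConst ℓ τ ‖p‖ ∧ 0 < B1 ℓ τ ‖p‖ ∧
              ∀ i : ℕ, 0 < i → 0 < normBound ℓ ρ τ ‖p‖ i) ∧
            (∀ᶠ m : ℕ in atTop, ∀ t : ℕ, (t : ℝ) ≤ (m : ℝ) ^ a →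
              SampleLarge ℓ ρ τ ‖p‖ δ (vcDim H) m t) ∧
            ∀ m t T : ℕ, 1 ≤ t → (t : ℝ) ≤ (m : ℝ) ^ a → t ≤ T → T ≤ ⌈(m : ℝ) ^ a⌉₊ →
              SampleLarge ℓ ρ τ ‖p‖ δ (vcDim H) m t →
              (Measure.pi fun _ : Fin m => μ)
                {S | ¬ ∀ lam : ℕ → Weights H, IsRun ℓ S ρ T lam →
                  (∀ lb : Weights H, ‖lb‖ ≤ normBound ℓ ρ τ ‖p‖ (t - 1) →
                    SurrogateBound ℓ μ ρ τ ‖p‖ δ m t (lam t) lb) ∧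
                  (DenseClass H (μ.map Prod.fst) →
                    ψ (classRisk μ (opH (lam t)) - bayesRisk μ)
                      ≤ risk ℓ μ (lam t) - optRisk ℓ μ H) ∧
                  (∀ out : Weights H, IsOutput S T lam out →
                    classRisk μ (opH out) ≤ classRisk μ (opH (lam t))
                      + 4 * √(empClassRisk S (opH (lam t)) * vcTerm a δ (vcDim H) m T)
                      + 8 * vcTerm a δ (vcDim H) m T)}
                ≤ ENNReal.ofReal δ := by
  refine ⟨calib ℓ, hbds.isCalibration_calib, fun e z => ?_, ?_⟩
  · subst e
    exact calib_logisticLoss hbds z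
  intro X _ μ _ H hb hV hH hopt
  have h0 : 0 < ℓ 0 := by
    have h1 := optRisk_le (μ := μ) hbds (0 : Weights H)
    rw [risk_zero] at h1
    linarith
  refine ⟨exists_isDualOptimum hbds hb hH.1, fun p hp =>
    ⟨dualLevel_spec hbds hb hH.1 hopt hp, fun τ hτ hμ hcurv ρ a δ hρ ha hδ => ?_⟩⟩
  have hc := cConst_pos (P := ‖p‖) hbds h0 hτ
  have hB := B1_pos htd hτ hc hcurv
  refine ⟨⟨hc, hB, fun i hi => normBound_pos h0 hρ.1 hB hi⟩,
    eventually_sampleLarge ℓ ρ τ ‖p‖ hτ (norm_nonneg _) hc ha.1 ha.2 _,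
    fun m t T ht hta htT _ hlarge => ?_⟩
  have hm : 0 < m := by
    rcases Nat.eq_zero_or_pos m with rfl | hm
    · have h1 : (1 : ℝ) ≤ t := by exact_mod_cast ht
      rw [Nat.cast_zero, Real.zero_rpow ha.1.ne'] at hta
      linarith
    · exact hm
  refine (measure_mono ?_).trans
    (measure_not_bounds_le (a := a) hbds htd hb hV hH h0 hp hτ hμ hB hρ.1 hρ.2 hδ.1 hδ.2 hm ht htT
      hlarge)
  intro S hS hall
  refine hS fun lam hrun => ?_
  exact ⟨(hall lam hrun).1, fun hd => calib_classRisk_sub_le hbds hb hH.1 hd _, (hall lam hrun).2⟩
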